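/- Let $M\subseteq \mathbb{B}(H)$ and $N\subseteq\mathbb{B}(K)$ be unital dual operator algebras, that is, $w^*$-closed subalgebras containing the identity operator, with $H\neq\{0\}$; the $w^*$-topology is the $\sigma$-weak topology. Let $(M\otimes_h M)^*_\sigma$ be the space of completely bounded, separately $w^*$-continuous bilinear forms on $M\times M$ with the cb-norm, and let $M\otimes_{\sigma h}M=\bigl((M\otimes_h M)^*_\sigma\bigr)^*$ be the normal Haagerup tensor product. Suppose that $M$ has a normal virtual $h$-diagonal $u$: an element $u\in M\otimes_{\sigma h}M$ such that $m\cdot u=u\cdot m$ for all $m\in M$ and $\mathrm{m}_{\sigma h}(u)=1$. Here the $M$-bimodule structure of $M\otimes_{\sigma h}M$ is $\langle a\cdot u\cdot b,\psi\rangle=\langle u,\ (c,d)\mapsto\psi(ac,db)\rangle$, and $\mathrm{m}_{\sigma h}:M\otimes_{\sigma h}M\to M$ is the $w^*$-continuous extension of the multiplication, $\langle \mathrm{m}_{\sigma h}(u),\varphi\rangle=\langle u,\ (c,d)\mapsto\varphi(cd)\rangle$ for $w^*$-continuous functionals $\varphi$ on $M$. For a linear map $L:M\to N$ put $L^\vee(x,y)=L(xy)-L(x)L(y)$.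 The cb-norm of a bilinear map $B$ on $M\times M$ is $\|B\|_{cb}=\sup_n\|B_n\|$, where $B_n(x,y)_{ij}=\sum_k B(x_{ik},y_{kj})$ for $n\times n$ matrices $x,y$ over $M$. Then for every $\varepsilon\in(0,1)$ and every $\mu>0$ the number $$\delta=\frac{\varepsilon}{4\|u\|+8\mu^2\|u\|^2}>0$$ has the following property: for every unital $w^*$-continuous linear map $L:M\to N$ with $\|L\|_{cb}\le\mu$ and $\|L^\vee\|_{cb}\le\delta$ there is a unital $w^*$-continuous completely bounded algebra homomorphism $\pi:M\to N$ such that $\|L-\pi\|_{cb}\le\varepsilon$. -/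

import Mathlib

set_option maxSynthPendingDepth 3

open scoped ENNReal InnerProductSpace Topology

noncomputable section

namespace DualOpAlg

variable {H : Type*} [NormedAddCommGroup H] [InnerProductSpace ℂ H]
variable {K : Type*} [NormedAddCommGroup K] [InnerProductSpace ℂ K]

/-! ### The weak-star topology of `B(H)` -/

/-- The weak-star (that is, `σ`-weak) topology on `B(H)`, the dual of the trace class operators:
the coarsest topology for which all functionals `T ↦ ∑ₙ ⟪ηₙ, T ξₙ⟫` with `∑ ‖ξₙ‖² < ∞` and
`∑ ‖ηₙ‖² < ∞` are continuous. -/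
@[reducible]
def wstarTopology (H : Type*) [NormedAddCommGroup H] [InnerProductSpace ℂ H] :
    TopologicalSpace (H →L[ℂ] H) :=
  ⨅ p : {p : (ℕ → H) × (ℕ → H) //
      (Summable fun n => ‖p.1 n‖ ^ 2) ∧ Summable fun n => ‖p.2 n‖ ^ 2},
    TopologicalSpace.induced (fun T : H →L[ℂ] H => ∑' n, ⟪p.1.2 n, T (p.1.1 n)⟫_ℂ) inferInstance

/-- A unital subalgebra of `B(H)` (it contains the identity operator) is a unital dual operator
algebra when it is weak-star closed in `B(H)`. -/
def IsDualOperatorAlgebra (M : Subalgebra ℂ (H →L[ℂ] H)) : Prop :=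
  IsClosed[wstarTopology H] (M : Set (H →L[ℂ] H))

/-- The weak-star topology of a subalgebra of `B(H)`, induced from that of `B(H)`. -/
@[reducible]
def wstar (M : Subalgebra ℂ (H →L[ℂ] H)) : TopologicalSpace M :=
  TopologicalSpace.induced (fun a : M => (a : H →L[ℂ] H)) (wstarTopology H)

/-- Weak-star continuity of a map between two subalgebras. -/
def WStarContinuous {M : Subalgebra ℂ (H →L[ℂ] H)} {N : Subalgebra ℂ (K →L[ℂ] K)}
    (f : M → N) : Prop :=
  Continuous[wstar M, wstar N] f

/-- Weak-star continuity of a scalar valued map. -/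
def WStarContinuousForm {M : Subalgebra ℂ (H →L[ℂ] H)} (f : M → ℂ) : Prop :=
  Continuous[wstar M, inferInstance] f

/-! ### Matrix norms and completely bounded maps -/

/-- The operator on `ℓ²ₙ ⊗ H = H ⊕ ⋯ ⊕ H` given by an `n × n` matrix of operators on `H`. -/
def matOp {n : ℕ} (x : Matrix (Fin n) (Fin n) (H →L[ℂ] H)) :
    PiLp 2 (fun _ : Fin n => H) →L[ℂ] PiLp 2 (fun _ : Fin n => H) :=
  ((PiLp.continuousLinearEquiv 2 ℂ (fun _ : Fin n => H)).symm :
      (Fin n → H) →L[ℂ] PiLp 2 (fun _ : Fin n => H)) ∘L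
    (ContinuousLinearMap.pi fun i => ∑ j, x i j ∘L ContinuousLinearMap.proj j) ∘L
    ((PiLp.continuousLinearEquiv 2 ℂ (fun _ : Fin n => H)) :
      PiLp 2 (fun _ : Fin n => H) →L[ℂ] (Fin n → H))

/-- The norm of `Mₙ(M) ⊆ Mₙ(B(H)) = B(ℓ²ₙ ⊗ H)`. -/
def matNorm {M : Subalgebra ℂ (H →L[ℂ] H)} {n : ℕ} (x : Matrix (Fin n) (Fin n) M) : ℝ :=
  ‖matOp (x.map fun a : M => (a : H →L[ℂ] H))‖

/-- The norm of `Mₙ(ℂ) = B(ℓ²ₙ)`. -/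
def scalarMatNorm {n : ℕ} (x : Matrix (Fin n) (Fin n) ℂ) : ℝ :=
  ‖Matrix.toEuclideanCLM (n := Fin n) (𝕜 := ℂ) x‖

/-- The `n`-th amplification of a bilinear map `B`, with
`Bₙ(x, y) i j = ∑ₖ B (x i k) (y k j)`. -/
def bilAmp {E F G : Type*} [AddCommGroup E] [Module ℂ E] [AddCommGroup F] [Module ℂ F]
    [AddCommGroup G] [Module ℂ G] (B : E →ₗ[ℂ] F →ₗ[ℂ] G) {n : ℕ}
    (x : Matrix (Fin n) (Fin n) E) (y : Matrix (Fin n) (Fin n) F) : Matrix (Fin n) (Fin n) G :=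
  Matrix.of fun i j => ∑ k, B (x i k) (y k j)

/-- The cb-norm `‖L‖_cb = supₙ ‖Lₙ‖` of a linear map, where `Lₙ` applies `L` to every entry of
an `n × n` matrix; it is `∞` if `L` is not completely bounded. -/
def cbNorm {M : Subalgebra ℂ (H →L[ℂ] H)} {N : Subalgebra ℂ (K →L[ℂ] K)} (L : M →ₗ[ℂ] N) :
    ℝ≥0∞ :=
  ⨆ (n : ℕ) (x : Matrix (Fin n) (Fin n) M) (_ : matNorm x ≤ 1), ENNReal.ofReal (matNorm (x.map L))

/-- The cb-norm `supₙ ‖Bₙ‖` of a bilinear map `M × M → N`. -/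
def cbNorm₂ {M : Subalgebra ℂ (H →L[ℂ] H)} {N : Subalgebra ℂ (K →L[ℂ] K)}
    (B : M →ₗ[ℂ] M →ₗ[ℂ] N) : ℝ≥0∞ :=
  ⨆ (n : ℕ) (x : Matrix (Fin n) (Fin n) M) (y : Matrix (Fin n) (Fin n) M)
    (_ : matNorm x ≤ 1) (_ : matNorm y ≤ 1), ENNReal.ofReal (matNorm (bilAmp B x y))

/-- The cb-norm `supₙ ‖ψₙ‖` of a bilinear form `M × M → ℂ`. -/
def cbNormForm {M : Subalgebra ℂ (H →L[ℂ] H)} (ψ : M →ₗ[ℂ] M →ₗ[ℂ] ℂ) : ℝ≥0∞ :=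
  ⨆ (n : ℕ) (x : Matrix (Fin n) (Fin n) M) (y : Matrix (Fin n) (Fin n) M)
    (_ : matNorm x ≤ 1) (_ : matNorm y ≤ 1), ENNReal.ofReal (scalarMatNorm (bilAmp ψ x y))

/-- The multiplicativity defect `L^∨(x, y) = L(xy) - L(x)L(y)`. -/
def defect {M : Subalgebra ℂ (H →L[ℂ] H)} {N : Subalgebra ℂ (K →L[ℂ] K)} (L : M →ₗ[ℂ] N) :
    M →ₗ[ℂ] M →ₗ[ℂ] N :=
  LinearMap.mk₂ ℂ (fun x y => L (x * y) - L x * L y)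
    (fun x x' y => by simp only [add_mul, map_add]; abel)
    (fun c x y => by simp [smul_sub])
    (fun x y y' => by simp only [mul_add, map_add]; abel)
    (fun c x y => by simp [smul_sub])

/-! ### Auxiliary facts on matrix norms -/

theorem matOp_apply {n : ℕ} (x : Matrix (Fin n) (Fin n) (H →L[ℂ] H))
    (ξ : PiLp 2 (fun _ : Fin n => H)) (i : Fin n) : matOp x ξ i = ∑ j, x i j (ξ j) := by
  simp [matOp]

theorem matOp_mul {n : ℕ} (x y : Matrix (Fin n) (Fin n) (H →L[ℂ] H)) :
    matOp (x * y) = matOp x ∘L matOp y := by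
  ext ξ i
  simp only [matOp_apply, ContinuousLinearMap.comp_apply, Matrix.mul_apply, map_sum,
    sum_apply, mul_apply_eq_comp]
  exact Finset.sum_comm

theorem matOp_smul {n : ℕ} (c : ℂ) (x : Matrix (Fin n) (Fin n) (H →L[ℂ] H)) :
    matOp (c • x) = c • matOp x := by
  ext ξ i
  simp [matOp_apply, Finset.smul_sum]

theorem eq_zero_of_matOp {n : ℕ} (x : Matrix (Fin n) (Fin n) (H →L[ℂ] H)) (h : matOp x = 0) :
    x = 0 := by
  ext i j v
  have h1 := congrArg (fun T => T (WithLp.toLp 2 (Pi.single j v)) i) h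
  simp only [matOp_apply] at h1
  rw [Finset.sum_eq_single j] at h1
  · simpa using h1
  · intro k _ hk
    simp [Pi.single_eq_of_ne hk]
  · simp

theorem norm_matOp_diagonal_le {n : ℕ} (a : H →L[ℂ] H) :
    ‖matOp (Matrix.diagonal fun _ : Fin n => a)‖ ≤ ‖a‖ := by
  refine ContinuousLinearMap.opNorm_le_bound _ (norm_nonneg _) fun ξ => ?_
  have hi : ∀ i, matOp (Matrix.diagonal fun _ : Fin n => a) ξ i = a (ξ i) := fun i => by
    rw [matOp_apply, Finset.sum_eq_single i]
    · simp
    · intro k _ hk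
      simp [Matrix.diagonal_apply_ne' _ hk]
    · simp
  rw [PiLp.norm_eq_of_L2, PiLp.norm_eq_of_L2,
    ← Real.sqrt_sq (norm_nonneg a), ← Real.sqrt_mul (sq_nonneg _), Finset.mul_sum]
  refine Real.sqrt_le_sqrt (Finset.sum_le_sum fun i _ => ?_)
  rw [hi, ← mul_pow]
  gcongr
  exact a.le_opNorm _

section MatNorm

variable {M : Subalgebra ℂ (H →L[ℂ] H)} {n : ℕ}

theorem matNorm_nonneg (x : Matrix (Fin n) (Fin n) M) : 0 ≤ matNorm x := norm_nonneg _

theorem matNorm_mul_le (x y : Matrix (Fin n) (Fin n) M) :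
    matNorm (x * y) ≤ matNorm x * matNorm y := by
  have : (x * y).map (fun a : M => (a : H →L[ℂ] H)) =
      x.map (fun a : M => (a : H →L[ℂ] H)) * y.map (fun a : M => (a : H →L[ℂ] H)) := by
    ext1 i j
    simp [Matrix.mul_apply]
  unfold matNorm
  rw [this, matOp_mul]
  exact ContinuousLinearMap.opNorm_comp_le _ _

theorem matNorm_smul (c : ℂ) (x : Matrix (Fin n) (Fin n) M) :
    matNorm (c • x) = ‖c‖ * matNorm x := by
  have : (c • x).map (fun a : M => (a : H →L[ℂ] H)) =
      c • x.map (fun a : M => (a : H →L[ℂ] H)) := by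
    ext1 i j
    simp
  unfold matNorm
  rw [this, matOp_smul, norm_smul]

theorem eq_zero_of_matNorm {x : Matrix (Fin n) (Fin n) M} (h : matNorm x = 0) : x = 0 := by
  have h1 := eq_zero_of_matOp _ (norm_eq_zero.1 h)
  ext1 i j
  exact Subtype.ext (congrFun (congrFun h1 i) j)

theorem matNorm_diagonal_le (a : M) :
    matNorm (Matrix.diagonal fun _ : Fin n => a) ≤ ‖a‖ := by
  have : (Matrix.diagonal fun _ : Fin n => a).map (fun a : M => (a : H →L[ℂ] H)) =
      Matrix.diagonal fun _ : Fin n => (a : H →L[ℂ] H) := by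
    rw [Matrix.diagonal_map]
    simp
  unfold matNorm
  rw [this]
  exact norm_matOp_diagonal_le _

theorem matNorm_mulLeft_le (a : M) (x : Matrix (Fin n) (Fin n) M) :
    matNorm (x.map fun c => a * c) ≤ ‖a‖ * matNorm x := by
  have : (x.map fun c => a * c) = (Matrix.diagonal fun _ : Fin n => a) * x := by
    ext1 i j
    simp
  rw [this]
  exact (matNorm_mul_le _ _).trans
    (mul_le_mul_of_nonneg_right (matNorm_diagonal_le a) (matNorm_nonneg x))

theorem matNorm_mulRight_le (b : M) (x : Matrix (Fin n) (Fin n) M) :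
    matNorm (x.map fun c => c * b) ≤ ‖b‖ * matNorm x := by
  have : (x.map fun c => c * b) = x * (Matrix.diagonal fun _ : Fin n => b) := by
    ext1 i j
    simp
  rw [this, mul_comm]
  exact (matNorm_mul_le _ _).trans
    (mul_le_mul_of_nonneg_left (matNorm_diagonal_le b) (matNorm_nonneg x))

theorem scalarMatNorm_nonneg (x : Matrix (Fin n) (Fin n) ℂ) : 0 ≤ scalarMatNorm x :=
  norm_nonneg _

theorem scalarMatNorm_add_le (x y : Matrix (Fin n) (Fin n) ℂ) :
    scalarMatNorm (x + y) ≤ scalarMatNorm x + scalarMatNorm y := by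
  unfold scalarMatNorm
  rw [map_add]
  exact norm_add_le _ _

theorem scalarMatNorm_smul (c : ℂ) (x : Matrix (Fin n) (Fin n) ℂ) :
    scalarMatNorm (c • x) = ‖c‖ * scalarMatNorm x := by
  unfold scalarMatNorm
  rw [map_smul, norm_smul]

theorem eq_zero_of_scalarMatNorm {x : Matrix (Fin n) (Fin n) ℂ} (h : scalarMatNorm x = 0) :
    x = 0 :=
  (EmbeddingLike.map_eq_zero_iff (f := Matrix.toEuclideanCLM (n := Fin n) (𝕜 := ℂ))).1
    (norm_eq_zero.1 h)

/-- A bounded functional is completely bounded, with the same norm. -/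
theorem scalarMatNorm_map_le (φ : M →L[ℂ] ℂ) (x : Matrix (Fin n) (Fin n) M) :
    scalarMatNorm (x.map φ) ≤ ‖φ‖ * matNorm x := by
  refine ContinuousLinearMap.opNorm_le_bound _
    (mul_nonneg (norm_nonneg _) (matNorm_nonneg _)) fun v => ?_
  set w := Matrix.toEuclideanCLM (n := Fin n) (𝕜 := ℂ) (x.map φ) v with hw
  have hwi : ∀ i, w i = ∑ j, φ (x i j) * v j := fun i => by
    rw [hw, Matrix.ofLp_toEuclideanCLM]
    simp [Matrix.mulVec, dotProduct]
  set s : M := ∑ i, ∑ j, (starRingEnd ℂ (w i) * v j) • x i j with hs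
  have h1 : ((‖w‖ ^ 2 : ℝ) : ℂ) = φ s := by
    rw [hs, EuclideanSpace.norm_sq_eq]
    push_cast
    simp only [map_sum, map_smul, smul_eq_mul]
    refine Finset.sum_congr rfl fun i _ => ?_
    rw [← Complex.conj_mul', hwi i, Finset.mul_sum]
    refine Finset.sum_congr rfl fun j _ => ?_
    ring
  have h2 : ‖s‖ ≤ ‖w‖ * matNorm x * ‖v‖ := by
    refine ContinuousLinearMap.opNorm_le_bound _
      (mul_nonneg (mul_nonneg (norm_nonneg _) (matNorm_nonneg _)) (norm_nonneg _)) fun h => ?_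
    set vh : PiLp 2 (fun _ : Fin n => H) := WithLp.toLp 2 (fun j => v j • h) with hvh
    have hvn : ‖vh‖ = ‖v‖ * ‖h‖ := by
      rw [PiLp.norm_eq_of_L2, EuclideanSpace.norm_eq, ← Real.sqrt_sq (norm_nonneg h),
        ← Real.sqrt_mul (Finset.sum_nonneg fun _ _ => sq_nonneg _), Finset.sum_mul]
      congr 1
      refine Finset.sum_congr rfl fun i _ => ?_
      simp [hvh, norm_smul, mul_pow]
    set y := matOp (x.map fun a : M => (a : H →L[ℂ] H)) vh with hy
    have hyn : ‖y‖ ≤ matNorm x * (‖v‖ * ‖h‖) := hvn ▸ ContinuousLinearMap.le_opNorm _ _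
    have hsy : (s : H →L[ℂ] H) h = ∑ i, starRingEnd ℂ (w i) • y i := by
      rw [hs]
      simp only [hy, matOp_apply, hvh, Finset.smul_sum, AddSubmonoidClass.coe_finsetSum,
        sum_apply, Matrix.map_apply, map_smul, smul_smul]
      rfl
    have hb : ‖(s : H →L[ℂ] H) h‖ ≤ ‖w‖ * ‖y‖ := by
      rw [hsy, PiLp.norm_eq_of_L2 w, PiLp.norm_eq_of_L2 y]
      refine (norm_sum_le _ _).trans ?_
      refine le_trans (le_of_eq ?_)
        (Real.sum_mul_le_sqrt_mul_sqrt Finset.univ (fun i => ‖w i‖) (fun i => ‖y i‖))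
      refine Finset.sum_congr rfl fun i _ => ?_
      rw [norm_smul, RCLike.norm_conj]
    calc _ ≤ ‖w‖ * ‖y‖ := hb
      _ ≤ ‖w‖ * (matNorm x * (‖v‖ * ‖h‖)) := by gcongr
      _ = _ := by ring
  have h3 : ‖w‖ ^ 2 ≤ ‖φ‖ * (‖w‖ * matNorm x * ‖v‖) := by
    calc ‖w‖ ^ 2 = ‖φ s‖ := by
          rw [← h1, Complex.norm_real, Real.norm_of_nonneg (sq_nonneg _)]
      _ ≤ ‖φ‖ * ‖s‖ := φ.le_opNorm _
      _ ≤ _ := by gcongr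
  rcases (norm_nonneg w).eq_or_lt with h0 | h0
  · rw [← h0]
    exact mul_nonneg (mul_nonneg (norm_nonneg _) (matNorm_nonneg _)) (norm_nonneg _)
  · refine le_of_mul_le_mul_left ?_ h0
    calc ‖w‖ * ‖w‖ = ‖w‖ ^ 2 := by ring
      _ ≤ _ := h3
      _ = _ := by ring

end MatNorm

section BilinearForm

variable {M : Subalgebra ℂ (H →L[ℂ] H)}

theorem cbNormForm_le {ψ : M →ₗ[ℂ] M →ₗ[ℂ] ℂ} {C : ℝ} (hC : 0 ≤ C)
    (h : ∀ (n : ℕ) (x y : Matrix (Fin n) (Fin n) M),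
      scalarMatNorm (bilAmp ψ x y) ≤ C * (matNorm x * matNorm y)) :
    cbNormForm ψ ≤ ENNReal.ofReal C := by
  refine iSup_le fun n => iSup_le fun x => iSup_le fun y => iSup_le fun hx => iSup_le fun hy => ?_
  refine ENNReal.ofReal_le_ofReal ((h n x y).trans ?_)
  exact mul_le_of_le_one_right hC (mul_le_one₀ hx (matNorm_nonneg y) hy)

theorem bilAmp_smul_smul (ψ : M →ₗ[ℂ] M →ₗ[ℂ] ℂ) {n : ℕ} (c d : ℂ)
    (x y : Matrix (Fin n) (Fin n) M) :
    bilAmp ψ (c • x) (d • y) = (c * d) • bilAmp ψ x y := by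
  ext i j
  simp [bilAmp, Finset.mul_sum, mul_assoc, mul_left_comm]

theorem le_cbNormForm {ψ : M →ₗ[ℂ] M →ₗ[ℂ] ℂ} (hψ : cbNormForm ψ ≠ ⊤) {n : ℕ}
    (x y : Matrix (Fin n) (Fin n) M) :
    scalarMatNorm (bilAmp ψ x y) ≤ (cbNormForm ψ).toReal * (matNorm x * matNorm y) := by
  rcases (matNorm_nonneg x).eq_or_lt with hx | hx
  · rw [eq_zero_of_matNorm hx.symm]
    have : bilAmp ψ (0 : Matrix (Fin n) (Fin n) M) y = 0 := by ext i j; simp [bilAmp]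
    rw [this]
    simpa [scalarMatNorm] using
      mul_nonneg ENNReal.toReal_nonneg (mul_nonneg (matNorm_nonneg _) (matNorm_nonneg y))
  rcases (matNorm_nonneg y).eq_or_lt with hy | hy
  · rw [eq_zero_of_matNorm hy.symm]
    have : bilAmp ψ x (0 : Matrix (Fin n) (Fin n) M) = 0 := by ext i j; simp [bilAmp]
    rw [this]
    simpa [scalarMatNorm] using
      mul_nonneg ENNReal.toReal_nonneg (mul_nonneg (matNorm_nonneg x) (matNorm_nonneg _))
  set c : ℂ := (((matNorm x)⁻¹ : ℝ) : ℂ)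
  set d : ℂ := (((matNorm y)⁻¹ : ℝ) : ℂ)
  have hc : ‖c‖ = (matNorm x)⁻¹ := by
    rw [Complex.norm_real, Real.norm_of_nonneg (inv_nonneg.2 hx.le)]
  have hd : ‖d‖ = (matNorm y)⁻¹ := by
    rw [Complex.norm_real, Real.norm_of_nonneg (inv_nonneg.2 hy.le)]
  have h1 : matNorm (c • x) ≤ 1 := by rw [matNorm_smul, hc, inv_mul_cancel₀ hx.ne']
  have h2 : matNorm (d • y) ≤ 1 := by rw [matNorm_smul, hd, inv_mul_cancel₀ hy.ne']
  have h3 : ENNReal.ofReal (scalarMatNorm (bilAmp ψ (c • x) (d • y))) ≤ cbNormForm ψ :=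
    le_iSup_of_le n (le_iSup_of_le (c • x) (le_iSup_of_le (d • y)
      (le_iSup_of_le h1 (le_iSup_of_le h2 le_rfl))))
  have h4 := (ENNReal.ofReal_le_iff_le_toReal hψ).1 h3
  rw [bilAmp_smul_smul, scalarMatNorm_smul, norm_mul, hc, hd, ← mul_inv,
    inv_mul_le_iff₀ (mul_pos hx hy)] at h4
  rwa [mul_comm]

theorem toReal_cbNormForm_le {ψ : M →ₗ[ℂ] M →ₗ[ℂ] ℂ} {C : ℝ} (hC : 0 ≤ C)
    (h : ∀ (n : ℕ) (x y : Matrix (Fin n) (Fin n) M),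
      scalarMatNorm (bilAmp ψ x y) ≤ C * (matNorm x * matNorm y)) :
    (cbNormForm ψ).toReal ≤ C :=
  ENNReal.toReal_le_of_le_ofReal hC (cbNormForm_le hC h)

theorem scalarMatNorm_bilAmp_add_le {ψ ψ' : M →ₗ[ℂ] M →ₗ[ℂ] ℂ} (h : cbNormForm ψ ≠ ⊤)
    (h' : cbNormForm ψ' ≠ ⊤) (n : ℕ) (x y : Matrix (Fin n) (Fin n) M) :
    scalarMatNorm (bilAmp (ψ + ψ') x y) ≤
      ((cbNormForm ψ).toReal + (cbNormForm ψ').toReal) * (matNorm x * matNorm y) := by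
  have : bilAmp (ψ + ψ') x y = bilAmp ψ x y + bilAmp ψ' x y := by
    ext i j
    simp [bilAmp, Finset.sum_add_distrib]
  rw [this, add_mul]
  exact (scalarMatNorm_add_le _ _).trans (add_le_add (le_cbNormForm h x y) (le_cbNormForm h' x y))

theorem scalarMatNorm_bilAmp_smul_le {ψ : M →ₗ[ℂ] M →ₗ[ℂ] ℂ} (h : cbNormForm ψ ≠ ⊤) (c : ℂ)
    (n : ℕ) (x y : Matrix (Fin n) (Fin n) M) :
    scalarMatNorm (bilAmp (c • ψ) x y) ≤
      (‖c‖ * (cbNormForm ψ).toReal) * (matNorm x * matNorm y) := by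
  have : bilAmp (c • ψ) x y = c • bilAmp ψ x y := by
    ext i j
    simp [bilAmp, Finset.mul_sum]
  rw [this, scalarMatNorm_smul, mul_assoc]
  exact mul_le_mul_of_nonneg_left (le_cbNormForm h x y) (norm_nonneg c)

/-- The form `b · ψ · a : (c, d) ↦ ψ(ac, db)`, as a bilinear form. -/
def actBilin (a b : M) (ψ : M →ₗ[ℂ] M →ₗ[ℂ] ℂ) : M →ₗ[ℂ] M →ₗ[ℂ] ℂ :=
  ψ.compl₁₂ (LinearMap.mulLeft ℂ a) (LinearMap.mulRight ℂ b)

theorem scalarMatNorm_actBilin_le (a b : M) {ψ : M →ₗ[ℂ] M →ₗ[ℂ] ℂ} (hψ : cbNormForm ψ ≠ ⊤)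
    (n : ℕ) (x y : Matrix (Fin n) (Fin n) M) :
    scalarMatNorm (bilAmp (actBilin a b ψ) x y) ≤
      (‖a‖ * ‖b‖ * (cbNormForm ψ).toReal) * (matNorm x * matNorm y) := by
  have h : bilAmp (actBilin a b ψ) x y =
      bilAmp ψ (x.map fun c => a * c) (y.map fun c => c * b) := rfl
  rw [h]
  calc _ ≤ (cbNormForm ψ).toReal *
        (matNorm (x.map fun c => a * c) * matNorm (y.map fun c => c * b)) := le_cbNormForm hψ _ _
    _ ≤ (cbNormForm ψ).toReal * ((‖a‖ * matNorm x) * (‖b‖ * matNorm y)) :=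
        mul_le_mul_of_nonneg_left (mul_le_mul (matNorm_mulLeft_le a x) (matNorm_mulRight_le b y)
          (matNorm_nonneg _) (mul_nonneg (norm_nonneg _) (matNorm_nonneg _)))
          ENNReal.toReal_nonneg
    _ = _ := by ring

end BilinearForm

/-! ### The normal Haagerup tensor product -/

/-- The space `(M ⊗_h M)_σ^*` of completely bounded, separately weak-star continuous bilinear
forms on `M × M`. -/
def NormalForms (M : Subalgebra ℂ (H →L[ℂ] H)) : Submodule ℂ (M →ₗ[ℂ] M →ₗ[ℂ] ℂ) where
  carrier := {ψ | (∀ b : M, WStarContinuousForm fun a : M => ψ a b) ∧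
    (∀ a : M, WStarContinuousForm fun b : M => ψ a b) ∧ cbNormForm ψ ≠ ⊤}
  zero_mem' := by
    refine ⟨fun b => ?_, fun a => ?_, ?_⟩
    · exact @continuous_const _ _ (wstar M) _ _
    · exact @continuous_const _ _ (wstar M) _ _
    · refine ne_top_of_le_ne_top ENNReal.ofReal_ne_top (cbNormForm_le le_rfl fun n x y => ?_)
      have : bilAmp (0 : M →ₗ[ℂ] M →ₗ[ℂ] ℂ) x y = 0 := by ext i j; simp [bilAmp]
      simp [this, scalarMatNorm]
  add_mem' := by
    rintro ψ ψ' ⟨h1, h2, h3⟩ ⟨h1', h2', h3'⟩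
    refine ⟨fun b => ?_, fun a => ?_, ?_⟩
    · exact @Continuous.add _ _ _ _ _ (wstar M) _ _ (h1 b) (h1' b)
    · exact @Continuous.add _ _ _ _ _ (wstar M) _ _ (h2 a) (h2' a)
    · exact ne_top_of_le_ne_top ENNReal.ofReal_ne_top (cbNormForm_le
        (add_nonneg ENNReal.toReal_nonneg ENNReal.toReal_nonneg)
        (scalarMatNorm_bilAmp_add_le h3 h3'))
  smul_mem' := by
    rintro c ψ ⟨h1, h2, h3⟩
    refine ⟨fun b => ?_, fun a => ?_, ?_⟩
    · exact @Continuous.const_smul _ _ _ _ _ _ (wstar M) _ (h1 b) c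
    · exact @Continuous.const_smul _ _ _ _ _ _ (wstar M) _ (h2 a) c
    · exact ne_top_of_le_ne_top ENNReal.ofReal_ne_top (cbNormForm_le
        (mul_nonneg (norm_nonneg c) ENNReal.toReal_nonneg) (scalarMatNorm_bilAmp_smul_le h3 c))

/-- The norm of `(M ⊗_h M)_σ^*` is the cb-norm of bilinear forms. -/
instance (M : Subalgebra ℂ (H →L[ℂ] H)) : Norm (NormalForms M) :=
  ⟨fun ψ => (cbNormForm (ψ : M →ₗ[ℂ] M →ₗ[ℂ] ℂ)).toReal⟩

theorem NormalForms.norm_def {M : Subalgebra ℂ (H →L[ℂ] H)} (ψ : NormalForms M) :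
    ‖ψ‖ = (cbNormForm (ψ : M →ₗ[ℂ] M →ₗ[ℂ] ℂ)).toReal := rfl

theorem NormalForms.core (M : Subalgebra ℂ (H →L[ℂ] H)) : NormedSpace.Core ℂ (NormalForms M) where
  norm_nonneg _ := ENNReal.toReal_nonneg
  norm_smul c ψ := by
    have key : ∀ (c : ℂ) (ψ : NormalForms M), ‖c • ψ‖ ≤ ‖c‖ * ‖ψ‖ := fun c ψ =>
      toReal_cbNormForm_le (mul_nonneg (norm_nonneg c) ENNReal.toReal_nonneg)
        (scalarMatNorm_bilAmp_smul_le ψ.2.2.2 c)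
    refine le_antisymm (key c ψ) ?_
    rcases eq_or_ne c 0 with rfl | hc
    · rw [norm_zero, zero_mul]
      exact ENNReal.toReal_nonneg
    · have h := key c⁻¹ (c • ψ)
      rw [smul_smul, inv_mul_cancel₀ hc, one_smul, norm_inv] at h
      rwa [← le_inv_mul_iff₀ (norm_pos_iff.2 hc)]
  norm_triangle ψ ψ' :=
    toReal_cbNormForm_le (add_nonneg ENNReal.toReal_nonneg ENNReal.toReal_nonneg)
      (scalarMatNorm_bilAmp_add_le ψ.2.2.2 ψ'.2.2.2)
  norm_eq_zero_iff ψ := by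
    constructor
    · intro h
      rw [NormalForms.norm_def] at h
      refine Subtype.ext (LinearMap.ext₂ fun a b => ?_)
      have h1 := le_cbNormForm ψ.2.2.2 (Matrix.of fun _ _ : Fin 1 => a)
        (Matrix.of fun _ _ : Fin 1 => b)
      rw [h, zero_mul] at h1
      have h2 := eq_zero_of_scalarMatNorm (le_antisymm h1 (scalarMatNorm_nonneg _))
      simpa [bilAmp] using congrFun (congrFun h2 0) 0
    · rintro rfl
      refine le_antisymm (toReal_cbNormForm_le le_rfl fun n x y => ?_) ENNReal.toReal_nonneg
      have : bilAmp (0 : M →ₗ[ℂ] M →ₗ[ℂ] ℂ) x y = 0 := by ext i j; simp [bilAmp]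
      simp [this, scalarMatNorm]

instance (M : Subalgebra ℂ (H →L[ℂ] H)) : NormedAddCommGroup (NormalForms M) :=
  NormedAddCommGroup.ofCore (NormalForms.core M)

instance (M : Subalgebra ℂ (H →L[ℂ] H)) : NormedSpace ℂ (NormalForms M) :=
  NormedSpace.ofCore (NormalForms.core M)

/-- The normal Haagerup tensor product `M ⊗_σh M = ((M ⊗_h M)_σ^*)^*`, a Banach dual with its dual
norm. -/
abbrev NormalHaagerup (M : Subalgebra ℂ (H →L[ℂ] H)) : Type _ := StrongDual ℂ (NormalForms M)

/-! ### Weak-star continuity of functionals and multiplications -/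

theorem summable_inner_apply {E : Type*} [NormedAddCommGroup E] {ξ η : ℕ → E} (hξ : Summable fun n => ‖ξ n‖ ^ 2)
    (hη : Summable fun n => ‖η n‖ ^ 2) : Summable fun n => ‖η n‖ * ‖ξ n‖ := by
  refine Summable.of_nonneg_of_le (fun n => by positivity) (fun n => ?_) (hξ.add hη)
  nlinarith [sq_nonneg (‖ξ n‖ - ‖η n‖), sq_nonneg (‖ξ n‖ + ‖η n‖), norm_nonneg (ξ n)]

/-- The weak-star topology is coarser than the norm topology. -/
theorem norm_le_wstarTopology :
    (inferInstance : TopologicalSpace (H →L[ℂ] H)) ≤ wstarTopology H := by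
  refine le_iInf fun p => ?_
  obtain ⟨⟨ξ, η⟩, hξ, hη⟩ := p
  rw [← continuous_iff_le_induced]
  have hs := summable_inner_apply hξ hη
  have hb : ∀ (T : H →L[ℂ] H) n, ‖⟪η n, T (ξ n)⟫_ℂ‖ ≤ ‖T‖ * (‖η n‖ * ‖ξ n‖) := fun T n =>
    (norm_inner_le_norm _ _).trans (by
      have := mul_le_mul_of_nonneg_left (T.le_opNorm (ξ n)) (norm_nonneg (η n))
      linarith)
  have hT : ∀ T : H →L[ℂ] H, Summable fun n => ⟪η n, T (ξ n)⟫_ℂ := fun T =>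
    Summable.of_norm_bounded (hs.mul_left ‖T‖) (hb T)
  let f : (H →L[ℂ] H) →ₗ[ℂ] ℂ :=
    { toFun := fun T => ∑' n, ⟪η n, T (ξ n)⟫_ℂ
      map_add' := fun S T => by
        simp only [add_apply, inner_add_right]
        exact (hT S).tsum_add (hT T)
      map_smul' := fun c T => by
        simp only [smul_apply, inner_smul_right, RingHom.id_apply,
          smul_eq_mul]
        exact tsum_mul_left }
  refine (f.mkContinuous (∑' n, ‖η n‖ * ‖ξ n‖) fun T => ?_).continuous
  refine (tsum_of_norm_bounded ((hs.mul_left ‖T‖).hasSum) (hb T)).trans (le_of_eq ?_)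
  rw [tsum_mul_left, mul_comm]

section Mul

variable {M : Subalgebra ℂ (H →L[ℂ] H)}

/-- A weak-star continuous linear functional is norm continuous. -/
theorem WStarContinuousForm.continuous {f : M → ℂ} (hf : WStarContinuousForm f) :
    Continuous f :=
  continuous_le_dom (induced_mono norm_le_wstarTopology) hf

theorem WStarContinuousForm.comp {f : M → ℂ} {g : M → M} (hf : WStarContinuousForm f)
    (hg : WStarContinuous g) : WStarContinuousForm fun a => f (g a) :=
  @Continuous.comp _ _ _ (wstar M) (wstar M) _ _ _ hf hg

theorem wstar_continuous_iff {X : Type*} [TopologicalSpace X] (f : X → M) :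
    Continuous[inferInstance, wstar M] f ↔ ∀ ξ η : ℕ → H, (Summable fun n => ‖ξ n‖ ^ 2) →
      (Summable fun n => ‖η n‖ ^ 2) →
      Continuous fun t => ∑' n, ⟪η n, (f t : H →L[ℂ] H) (ξ n)⟫_ℂ := by
  rw [continuous_induced_rng, continuous_iInf_rng]
  simp only [continuous_induced_rng]
  exact ⟨fun h ξ η hξ hη => h ⟨(ξ, η), hξ, hη⟩, fun h p => h p.1.1 p.1.2 p.2.1 p.2.2⟩

theorem wstar_functional_continuous {ξ η : ℕ → H} (hξ : Summable fun n => ‖ξ n‖ ^ 2)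
    (hη : Summable fun n => ‖η n‖ ^ 2) :
    WStarContinuousForm fun a : M => ∑' n, ⟪η n, (a : H →L[ℂ] H) (ξ n)⟫_ℂ :=
  (@wstar_continuous_iff _ _ _ M _ (wstar M) id).1 (@continuous_id _ (wstar M)) ξ η hξ hη

theorem summable_apply (T : H →L[ℂ] H) {ξ : ℕ → H} (hξ : Summable fun n => ‖ξ n‖ ^ 2) :
    Summable fun n => ‖T (ξ n)‖ ^ 2 := by
  refine Summable.of_nonneg_of_le (fun n => by positivity) (fun n => ?_) (hξ.mul_left (‖T‖ ^ 2))
  rw [← mul_pow]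
  gcongr
  exact T.le_opNorm _

theorem wstarContinuous_mulRight (b : M) : WStarContinuous fun a : M => a * b := by
  refine (@wstar_continuous_iff _ _ _ M _ (wstar M) _).2 fun ξ η hξ hη => ?_
  exact wstar_functional_continuous (M := M) (summable_apply (b : H →L[ℂ] H) hξ) hη

theorem wstarContinuous_mulLeft [CompleteSpace H] (a : M) :
    WStarContinuous fun b : M => a * b := by
  refine (@wstar_continuous_iff _ _ _ M _ (wstar M) _).2 fun ξ η hξ hη => ?_
  have := wstar_functional_continuous (M := M) hξ
    (summable_apply (ContinuousLinearMap.adjoint (a : H →L[ℂ] H)) hη)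
  simpa [WStarContinuousForm, ContinuousLinearMap.adjoint_inner_left] using this

end Mul

/-! ### Normal virtual `h`-diagonals -/

section Diagonal

variable [CompleteSpace H] {M : Subalgebra ℂ (H →L[ℂ] H)}

/-- The action `ψ ↦ b · ψ · a`, where `(b · ψ · a)(c, d) = ψ(ac, db)`, on `(M ⊗_h M)_σ^*`. -/
def actForm (a b : M) : NormalForms M →L[ℂ] NormalForms M :=
  LinearMap.mkContinuous
    { toFun := fun ψ => ⟨actBilin a b ψ, fun d => (ψ.2.1 (d * b)).comp (wstarContinuous_mulLeft a),
          fun c => (ψ.2.2.1 (a * c)).comp (wstarContinuous_mulRight b),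
          ne_top_of_le_ne_top ENNReal.ofReal_ne_top (cbNormForm_le
            (mul_nonneg (mul_nonneg (norm_nonneg a) (norm_nonneg b)) ENNReal.toReal_nonneg)
            (scalarMatNorm_actBilin_le a b ψ.2.2.2))⟩
      map_add' := fun _ _ => rfl
      map_smul' := fun _ _ => rfl }
    (‖a‖ * ‖b‖) fun ψ => toReal_cbNormForm_le
      (mul_nonneg (mul_nonneg (norm_nonneg a) (norm_nonneg b)) ENNReal.toReal_nonneg)
      (scalarMatNorm_actBilin_le a b ψ.2.2.2)

theorem actForm_apply (a b : M) (ψ : NormalForms M) (c d : M) :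
    (actForm a b ψ : M →ₗ[ℂ] M →ₗ[ℂ] ℂ) c d = (ψ : M →ₗ[ℂ] M →ₗ[ℂ] ℂ) (a * c) (d * b) := rfl

/-- The `M`-bimodule action `a · u · b` on `M ⊗_σh M`, dual to the action on `(M ⊗_h M)_σ^*`;
on elementary tensors `a · (c ⊗ d) · b = ac ⊗ db`. -/
def biAct (a : M) (u : NormalHaagerup M) (b : M) : NormalHaagerup M :=
  u ∘L actForm a b

/-- The bilinear form `(a, b) ↦ φ(ab)` of a weak-star continuous functional `φ`. -/
def mulForm (φ : M →ₗ[ℂ] ℂ) (hφ : WStarContinuousForm φ) : NormalForms M :=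
  ⟨(LinearMap.mul ℂ M).compr₂ φ, fun b => hφ.comp (wstarContinuous_mulRight b),
    fun a => hφ.comp (wstarContinuous_mulLeft a), by
    refine ne_top_of_le_ne_top ENNReal.ofReal_ne_top (cbNormForm_le
      (norm_nonneg (⟨φ, hφ.continuous⟩ : M →L[ℂ] ℂ)) fun n x y => ?_)
    have h : bilAmp ((LinearMap.mul ℂ M).compr₂ φ) x y =
        (x * y).map (⟨φ, hφ.continuous⟩ : M →L[ℂ] ℂ) := by
      ext i j
      simp [bilAmp, Matrix.mul_apply]
    rw [h]
    exact (scalarMatNorm_map_le _ _).trans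
      (mul_le_mul_of_nonneg_left (matNorm_mul_le x y) (norm_nonneg _))⟩

theorem mulForm_apply (φ : M →ₗ[ℂ] ℂ) (hφ : WStarContinuousForm φ) (a b : M) :
    (mulForm φ hφ : M →ₗ[ℂ] M →ₗ[ℂ] ℂ) a b = φ (a * b) := rfl

/-- `MulMapsTo u m` says that `m_σh(u) = m`, where `m_σh : M ⊗_σh M → M` is the weak-star
continuous extension of the multiplication: by duality, `⟨m_σh(u), φ⟩ = u((a, b) ↦ φ(ab))` for
every `φ` in the predual of `M`, that is, every weak-star continuous functional. -/
def MulMapsTo (u : NormalHaagerup M) (m : M) : Prop :=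
  ∀ (φ : M →ₗ[ℂ] ℂ) (hφ : WStarContinuousForm φ), u (mulForm φ hφ) = φ m

/-- Normal virtual `h`-diagonals: `m · u = u · m` for all `m ∈ M`, and `m_σh(u) = 1`. -/
structure IsNormalVirtualHDiagonal (u : NormalHaagerup M) : Prop where
  commutes : ∀ m : M, biAct m u 1 = biAct 1 u m
  mul_eq_one : MulMapsTo u 1

end Diagonal

end DualOpAlg

end

/-! The proof is a Newton iteration in which averaging against the diagonal `u` inverts the
coboundary up to a quadratic error. For an operator valued form `E` on `M × M`, let `u[E]` be the
operator with `⟪η, u[E] ξ⟫ = ⟨u, ⟪η, E(·,·) ξ⟫⟩` (`IsAvg`). The two properties of the diagonal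
become `u[E(xa, b)] = u[E(a, bx)]` (`IsAvg.comm`) and `u[α(ab)] = α(1)` (`isAvg_mul`).

Let `D(a, b) = ℓ(ab) - ℓ(a)ℓ(b)` be the defect of a unital map `ℓ`, and correct `ℓ` by `R(x) =
u[ℓ(a) D(b, x)]`. The identity `D(b, xy) - D(b, x)ℓ(y) = D(bx, y) - ℓ(b)D(x, y)`, together with
moving `x` across the diagonal, shows that `ℓ + R` has defect `(1 - u[ℓ(a)ℓ(b)]) D(x, y) + u[D(x, a)
D(b, y)] - R(x)R(y)`. Since `1 - u[ℓ(a)ℓ(b)] = u[D]`, each term is quadratic in `D`: if `‖ℓ‖_cb ≤ m`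
and `‖D‖_cb ≤ d`, the new defect is at most `(2‖u‖ + m²‖u‖²) d²` and `‖R‖_cb ≤ ‖u‖ m d`
(`IsAlmostHom.exists_improvement`). The choice of `δ` makes the defect halve at each step while the
cb-norms stay below `2μ`, so the iterates converge in cb-norm to a homomorphism.

Two points require duality theory, because `u` is only a functional on the normal forms. Averages of
`N`-valued maps must stay in `N`: a trace functional vanishing on `N` is paired with the average by
passing to norm limits of forms (`IsNormalBilinear.mem_of_isAvg`). Also, `R` must be normal although
`u` need not be. This reduces to the map `x ↦ ⟨u, ⟪η, ℓ(a)ℓ(bx) ξ⟫⟩`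
(`IsDualOperatorAlgebra.wstarContinuousForm_translate`): the column bound for `b ↦ ℓ(b)ξ` gives a
dominating positive functional, and in its GNS-type Hilbert space the map is a norm limit of
combinations of the normal functionals `x ↦ ⟪k, ℓ(bx) ξ⟫`. Norm limits of normal functionals are
normal because the quotient trace norm on the predual is dominated by the functional norm
(`IsDualOperatorAlgebra.traceNorm_le`). -/

noncomputable section
namespace DualOpAlg

/-! ### Norm estimates for finite matrices of operators. -/

section OpBound

variable {E F G : Type*} [NormedAddCommGroup E] [InnerProductSpace ℂ E] [NormedAddCommGroup F]
  [InnerProductSpace ℂ F] [NormedAddCommGroup G] [InnerProductSpace ℂ G]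
variable {ι κ ν ι' κ' : Type*} [Fintype ι] [Fintype κ] [Fintype ν] [Fintype ι'] [Fintype κ']

/-- The matrix `x` of operators, acting between Hilbert space direct sums, has norm at most `C`. -/
def OpBound (x : ι → κ → E →L[ℂ] F) (C : ℝ) : Prop :=
  ∀ ξ : κ → E, ∑ i, ‖∑ j, x i j (ξ j)‖ ^ 2 ≤ C ^ 2 * ∑ j, ‖ξ j‖ ^ 2

theorem OpBound.mono {x : ι → κ → E →L[ℂ] F} {C D : ℝ} (h : OpBound x C) (hC : 0 ≤ C)
    (hCD : C ≤ D) : OpBound x D := fun ξ => by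
  refine (h ξ).trans ?_
  gcongr

theorem OpBound.comp {x : ι → κ → F →L[ℂ] G} {y : κ → ν → E →L[ℂ] F} {C D : ℝ}
    (hx : OpBound x C) (hy : OpBound y D) :
    OpBound (fun i j => ∑ k, x i k ∘L y k j) (C * D) := fun ξ => by
  have h : ∀ i, ∑ j, (∑ k, x i k ∘L y k j) (ξ j) = ∑ k, x i k (∑ j, y k j (ξ j)) := fun i => by
    simp only [sum_apply, ContinuousLinearMap.comp_apply, map_sum]
    exact Finset.sum_comm
  simp only [h]
  calc _ ≤ C ^ 2 * ∑ k, ‖∑ j, y k j (ξ j)‖ ^ 2 := hx _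
    _ ≤ C ^ 2 * (D ^ 2 * ∑ j, ‖ξ j‖ ^ 2) := by gcongr; exact hy ξ
    _ = _ := by ring

theorem OpBound.reindex {x : ι → κ → E →L[ℂ] F} {C : ℝ} (h : OpBound x C) (e : ι' ≃ ι)
    (f : κ' ≃ κ) : OpBound (fun i j => x (e i) (f j)) C := fun ξ => by
  have h1 := h fun j => ξ (f.symm j)
  rw [← e.sum_comp, ← f.sum_comp] at h1
  simpa only [← f.sum_comp, Equiv.symm_apply_apply] using h1

/-- The matrix is `x ⊗ 1`, a direct sum of copies of `x` indexed by `ν`, so the estimate is applied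
to each slice separately. -/
theorem OpBound.kronRight [DecidableEq ν] {x : ι → κ → E →L[ℂ] F} {C : ℝ} (h : OpBound x C) :
    OpBound (fun (p : ι × ν) (q : κ × ν) => if p.2 = q.2 then x p.1 q.1 else 0) C := fun ξ => by
  have h0 : ∀ p : ι × ν, ∑ q : κ × ν, (if p.2 = q.2 then x p.1 q.1 else 0) (ξ q) =
      ∑ k, x p.1 k (ξ (k, p.2)) := fun p => by
    rw [Fintype.sum_prod_type]
    refine Finset.sum_congr rfl fun k _ => ?_
    rw [Finset.sum_eq_single p.2]
    · simp
    · intro s _ hs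
      simp [hs.symm]
    · simp
  simp only [h0]
  rw [Fintype.sum_prod_type_right, Fintype.sum_prod_type_right, Finset.mul_sum]
  exact Finset.sum_le_sum fun s _ => h fun k => ξ (k, s)

theorem OpBound.kronLeft [DecidableEq ν] {x : ι → κ → E →L[ℂ] F} {C : ℝ} (h : OpBound x C) :
    OpBound (fun (p : ν × ι) (q : ν × κ) => if p.1 = q.1 then x p.2 q.2 else 0) C :=
  (h.kronRight (ν := ν)).reindex (Equiv.prodComm _ _) (Equiv.prodComm _ _)

/-- Placing `x` in the upper right corner makes it square without changing its norm. This carries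
estimates for square matrices over to rectangular ones, in particular to columns. -/
theorem opBound_block {x : ι → κ → E →L[ℂ] F} {C : ℝ} :
    OpBound (fun (p q : ι ⊕ κ) => Sum.elim (fun i => Sum.elim (fun _ => 0) (x i) q)
      (fun _ => 0) p) C ↔ OpBound x C := by
  constructor
  · intro h ξ
    simpa [Fintype.sum_sum_type] using h (Sum.elim (fun _ => 0) ξ)
  · intro h ξ
    have h1 := h fun j => ξ (Sum.inr j)
    simp only [Fintype.sum_sum_type, Sum.elim_inl, Sum.elim_inr, zero_apply,
      Finset.sum_const_zero, zero_add, norm_zero, mul_add]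
    simp only [ne_eq, OfNat.ofNat_ne_zero, not_false_eq_true, zero_pow, Finset.sum_const_zero,
      add_zero]
    have : 0 ≤ C ^ 2 * ∑ i, ‖ξ (Sum.inl i)‖ ^ 2 := by positivity
    linarith

theorem norm_sum_inner_le (η ζ : ι → F) :
    ‖∑ i, ⟪η i, ζ i⟫_ℂ‖ ≤ √(∑ i, ‖η i‖ ^ 2) * √(∑ i, ‖ζ i‖ ^ 2) := by
  refine (norm_sum_le _ _).trans ?_
  refine le_trans (Finset.sum_le_sum fun i _ => norm_inner_le_norm _ _) ?_
  exact Real.sum_mul_le_sqrt_mul_sqrt Finset.univ (fun i => ‖η i‖) (fun i => ‖ζ i‖)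

theorem OpBound.norm_sum_inner_le {x : ι → κ → E →L[ℂ] F} {C : ℝ} (h : OpBound x C)
    (hC : 0 ≤ C) (η : ι → F) (ξ : κ → E) :
    ‖∑ i, ∑ j, ⟪η i, x i j (ξ j)⟫_ℂ‖ ≤ C * (√(∑ i, ‖η i‖ ^ 2) * √(∑ j, ‖ξ j‖ ^ 2)) := by
  simp only [← inner_sum]
  refine (DualOpAlg.norm_sum_inner_le _ _).trans ?_
  have : √(∑ i, ‖∑ j, x i j (ξ j)‖ ^ 2) ≤ C * √(∑ j, ‖ξ j‖ ^ 2) := by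
    rw [← Real.sqrt_sq hC, ← Real.sqrt_mul (sq_nonneg _)]
    exact Real.sqrt_le_sqrt (h ξ)
  calc _ ≤ √(∑ i, ‖η i‖ ^ 2) * (C * √(∑ j, ‖ξ j‖ ^ 2)) := by gcongr
    _ = _ := by ring

/-- Test with `η = xξ`: the left side becomes the square `S` of the norm of `xξ`, and one factor
`√S` cancels. -/
theorem opBound_of_inner {x : ι → κ → E →L[ℂ] F} {C : ℝ}
    (h : ∀ (η : ι → F) (ξ : κ → E), ‖∑ i, ∑ j, ⟪η i, x i j (ξ j)⟫_ℂ‖ ≤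
      C * (√(∑ i, ‖η i‖ ^ 2) * √(∑ j, ‖ξ j‖ ^ 2))) : OpBound x C := fun ξ => by
  have h1 := h (fun i => ∑ j, x i j (ξ j)) ξ
  simp only [← inner_sum, inner_self_eq_norm_sq_to_K] at h1
  set S := ∑ i, ‖∑ j, x i j (ξ j)‖ ^ 2 with hS
  set T := ∑ j, ‖ξ j‖ ^ 2
  have hS0 : 0 ≤ S := by positivity
  have hT0 : 0 ≤ T := by positivity
  have h2 : ‖∑ i, ((‖∑ j, x i j (ξ j)‖ : ℂ)) ^ 2‖ = S := by
    have : ∑ i, ((‖∑ j, x i j (ξ j)‖ : ℂ)) ^ 2 = (S : ℂ) := by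
      rw [hS]
      push_cast
      rfl
    rw [this, Complex.norm_real, Real.norm_of_nonneg hS0]
  have h3 : S ≤ C * (√S * √T) := h2 ▸ h1
  rcases hS0.eq_or_lt with h0 | h0
  · rw [← h0]; positivity
  · have h4 : √S ≤ C * √T := by
      refine le_of_mul_le_mul_left ?_ (Real.sqrt_pos.2 h0)
      rw [Real.mul_self_sqrt hS0]
      linarith
    calc S = √S ^ 2 := (Real.sq_sqrt hS0).symm
      _ ≤ (C * √T) ^ 2 := by gcongr
      _ = _ := by rw [mul_pow, Real.sq_sqrt hT0]

theorem OpBound.add {x y : ι → κ → E →L[ℂ] F} {C D : ℝ} (hx : OpBound x C) (hy : OpBound y D)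
    (hC : 0 ≤ C) (hD : 0 ≤ D) : OpBound (fun i j => x i j + y i j) (C + D) :=
  opBound_of_inner fun η ξ => by
    simp only [add_apply, inner_add_right, Finset.sum_add_distrib, add_mul]
    exact (norm_add_le _ _).trans
      (add_le_add (hx.norm_sum_inner_le hC η ξ) (hy.norm_sum_inner_le hD η ξ))

theorem OpBound.smul {x : ι → κ → E →L[ℂ] F} {C : ℝ} (hx : OpBound x C) (c : ℂ) :
    OpBound (fun i j => c • x i j) (‖c‖ * C) := fun ξ => by
  simp only [smul_apply, ← Finset.smul_sum, norm_smul, mul_pow, ← Finset.mul_sum]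
  rw [mul_assoc]
  gcongr
  exact hx ξ

theorem OpBound.neg {x : ι → κ → E →L[ℂ] F} {C : ℝ} (hx : OpBound x C) :
    OpBound (fun i j => -x i j) C := by
  simpa using hx.smul (-1)

theorem opBound_const_comp {x : ι → κ → E →L[ℂ] F} {C : ℝ} (hx : OpBound x C) (T : F →L[ℂ] G) :
    OpBound (fun i j => T ∘L x i j) (‖T‖ * C) := fun ξ => by
  simp only [ContinuousLinearMap.comp_apply, ← map_sum]
  calc _ ≤ ∑ i, (‖T‖ * ‖∑ j, x i j (ξ j)‖) ^ 2 := by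
        gcongr; exact T.le_opNorm _
    _ = ‖T‖ ^ 2 * ∑ i, ‖∑ j, x i j (ξ j)‖ ^ 2 := by simp only [mul_pow, Finset.mul_sum]
    _ ≤ ‖T‖ ^ 2 * (C ^ 2 * ∑ j, ‖ξ j‖ ^ 2) := by gcongr; exact hx ξ
    _ = _ := by ring

theorem opBound_unit {T : E →L[ℂ] F} {C : ℝ} (hC : 0 ≤ C) :
    OpBound (fun _ _ : Unit => T) C ↔ ‖T‖ ≤ C := by
  constructor
  · intro h
    refine T.opNorm_le_bound hC fun v => ?_
    have := h fun _ => v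
    simp only [Finset.univ_unique, Finset.sum_singleton, ← mul_pow] at this
    exact (pow_le_pow_iff_left₀ (norm_nonneg _) (by positivity) two_ne_zero).1 this
  · intro h ξ
    simp only [Finset.univ_unique, Finset.sum_singleton, ← mul_pow]
    gcongr
    exact T.le_of_opNorm_le h _

end OpBound

/-! ### Complete boundedness as estimates on matrices with arbitrary finite index sets. -/

section CB

variable {H : Type*} [NormedAddCommGroup H] [InnerProductSpace ℂ H]
variable {K : Type*} [NormedAddCommGroup K] [InnerProductSpace ℂ K]
variable {M : Subalgebra ℂ (H →L[ℂ] H)} {N : Subalgebra ℂ (K →L[ℂ] K)}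

theorem matNorm_le_iff {n : ℕ} {x : Matrix (Fin n) (Fin n) M} {C : ℝ} (hC : 0 ≤ C) :
    matNorm x ≤ C ↔ OpBound (fun i j => (x i j : H →L[ℂ] H)) C := by
  have key : ∀ ξ : PiLp 2 fun _ : Fin n => H,
      (‖matOp (x.map fun a : M => (a : H →L[ℂ] H)) ξ‖ ≤ C * ‖ξ‖ ↔
        ∑ i, ‖∑ j, (x i j : H →L[ℂ] H) (ξ j)‖ ^ 2 ≤ C ^ 2 * ∑ j, ‖ξ j‖ ^ 2) := fun ξ => by
    rw [← pow_le_pow_iff_left₀ (norm_nonneg _) (by positivity) two_ne_zero, mul_pow,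
      PiLp.norm_sq_eq_of_L2, PiLp.norm_sq_eq_of_L2]
    simp only [matOp_apply, Matrix.map_apply]
  constructor
  · intro h ξ
    exact (key (WithLp.toLp 2 ξ)).1 (ContinuousLinearMap.le_of_opNorm_le _ h _)
  · intro h
    exact ContinuousLinearMap.opNorm_le_bound _ hC fun ξ => (key ξ).2 (h ξ)

/-- Complete boundedness of an operator valued map, tested on rectangular matrices. -/
def CBBound (α : M → K →L[ℂ] K) (A : ℝ) : Prop :=
  ∀ (ι κ : Type) [Fintype ι] [Fintype κ] (x : ι → κ → M) (C : ℝ), 0 ≤ C →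
    OpBound (fun i j => (x i j : H →L[ℂ] H)) C → OpBound (fun i j => α (x i j)) (A * C)

/-- Complete boundedness of an operator valued map of two variables. -/
def CBBound₂ (B : M → M → K →L[ℂ] K) (A : ℝ) : Prop :=
  ∀ (ι : Type) [Fintype ι] (x y : ι → ι → M) (C D : ℝ), 0 ≤ C → 0 ≤ D →
    OpBound (fun i j => (x i j : H →L[ℂ] H)) C → OpBound (fun i j => (y i j : H →L[ℂ] H)) D →
      OpBound (fun i j => ∑ k, B (x i k) (y k j)) (A * (C * D))

theorem opBound_smul_le_one {ι : Type*} [Fintype ι] {x : ι → ι → M} {C : ℝ} (hC : 0 < C)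
    (hx : OpBound (fun i j => (x i j : H →L[ℂ] H)) C) :
    OpBound (fun i j => (((C⁻¹ : ℝ) : ℂ) • x i j : H →L[ℂ] H)) 1 := by
  have := hx.smul ((C⁻¹ : ℝ) : ℂ)
  rwa [Complex.norm_real, Real.norm_of_nonneg (inv_nonneg.2 hC.le), inv_mul_cancel₀ hC.ne'] at this

theorem eq_zero_of_opBound_zero {ι κ E F : Type*} [NormedAddCommGroup E] [InnerProductSpace ℂ E]
    [NormedAddCommGroup F] [InnerProductSpace ℂ F] [Fintype ι] [Fintype κ]
    {x : ι → κ → E →L[ℂ] F} (hx : OpBound x 0) (i : ι) (j : κ) : x i j = 0 := by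
  classical
  ext v
  have h := hx (Pi.single j v)
  rw [zero_pow two_ne_zero, zero_mul] at h
  have h1 : ‖∑ l, x i l (Pi.single (M := fun _ => E) j v l)‖ ^ 2 ≤ 0 :=
    (Finset.single_le_sum (f := fun i => ‖∑ l, x i l (Pi.single (M := fun _ => E) j v l)‖ ^ 2)
      (fun i _ => sq_nonneg _) (Finset.mem_univ i)).trans h
  rw [Finset.sum_eq_single j (fun l _ hl => by simp [Pi.single_eq_of_ne hl]) (by simp)] at h1
  simpa using h1

theorem cbBound_of_square (α : M →ₗ[ℂ] K →L[ℂ] K) {A : ℝ}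
    (h : ∀ (ι : Type) [Fintype ι] (x : ι → ι → M) (C : ℝ), 0 ≤ C →
      OpBound (fun i j => (x i j : H →L[ℂ] H)) C → OpBound (fun i j => α (x i j)) (A * C)) :
    CBBound α A := by
  intro ι κ _ _ x C hC hx
  have h4 := h (ι ⊕ κ) (fun p q => Sum.elim (fun i => Sum.elim (fun _ => 0) (x i) q)
      (fun _ => 0) p) C hC (by
    refine Eq.mp ?_ (opBound_block.2 hx)
    congr 1
    funext p q
    rcases p with p | p <;> rcases q with q | q <;> rfl)
  refine opBound_block.1 (Eq.mp ?_ h4)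
  congr 1
  funext p q
  rcases p with p | p <;> rcases q with q | q <;> simp

/-- The supremum only sees contractive matrices indexed by `Fin n`. Reindexing, scaling by `C⁻¹`
(with `C = 0` forcing all entries to vanish) and the corner embedding give the general estimate. -/
theorem cbBound_of_cbNorm_le {L : M →ₗ[ℂ] N} {A : ℝ} (hA : 0 ≤ A)
    (h : cbNorm L ≤ ENNReal.ofReal A) : CBBound (fun a => (L a : K →L[ℂ] K)) A := by
  have h1 : ∀ (n : ℕ) (x : Matrix (Fin n) (Fin n) M),
      OpBound (fun i j => (x i j : H →L[ℂ] H)) 1 →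
      OpBound (fun i j => (L (x i j) : K →L[ℂ] K)) A := fun n x hx => by
    have h2 := (matNorm_le_iff zero_le_one).2 hx
    have h3 : ENNReal.ofReal (matNorm (x.map L)) ≤ cbNorm L :=
      le_iSup_of_le n (le_iSup_of_le x (le_iSup_of_le h2 le_rfl))
    exact (matNorm_le_iff hA).1 ((ENNReal.ofReal_le_ofReal_iff hA).1 (h3.trans h))
  have h2 : ∀ (ι : Type) [Fintype ι] (x : ι → ι → M), OpBound (fun i j => (x i j : H →L[ℂ] H)) 1 →
      OpBound (fun i j => (L (x i j) : K →L[ℂ] K)) A := fun ι _ x hx => by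
    have e := Fintype.equivFin ι
    have h3 := h1 _ (Matrix.of fun i j => x (e.symm i) (e.symm j)) (hx.reindex e.symm e.symm)
    simpa using h3.reindex e e
  have h3 : ∀ (ι : Type) [Fintype ι] (x : ι → ι → M) (C : ℝ), 0 ≤ C →
      OpBound (fun i j => (x i j : H →L[ℂ] H)) C →
      OpBound (fun i j => (L (x i j) : K →L[ℂ] K)) (A * C) := fun ι _ x C hC hx => by
    rcases hC.eq_or_lt with rfl | hC'
    · have : ∀ i j, x i j = 0 := fun i j => Subtype.ext (eq_zero_of_opBound_zero hx i j)
      intro ξ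
      simp [this]
    · have h4 := (h2 ι (fun i j => ((C⁻¹ : ℝ) : ℂ) • x i j) (opBound_smul_le_one hC' hx)).smul (C : ℂ)
      have h5 : ∀ a : M, (C : ℂ) • (L (((C⁻¹ : ℝ) : ℂ) • a) : K →L[ℂ] K) = L a := fun a => by
        rw [map_smul]
        have : (C : ℂ) • ((C⁻¹ : ℝ) : ℂ) • L a = L a := by
          rw [smul_smul, ← Complex.ofReal_mul, mul_inv_cancel₀ hC'.ne', Complex.ofReal_one, one_smul]
        exact congrArg Subtype.val this
      simp only [h5] at h4
      rwa [Complex.norm_real, Real.norm_of_nonneg hC, mul_comm] at h4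
  exact cbBound_of_square (N.val.toLinearMap ∘ₗ L) h3

theorem cbNorm_le_of_cbBound {L : M →ₗ[ℂ] N} {A : ℝ} (hA : 0 ≤ A)
    (h : CBBound (fun a => (L a : K →L[ℂ] K)) A) : cbNorm L ≤ ENNReal.ofReal A := by
  refine iSup_le fun n => iSup_le fun x => iSup_le fun hx => ?_
  refine ENNReal.ofReal_le_ofReal ((matNorm_le_iff hA).2 ?_)
  have := h (Fin n) (Fin n) x 1 zero_le_one ((matNorm_le_iff zero_le_one).1 hx)
  rwa [mul_one] at this

theorem cbBound₂_of_cbNorm₂_le {B : M →ₗ[ℂ] M →ₗ[ℂ] N} {A : ℝ} (hA : 0 ≤ A)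
    (h : cbNorm₂ B ≤ ENNReal.ofReal A) : CBBound₂ (fun a b => (B a b : K →L[ℂ] K)) A := by
  have h1 : ∀ (n : ℕ) (x y : Matrix (Fin n) (Fin n) M),
      OpBound (fun i j => (x i j : H →L[ℂ] H)) 1 → OpBound (fun i j => (y i j : H →L[ℂ] H)) 1 →
      OpBound (fun i j => ∑ k, (B (x i k) (y k j) : K →L[ℂ] K)) A := fun n x y hx hy => by
    have hx' := (matNorm_le_iff zero_le_one).2 hx
    have hy' := (matNorm_le_iff zero_le_one).2 hy
    have h3 : ENNReal.ofReal (matNorm (bilAmp B x y)) ≤ cbNorm₂ B :=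
      le_iSup_of_le n (le_iSup_of_le x (le_iSup_of_le y (le_iSup_of_le hx'
        (le_iSup_of_le hy' le_rfl))))
    have h4 := (matNorm_le_iff hA).1 ((ENNReal.ofReal_le_ofReal_iff hA).1 (h3.trans h))
    simpa [bilAmp] using h4
  have h2 : ∀ (ι : Type) [Fintype ι] (x y : ι → ι → M),
      OpBound (fun i j => (x i j : H →L[ℂ] H)) 1 → OpBound (fun i j => (y i j : H →L[ℂ] H)) 1 →
      OpBound (fun i j => ∑ k, (B (x i k) (y k j) : K →L[ℂ] K)) A := fun ι _ x y hx hy => by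
    have e := Fintype.equivFin ι
    have h3 := h1 _ (Matrix.of fun i j => x (e.symm i) (e.symm j))
      (Matrix.of fun i j => y (e.symm i) (e.symm j)) (hx.reindex e.symm e.symm)
      (hy.reindex e.symm e.symm)
    have h4 := h3.reindex e e
    simpa [← e.sum_comp] using h4
  intro ι _ x y C D hC hD hx hy
  rcases hC.eq_or_lt with rfl | hC'
  · have : ∀ i j, x i j = 0 := fun i j => Subtype.ext (eq_zero_of_opBound_zero hx i j)
    intro ξ
    simp [this]
  rcases hD.eq_or_lt with rfl | hD'
  · have : ∀ i j, y i j = 0 := fun i j => Subtype.ext (eq_zero_of_opBound_zero hy i j)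
    intro ξ
    simp [this]
  have h4 := (h2 ι (fun i j => ((C⁻¹ : ℝ) : ℂ) • x i j) (fun i j => ((D⁻¹ : ℝ) : ℂ) • y i j)
    (opBound_smul_le_one hC' hx) (opBound_smul_le_one hD' hy)).smul ((C * D : ℝ) : ℂ)
  have h5 : ∀ a b : M, ((C * D : ℝ) : ℂ) •
      (B (((C⁻¹ : ℝ) : ℂ) • a) (((D⁻¹ : ℝ) : ℂ) • b) : K →L[ℂ] K) = B a b := fun a b => by
    have : ((C * D : ℝ) : ℂ) • (B (((C⁻¹ : ℝ) : ℂ) • a) (((D⁻¹ : ℝ) : ℂ) • b)) = B a b := by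
      rw [map_smul, map_smul, LinearMap.smul_apply, smul_smul, smul_smul, ← Complex.ofReal_mul,
        ← Complex.ofReal_mul]
      have : C * D * D⁻¹ * C⁻¹ = 1 := by field_simp
      simp [this]
    exact congrArg Subtype.val this
  simp only [Finset.smul_sum, h5] at h4
  rwa [Complex.norm_real, Real.norm_of_nonneg (mul_nonneg hC hD), mul_comm] at h4

end CB

/-- The Riesz representation of bounded sesquilinear forms. It produces both the averages `u[E]` and
the operator representing a functional on the predual. -/
theorem exists_clm_of_sesquilinear {E : Type*} [NormedAddCommGroup E] [InnerProductSpace ℂ E]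
    [CompleteSpace E] (s : E → E → ℂ) (add_left : ∀ η η' ξ, s (η + η') ξ = s η ξ + s η' ξ)
    (smul_left : ∀ (c : ℂ) η ξ, s (c • η) ξ = starRingEnd ℂ c * s η ξ)
    (add_right : ∀ η ξ ξ', s η (ξ + ξ') = s η ξ + s η ξ')
    (smul_right : ∀ (c : ℂ) η ξ, s η (c • ξ) = c * s η ξ)
    {C : ℝ} (hC : 0 ≤ C) (hs : ∀ η ξ, ‖s η ξ‖ ≤ C * (‖η‖ * ‖ξ‖)) :
    ∃ T : E →L[ℂ] E, ‖T‖ ≤ C ∧ ∀ η ξ, ⟪η, T ξ⟫_ℂ = s η ξ := by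
  -- Conjugating and swapping the arguments gives the form `⟪T ξ, η⟫`, which is conjugate linear in
  -- `ξ`.
  let Q : E →ₗ⋆[ℂ] E →ₗ[ℂ] ℂ := LinearMap.mk₂'ₛₗ (starRingEnd ℂ) (RingHom.id ℂ)
    (fun ξ η => starRingEnd ℂ (s η ξ)) (fun ξ ξ' η => by simp [add_right])
    (fun c ξ η => by simp [smul_right]) (fun ξ η η' => by simp [add_left])
    (fun c ξ η => by simp [smul_left])
  let B : E →L⋆[ℂ] E →L[ℂ] ℂ := Q.mkContinuous₂ C fun ξ η => by
    have := hs η ξ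
    simp only [Q, LinearMap.mk₂'ₛₗ_apply, RCLike.norm_conj]
    linarith
  let T := InnerProductSpace.continuousLinearMapOfBilin B
  have hT : ∀ η ξ, ⟪η, T ξ⟫_ℂ = s η ξ := fun η ξ => by
    rw [← inner_conj_symm, InnerProductSpace.continuousLinearMapOfBilin_apply]
    simp [B, Q]
  refine ⟨T, T.opNorm_le_bound hC fun ξ => ?_, hT⟩
  have h1 : ‖T ξ‖ * ‖T ξ‖ ≤ ‖T ξ‖ * (C * ‖ξ‖) := by
    have h2 := hs (T ξ) ξ
    rw [← hT, inner_self_eq_norm_sq_to_K, norm_pow, RCLike.norm_ofReal, abs_norm] at h2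
    linarith
  rcases (norm_nonneg (T ξ)).eq_or_lt with h0 | h0
  · rw [← h0]; positivity
  · exact le_of_mul_le_mul_left h1 h0

/-! ### Functionals of trace class type. -/

section TraceRep

variable {H : Type*} [NormedAddCommGroup H] [InnerProductSpace ℂ H]
variable {V : Type*} [AddCommGroup V] [Module ℂ V]

/-- The function `f` is of the form `a ↦ ∑ₙ ⟪ηₙ, ρ(a) ξₙ⟫` with `∑ ‖ηₙ‖ ‖ξₙ‖ ≤ r`. -/
def TraceRep (ρ : V →ₗ[ℂ] (H →L[ℂ] H)) (f : V → ℂ) (r : ℝ) : Prop :=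
  ∃ η ξ : ℕ → H, (Summable fun n => ‖η n‖ * ‖ξ n‖) ∧ ∑' n, ‖η n‖ * ‖ξ n‖ ≤ r ∧
    ∀ a, HasSum (fun n => ⟪η n, ρ a (ξ n)⟫_ℂ) (f a)

variable {ρ : V →ₗ[ℂ] (H →L[ℂ] H)}

theorem TraceRep.mono {f : V → ℂ} {r r' : ℝ} (h : TraceRep ρ f r) (hr : r ≤ r') :
    TraceRep ρ f r' := by
  obtain ⟨η, ξ, h1, h2, h3⟩ := h
  exact ⟨η, ξ, h1, h2.trans hr, h3⟩

theorem TraceRep.nonneg {f : V → ℂ} {r : ℝ} (h : TraceRep ρ f r) : 0 ≤ r := by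
  obtain ⟨η, ξ, h1, h2, h3⟩ := h
  exact (tsum_nonneg fun n => by positivity).trans h2

theorem traceRep_inner (η ξ : H) : TraceRep ρ (fun a => ⟪η, ρ a ξ⟫_ℂ) (‖η‖ * ‖ξ‖) := by
  have h : HasSum (fun n => ‖(Pi.single 0 η : ℕ → H) n‖ * ‖(Pi.single 0 ξ : ℕ → H) n‖)
      (‖η‖ * ‖ξ‖) := by
    have := hasSum_single (f := fun n => ‖(Pi.single 0 η : ℕ → H) n‖ *
      ‖(Pi.single 0 ξ : ℕ → H) n‖) 0 fun n hn => by simp [Pi.single_eq_of_ne hn]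
    simpa using this
  refine ⟨Pi.single 0 η, Pi.single 0 ξ, h.summable, h.tsum_eq.le, fun a => ?_⟩
  have := hasSum_single (f := fun n => ⟪(Pi.single 0 η : ℕ → H) n,
    ρ a ((Pi.single 0 ξ : ℕ → H) n)⟫_ℂ) 0 fun n hn => by simp [Pi.single_eq_of_ne hn]
  simpa using this

theorem traceRep_zero : TraceRep ρ (fun _ => 0) 0 := by
  simpa using traceRep_inner (ρ := ρ) 0 0

theorem TraceRep.smul {f : V → ℂ} {r : ℝ} (h : TraceRep ρ f r) (c : ℂ) :
    TraceRep ρ (fun a => c * f a) (‖c‖ * r) := by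
  obtain ⟨η, ξ, h1, h2, h3⟩ := h
  refine ⟨fun n => starRingEnd ℂ c • η n, ξ, ?_, ?_, fun a => ?_⟩
  · simpa [norm_smul, mul_assoc] using h1.mul_left ‖c‖
  · simp only [norm_smul, mul_assoc, RCLike.norm_conj, tsum_mul_left]
    gcongr
  · simpa [inner_smul_left, mul_comm c] using (h3 a).mul_left c

theorem TraceRep.tsum {f : ℕ → V → ℂ} {F : V → ℂ} {r : ℕ → ℝ} (h : ∀ k, TraceRep ρ (f k) (r k))
    (hr : Summable r) (hF : ∀ a, HasSum (fun k => f k a) (F a)) : TraceRep ρ F (∑' k, r k) := by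
  choose η ξ h1 h2 h3 using h
  have h0 : ∀ k, 0 ≤ ∑' n, ‖η k n‖ * ‖ξ k n‖ := fun k => tsum_nonneg fun n => by positivity
  have hs1 : Summable fun k => ∑' n, ‖η k n‖ * ‖ξ k n‖ :=
    Summable.of_nonneg_of_le h0 h2 hr
  have hs : Summable fun p : ℕ × ℕ => ‖η p.1 p.2‖ * ‖ξ p.1 p.2‖ :=
    (summable_prod_of_nonneg fun p => by positivity).2 ⟨h1, hs1⟩
  have e := Nat.pairEquiv.symm
  refine ⟨fun n => η (e n).1 (e n).2, fun n => ξ (e n).1 (e n).2, ?_, ?_, fun a => ?_⟩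
  · exact e.summable_iff.2 hs
  · rw [e.tsum_eq fun p : ℕ × ℕ => ‖η p.1 p.2‖ * ‖ξ p.1 p.2‖, hs.tsum_prod]
    exact hs1.tsum_le_tsum h2 hr
  · have hs2 : Summable fun p : ℕ × ℕ => ⟪η p.1 p.2, ρ a (ξ p.1 p.2)⟫_ℂ := by
      refine Summable.of_norm_bounded (hs.mul_left ‖ρ a‖) fun p => ?_
      refine (norm_inner_le_norm _ _).trans ?_
      have := mul_le_mul_of_nonneg_left ((ρ a).le_opNorm (ξ p.1 p.2)) (norm_nonneg (η p.1 p.2))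
      linarith
    refine (e.hasSum_iff (f := fun p : ℕ × ℕ => ⟪η p.1 p.2, ρ a (ξ p.1 p.2)⟫_ℂ)).2 ?_
    have h4 := (hs2.hasSum.prod_fiberwise fun k => h3 k a).unique (hF a)
    exact h4 ▸ hs2.hasSum

theorem TraceRep.add {f g : V → ℂ} {r s : ℝ} (hf : TraceRep ρ f r) (hg : TraceRep ρ g s) :
    TraceRep ρ (fun a => f a + g a) (r + s) := by
  let F : ℕ → V → ℂ := fun k => if k = 0 then f else if k = 1 then g else fun _ => 0
  let R : ℕ → ℝ := fun k => if k = 0 then r else if k = 1 then s else 0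
  have hR : HasSum R (r + s) := by
    have : HasSum R (∑ k ∈ Finset.range 2, R k) := hasSum_sum_of_ne_finset_zero (by
      intro k hk
      have : 1 < k := by simpa using hk
      simp [R, show k ≠ 0 by omega, show k ≠ 1 by omega])
    simpa [R, Finset.sum_range_succ] using this
  rw [← hR.tsum_eq]
  refine TraceRep.tsum (f := F) (fun k => ?_) hR.summable fun a => ?_
  · by_cases h0 : k = 0
    · simpa [F, R, h0] using hf
    by_cases h1 : k = 1
    · simpa [F, R, h1] using hg
    · simpa [F, R, h0, h1] using traceRep_zero
  · have : HasSum (fun k => F k a) (∑ k ∈ Finset.range 2, F k a) := hasSum_sum_of_ne_finset_zero (by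
      intro k hk
      have : 1 < k := by simpa using hk
      simp [F, show k ≠ 0 by omega, show k ≠ 1 by omega])
    simpa [F, Finset.sum_range_succ] using this

theorem summable_inner_clm {η ξ : ℕ → H} (h : Summable fun n => ‖η n‖ * ‖ξ n‖) (T : H →L[ℂ] H) :
    Summable fun n => ⟪η n, T (ξ n)⟫_ℂ := by
  refine Summable.of_norm_bounded (h.mul_left ‖T‖) fun n => ?_
  refine (norm_inner_le_norm _ _).trans ?_
  have := mul_le_mul_of_nonneg_left (T.le_opNorm (ξ n)) (norm_nonneg (η n))
  linarith

/-- The functional `T ↦ ∑ₙ ⟪ηₙ, T ξₙ⟫`. -/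
def tsumInner (η ξ : ℕ → H) (h : Summable fun n => ‖η n‖ * ‖ξ n‖) :
    (H →L[ℂ] H) →ₗ[ℂ] ℂ where
  toFun T := ∑' n, ⟪η n, T (ξ n)⟫_ℂ
  map_add' S T := by
    simp only [add_apply, inner_add_right]
    exact (summable_inner_clm h S).tsum_add (summable_inner_clm h T)
  map_smul' c T := by
    simp only [smul_apply, inner_smul_right, RingHom.id_apply, smul_eq_mul]
    exact tsum_mul_left

/-- The topology is the initial one for a family of linear functionals, so a continuous functional
is a finite linear combination of members of the family. -/
theorem traceRep_of_continuous (f : V →ₗ[ℂ] ℂ)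
    (hf : Continuous[TopologicalSpace.induced ρ (wstarTopology H), inferInstance] f) :
    ∃ r, TraceRep ρ f r := by
  let I := {p : (ℕ → H) × (ℕ → H) //
      (Summable fun n => ‖p.1 n‖ ^ 2) ∧ Summable fun n => ‖p.2 n‖ ^ 2}
  let φ : I → V →ₗ[ℂ] ℂ := fun p =>
    tsumInner p.1.2 p.1.1 (summable_inner_apply p.2.1 p.2.2) ∘ₗ ρ
  have h1 : TopologicalSpace.induced ρ (wstarTopology H) =
      ⨅ p, TopologicalSpace.induced (φ p) inferInstance := by
    simp only [wstarTopology, induced_iInf, induced_compose]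
    rfl
  rw [h1, ← LinearMap.mem_span_iff_continuous] at hf
  induction hf using Submodule.span_induction with
  | mem g hg =>
    obtain ⟨p, rfl⟩ := hg
    have hs := summable_inner_apply p.2.1 p.2.2
    exact ⟨_, p.1.2, p.1.1, hs, le_rfl, fun a => (summable_inner_clm hs (ρ a)).hasSum⟩
  | zero => exact ⟨0, traceRep_zero⟩
  | add g g' _ _ h h' =>
    obtain ⟨r, hr⟩ := h
    obtain ⟨r', hr'⟩ := h'
    exact ⟨_, hr.add hr'⟩
  | smul c g _ h =>
    obtain ⟨r, hr⟩ := h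
    exact ⟨_, hr.smul c⟩

/-- Rescaling the two vectors against each other by `√(‖η‖ / ‖ξ‖)` turns summability of `‖ηₙ‖ ‖ξₙ‖`
into the separate square summability required in `wstarTopology`. -/
theorem exists_balanced (η ξ : H) : ∃ η' ξ' : H, ‖η'‖ ^ 2 = ‖η‖ * ‖ξ‖ ∧ ‖ξ'‖ ^ 2 = ‖η‖ * ‖ξ‖ ∧
    ∀ T : H →L[ℂ] H, ⟪η', T ξ'⟫_ℂ = ⟪η, T ξ⟫_ℂ := by
  rcases eq_or_ne η 0 with rfl | hη
  · exact ⟨0, 0, by simp, by simp, by simp⟩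
  rcases eq_or_ne ξ 0 with rfl | hξ
  · exact ⟨0, 0, by simp, by simp, by simp⟩
  have h1 := norm_pos_iff.2 hη
  have h2 := norm_pos_iff.2 hξ
  set s : ℝ := √(‖η‖ / ‖ξ‖)
  have hs : 0 < s := Real.sqrt_pos.2 (by positivity)
  have hs2 : s ^ 2 = ‖η‖ / ‖ξ‖ := Real.sq_sqrt (by positivity)
  refine ⟨((s⁻¹ : ℝ) : ℂ) • η, (s : ℂ) • ξ, ?_, ?_, fun T => ?_⟩
  · rw [norm_smul, Complex.norm_real, Real.norm_of_nonneg (by positivity), mul_pow, inv_pow, hs2]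
    field_simp
  · rw [norm_smul, Complex.norm_real, Real.norm_of_nonneg (by positivity), mul_pow, hs2]
    field_simp
  · rw [map_smul, inner_smul_left, inner_smul_right, Complex.conj_ofReal, ← mul_assoc,
      ← Complex.ofReal_mul, inv_mul_cancel₀ hs.ne', Complex.ofReal_one, one_mul]

end TraceRep

/-! ### Two forms of the Hahn–Banach theorem. -/

section HahnBanach

theorem exists_mem_span_of_isClosed {V ι : Type*} [AddCommGroup V] [Module ℂ V]
    (φ : ι → V →ₗ[ℂ] ℂ) (S : Submodule ℂ V)
    (hS : IsClosed[⨅ i, TopologicalSpace.induced (φ i) inferInstance] (S : Set V)) {x : V}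
    (hx : x ∉ S) : ∃ f ∈ Submodule.span ℂ (Set.range φ), (∀ y ∈ S, f y = 0) ∧ f x ≠ 0 := by
  let _ : TopologicalSpace V := ⨅ i, TopologicalSpace.induced (φ i) inferInstance
  have : IsTopologicalAddGroup V :=
    topologicalAddGroup_iInf fun i => topologicalAddGroup_induced (φ i)
  have : ContinuousSMul ℂ V := continuousSMul_iInf fun i => continuousSMul_induced (φ i)
  have : LocallyConvexSpace ℝ V :=
    LocallyConvexSpace.iInf fun i => LocallyConvexSpace.induced ((φ i).restrictScalars ℝ)
  obtain ⟨f, c, h1, h2⟩ := RCLike.geometric_hahn_banach_closed_point (𝕜 := ℂ)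
    (S.restrictScalars ℝ).convex hS hx
  have h0 : 0 < c := by simpa using h1 0 S.zero_mem
  have h3 : ∀ y ∈ S, f y = 0 := fun y hy => by
    by_contra hne
    -- If `f y ≠ 0`, a multiple of `y` in `S` takes the value `c`, against the strict bound by `c`
    -- on `S`.
    have h4 := h1 _ (S.smul_mem ((c : ℂ) * (f y)⁻¹) hy)
    rw [map_smul, smul_eq_mul, mul_assoc, inv_mul_cancel₀ hne] at h4
    simp at h4
  refine ⟨f, (LinearMap.mem_span_iff_continuous _).2 f.continuous, h3, fun h4 => ?_⟩
  have : f x = 0 := h4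
  rw [this] at h2
  simp only [map_zero] at h2
  linarith

/-- The real theorem extends `c • x₀ ↦ c * N x₀`. Complexifying keeps the bound because `‖gc x‖²` is
`g` evaluated at the multiple of `x` by the conjugate of `gc x`. -/
theorem exists_linearMap_le_of_sublinear {E : Type*} [AddCommGroup E] [Module ℂ E] (N : E → ℝ)
    (N_add : ∀ x y, N (x + y) ≤ N x + N y) (N_smul : ∀ (c : ℂ) x, N (c • x) ≤ ‖c‖ * N x)
    (N_nonneg : ∀ x, 0 ≤ N x) (x₀ : E) :
    ∃ g : E →ₗ[ℂ] ℂ, (∀ x, ‖g x‖ ≤ N x) ∧ (g x₀).re = N x₀ := by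
  have N_hom : ∀ c : ℝ, 0 < c → ∀ x, N (c • x) = c * N x := fun c hc x => by
    have h1 : ∀ (c : ℝ) (_ : 0 < c) x, N (c • x) ≤ c * N x := fun c hc x => by
      have := N_smul (c : ℂ) x
      rwa [Complex.norm_real, Real.norm_of_nonneg hc.le, Complex.coe_smul] at this
    refine le_antisymm (h1 c hc x) ?_
    have h2 := h1 c⁻¹ (inv_pos.2 hc) (c • x)
    rw [smul_smul, inv_mul_cancel₀ hc.ne', one_smul] at h2
    rwa [← le_inv_mul_iff₀ hc]
  have N_zero : N 0 = 0 := le_antisymm (by simpa using N_smul 0 0) (N_nonneg 0)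
  have hw : ∀ c : ℝ, c • x₀ = 0 → (RingHom.id ℝ) c • N x₀ = 0 := fun c hc => by
    rcases eq_or_ne c 0 with rfl | h
    · simp
    · have : x₀ = 0 := (smul_eq_zero.1 hc).resolve_left h
      simp [this, N_zero]
  obtain ⟨g, hg1, hg2⟩ := exists_extension_of_le_sublinear
    (LinearPMap.mkSpanSingleton' x₀ (N x₀) hw) N N_hom N_add (by
      rintro ⟨x, hx⟩
      obtain ⟨c, rfl⟩ := Submodule.mem_span_singleton.1 hx
      rw [LinearPMap.mkSpanSingleton'_apply]
      rcases lt_or_ge 0 c with hc | hc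
      · exact (N_hom c hc x₀).ge
      · exact (mul_nonpos_of_nonpos_of_nonneg hc (N_nonneg _)).trans (N_nonneg _))
  have hx₀ := (hg1 ⟨x₀, Submodule.mem_span_singleton_self x₀⟩).trans
    (LinearPMap.mkSpanSingleton'_apply_self _ _ hw _)
  let gc : E →ₗ[ℂ] ℂ := Module.Dual.extendRCLike (𝕜 := ℂ) g
  refine ⟨gc, fun x => ?_, ?_⟩
  · have h1 := Module.Dual.norm_extendRCLike_apply_sq (𝕜 := ℂ) g x
    have h2 : ‖gc x‖ ^ 2 ≤ ‖gc x‖ * N x := by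
      refine (h1.trans_le ((hg2 _).trans (N_smul _ _))).trans_eq ?_
      rw [RCLike.norm_conj]
    rcases (norm_nonneg (gc x)).eq_or_lt with h0 | h0
    · rw [← h0]; exact N_nonneg x
    · refine le_of_mul_le_mul_left ?_ h0
      linarith
  · exact (Module.Dual.re_extendRCLike_apply (𝕜 := ℂ) g x₀).trans hx₀

end HahnBanach

/-! ### The quotient trace norm on trace class functionals. -/

section TraceNorm

variable {H : Type*} [NormedAddCommGroup H] [InnerProductSpace ℂ H]
variable {V : Type*} [AddCommGroup V] [Module ℂ V]

/-- The functionals `a ↦ ∑ₙ ⟪ηₙ, ρ(a) ξₙ⟫`. -/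
def traceForms (ρ : V →ₗ[ℂ] (H →L[ℂ] H)) : Submodule ℂ (V →ₗ[ℂ] ℂ) where
  carrier := {f | ∃ r, TraceRep ρ f r}
  zero_mem' := ⟨0, traceRep_zero⟩
  add_mem' := fun ⟨_, h⟩ ⟨_, h'⟩ => ⟨_, h.add h'⟩
  smul_mem' := fun c _ ⟨_, h⟩ => ⟨_, h.smul c⟩

/-- The quotient of the trace norm. -/
def traceNorm (ρ : V →ₗ[ℂ] (H →L[ℂ] H)) (f : V →ₗ[ℂ] ℂ) : ℝ := sInf {r | TraceRep ρ f r}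

variable {ρ : V →ₗ[ℂ] (H →L[ℂ] H)} {f g : V →ₗ[ℂ] ℂ}

theorem traceNorm_nonneg : 0 ≤ traceNorm ρ f := Real.sInf_nonneg fun _ h => h.nonneg

theorem traceNorm_le {r : ℝ} (h : TraceRep ρ f r) : traceNorm ρ f ≤ r :=
  csInf_le ⟨0, fun _ h => h.nonneg⟩ h

theorem traceRep_of_traceNorm_lt (hf : f ∈ traceForms ρ) {r : ℝ} (h : traceNorm ρ f < r) :
    TraceRep ρ f r := by
  obtain ⟨s, hs, hsr⟩ := exists_lt_of_csInf_lt hf h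
  exact TraceRep.mono hs hsr.le

theorem traceNorm_add_le (hf : f ∈ traceForms ρ) (hg : g ∈ traceForms ρ) :
    traceNorm ρ (f + g) ≤ traceNorm ρ f + traceNorm ρ g := by
  refine le_of_forall_pos_le_add fun ε hε => ?_
  have h1 := traceRep_of_traceNorm_lt hf (r := traceNorm ρ f + ε / 2) (by linarith)
  have h2 := traceRep_of_traceNorm_lt hg (r := traceNorm ρ g + ε / 2) (by linarith)
  refine (traceNorm_le (f := f + g) (h1.add h2)).trans (by linarith)

theorem traceNorm_smul_le (c : ℂ) (hf : f ∈ traceForms ρ) :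
    traceNorm ρ (c • f) ≤ ‖c‖ * traceNorm ρ f := by
  refine le_of_forall_pos_le_add fun ε hε => ?_
  have h1 := traceRep_of_traceNorm_lt hf (r := traceNorm ρ f + ε / (‖c‖ + 1))
    (by have := norm_nonneg c; linarith [show 0 < ε / (‖c‖ + 1) by positivity])
  refine (traceNorm_le (f := c • f) (h1.smul c)).trans ?_
  rw [mul_add]
  gcongr
  rw [mul_div_assoc', div_le_iff₀ (by positivity)]
  nlinarith [norm_nonneg c]

end TraceNorm

/-! ### The predual of a dual operator algebra and its completeness. -/

section Predual

variable {H : Type*} [NormedAddCommGroup H] [InnerProductSpace ℂ H]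
variable {M : Subalgebra ℂ (H →L[ℂ] H)}

theorem TraceRep.wstarContinuousForm {f : M → ℂ} {r : ℝ}
    (h : TraceRep M.val.toLinearMap f r) : WStarContinuousForm f := by
  obtain ⟨η, ξ, h1, -, h3⟩ := h
  choose η' ξ' h4 h5 h6 using fun n => exists_balanced (η n) (ξ n)
  have := wstar_functional_continuous (M := M) (ξ := ξ') (η := η') (by simpa [h5] using h1)
    (by simpa [h4] using h1)
  convert! this using 2 with a
  simp only [h6]
  exact (h3 a).tsum_eq.symm

theorem WStarContinuousForm.exists_traceRep {f : M →ₗ[ℂ] ℂ} (h : WStarContinuousForm f) :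
    ∃ r, TraceRep M.val.toLinearMap f r :=
  traceRep_of_continuous f h

theorem WStarContinuousForm.sub {f g : M → ℂ} (hf : WStarContinuousForm f)
    (hg : WStarContinuousForm g) : WStarContinuousForm fun a => f a - g a := by
  let _ : TopologicalSpace M := wstar M
  exact Continuous.sub (X := M) hf hg

theorem wstarContinuousForm_inner (η ξ : H) :
    WStarContinuousForm fun a : M => ⟪η, (a : H →L[ℂ] H) ξ⟫_ℂ :=
  (traceRep_inner (ρ := M.val.toLinearMap) η ξ).wstarContinuousForm

/-- A weak-star closed algebra contains every operator killed by its preannihilator. -/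
theorem IsDualOperatorAlgebra.mem_of_forall (hM : IsDualOperatorAlgebra M) (T : H →L[ℂ] H)
    (hT : ∀ η ξ : ℕ → H, (Summable fun n => ‖η n‖ * ‖ξ n‖) →
      (∀ a : M, ∑' n, ⟪η n, (a : H →L[ℂ] H) (ξ n)⟫_ℂ = 0) → ∑' n, ⟪η n, T (ξ n)⟫_ℂ = 0) :
    T ∈ M := by
  by_contra hTM
  let φ : {p : (ℕ → H) × (ℕ → H) //
      (Summable fun n => ‖p.1 n‖ ^ 2) ∧ Summable fun n => ‖p.2 n‖ ^ 2} → (H →L[ℂ] H) →ₗ[ℂ] ℂ :=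
    fun p => tsumInner p.1.2 p.1.1 (summable_inner_apply p.2.1 p.2.2)
  obtain ⟨f, hf, h1, h2⟩ := exists_mem_span_of_isClosed φ (Subalgebra.toSubmodule M) hM hTM
  have hcont := (LinearMap.mem_span_iff_continuous f).1 hf
  obtain ⟨r, η, ξ, h3, -, h4⟩ := traceRep_of_continuous (ρ := LinearMap.id) f
    (by rw [show (⇑(LinearMap.id : (H →L[ℂ] H) →ₗ[ℂ] _)) = id from rfl,
      @induced_id _ (wstarTopology H)]; exact hcont)
  refine h2 ?_
  rw [← (h4 T).tsum_eq]
  refine hT η ξ h3 fun a => ?_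
  rw [← h1 a a.2]
  exact (h4 a).tsum_eq

/-- This is the isometric duality between `M` and its predual. A Hahn–Banach functional `g`, bounded
by the trace norm and norming `f`, is given by a contraction `T` on `H`. Since `g` depends only on
restrictions to `M`, the operator `T` is killed by the preannihilator of `M` and so lies in `M`.
Hence the trace norm of `f` is `Re f(T) ≤ r`. -/
theorem IsDualOperatorAlgebra.traceNorm_le [CompleteSpace H] (hM : IsDualOperatorAlgebra M)
    {f : M →ₗ[ℂ] ℂ} (hf : WStarContinuousForm f) {r : ℝ} (hr₀ : 0 ≤ r) (hr : ∀ a, ‖f a‖ ≤ r * ‖a‖) :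
    traceNorm M.val.toLinearMap f ≤ r := by
  set ρ := M.val.toLinearMap with hρ
  let X := traceForms ρ
  let f₀ : X := ⟨f, hf.exists_traceRep⟩
  obtain ⟨g, hg, hg₀⟩ := exists_linearMap_le_of_sublinear (E := X) (fun f => traceNorm ρ f)
    (fun f g => traceNorm_add_le f.2 g.2) (fun c f => traceNorm_smul_le c f.2)
    (fun f => traceNorm_nonneg) f₀
  let ω : H → H → X := fun η ξ =>
    ⟨{ toFun := fun a => ⟪η, (a : H →L[ℂ] H) ξ⟫_ℂ
       map_add' := fun a b => by simp
       map_smul' := fun c a => by simp }, _, traceRep_inner η ξ⟩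
  have hω : ∀ η ξ (a : M), (ω η ξ : M →ₗ[ℂ] ℂ) a = ⟪η, (a : H →L[ℂ] H) ξ⟫_ℂ := fun _ _ _ => rfl
  obtain ⟨T, hT1, hT⟩ := exists_clm_of_sesquilinear (fun η ξ => g (ω η ξ))
    (fun η η' ξ => by
      rw [← map_add]; congr 1; refine Subtype.ext (LinearMap.ext fun a => ?_)
      simp [hω])
    (fun c η ξ => by
      rw [← smul_eq_mul, ← map_smul]; congr 1; refine Subtype.ext (LinearMap.ext fun a => ?_)
      simp [hω, mul_comm])
    (fun η ξ ξ' => by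
      rw [← map_add]; congr 1; refine Subtype.ext (LinearMap.ext fun a => ?_)
      simp [hω])
    (fun c η ξ => by
      rw [← smul_eq_mul, ← map_smul]; congr 1; refine Subtype.ext (LinearMap.ext fun a => ?_)
      simp [hω])
    zero_le_one (fun η ξ => by
      rw [one_mul]
      exact (hg _).trans (DualOpAlg.traceNorm_le (traceRep_inner η ξ)))
  -- The bound by the trace norm lets `g` be evaluated term by term: the error after `n` terms is at
  -- most the tail of `∑ ‖ηᵢ‖ ‖ξᵢ‖`.
  have key : ∀ (h : X) (η ξ : ℕ → H), (Summable fun n => ‖η n‖ * ‖ξ n‖) →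
      (∀ a : M, HasSum (fun n => ⟪η n, (a : H →L[ℂ] H) (ξ n)⟫_ℂ) ((h : M →ₗ[ℂ] ℂ) a)) →
      HasSum (fun n => ⟪η n, T (ξ n)⟫_ℂ) (g h) := fun h η ξ hs ha => by
    have hs1 := (summable_inner_clm hs T).hasSum
    have h1 := hs1.tendsto_sum_nat
    have h2 : Filter.Tendsto (fun n => ∑ i ∈ Finset.range n, ⟪η i, T (ξ i)⟫_ℂ) Filter.atTop
        (𝓝 (g h)) := by
      rw [tendsto_iff_norm_sub_tendsto_zero]
      refine squeeze_zero (fun _ => norm_nonneg _) (fun n => ?_)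
        (tendsto_sum_nat_add fun i => ‖η i‖ * ‖ξ i‖)
      simp only [hT, ← map_sum, ← map_sub]
      rw [← norm_neg, ← map_neg]
      refine (hg _).trans (DualOpAlg.traceNorm_le ⟨fun i => η (i + n), fun i => ξ (i + n),
        (summable_nat_add_iff n).2 hs, le_rfl, fun a => ?_⟩)
      have h3 := (hasSum_nat_add_iff' n).2 (ha a)
      convert! h3 using 1
      simp [hω]
    exact tendsto_nhds_unique h1 h2 ▸ hs1
  -- A trace class functional vanishing on `M` represents the zero element of `X`, where `g` is
  -- zero.
  have hTM : T ∈ M := hM.mem_of_forall T fun η ξ hs ha => by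
    have := key 0 η ξ hs fun a => by
      have h1 := (summable_inner_clm hs (a : H →L[ℂ] H)).hasSum
      rw [ha a] at h1
      simpa using h1
    rw [this.tsum_eq, map_zero]
  obtain ⟨r', η, ξ, hs, -, h2⟩ := hf.exists_traceRep
  have h3 : g f₀ = f ⟨T, hTM⟩ := (key f₀ η ξ hs h2).unique (h2 ⟨T, hTM⟩)
  calc traceNorm ρ f = (g f₀).re := hg₀.symm
    _ ≤ ‖g f₀‖ := Complex.re_le_norm _
    _ ≤ r * ‖T‖ := h3 ▸ hr _
    _ ≤ r := mul_le_of_le_one_right hr₀ hT1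

/-- A norm limit of weak-star continuous functionals on a dual operator algebra is weak-star
continuous. -/
theorem IsDualOperatorAlgebra.wstarContinuousForm_of_approx [CompleteSpace H]
    (hM : IsDualOperatorAlgebra M) (F : M →ₗ[ℂ] ℂ)
    (hF : ∀ ε : ℝ, 0 < ε → ∃ f : M →ₗ[ℂ] ℂ, WStarContinuousForm f ∧
      ∀ a, ‖F a - f a‖ ≤ ε * ‖a‖) : WStarContinuousForm F := by
  -- A geometric rate makes the differences `f (k + 1) - f k` summable in trace norm, so the limit
  -- is again of trace class type.
  choose f hf1 hf2 using fun k : ℕ => hF ((1 / 2) ^ k) (by positivity)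
  have hd : ∀ k, TraceRep M.val.toLinearMap (fun a => f (k + 1) a - f k a) (4 * (1 / 2) ^ k) := by
    intro k
    have h1 : WStarContinuousForm (⇑(f (k + 1) - f k)) := (hf1 (k + 1)).sub (hf1 k)
    have h2 := hM.traceNorm_le h1 (r := 2 * (1 / 2) ^ k) (by positivity) fun a => by
      have h3 := hf2 (k + 1) a
      have h4 := hf2 k a
      rw [LinearMap.sub_apply, ← sub_sub_sub_cancel_left _ _ (F a)]
      refine (norm_sub_le _ _).trans ?_
      have h5 : (1 / 2 : ℝ) ^ (k + 1) * ‖a‖ ≤ (1 / 2) ^ k * ‖a‖ := by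
        gcongr ?_ * _
        exact pow_le_pow_of_le_one (by norm_num) (by norm_num) (Nat.le_succ k)
      linarith
    -- The trace norm is an infimum that need not be attained; doubling the bound `2 * (1 / 2) ^ k`
    -- supplies a representation.
    refine traceRep_of_traceNorm_lt h1.exists_traceRep (lt_of_le_of_lt h2 ?_)
    have : (0 : ℝ) < (1 / 2) ^ k := by positivity
    linarith
  have hs : Summable fun k : ℕ => 4 * (1 / 2 : ℝ) ^ k := summable_geometric_two.mul_left 4
  have h1 := TraceRep.tsum (F := fun a => F a - f 0 a) hd hs fun a => by
    have h2 : Filter.Tendsto (fun k => f k a) Filter.atTop (𝓝 (F a)) := by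
      rw [tendsto_iff_norm_sub_tendsto_zero]
      refine squeeze_zero (fun _ => norm_nonneg _)
        (fun k => (norm_sub_rev _ _).trans_le (hf2 k a)) ?_
      simpa using (tendsto_pow_atTop_nhds_zero_of_lt_one (r := (1 / 2 : ℝ)) (by norm_num)
        (by norm_num)).mul_const ‖a‖
    have hsum : Summable fun k => f (k + 1) a - f k a := by
      refine Summable.of_norm_bounded (g := fun k => 2 * (1 / 2 : ℝ) ^ k * ‖a‖)
        ((summable_geometric_two.mul_left 2).mul_right _) fun k => ?_
      have h3 := hf2 (k + 1) a
      have h4 := hf2 k a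
      rw [← sub_sub_sub_cancel_left _ _ (F a)]
      refine (norm_sub_le _ _).trans ?_
      have h5 : (1 / 2 : ℝ) ^ (k + 1) * ‖a‖ ≤ (1 / 2) ^ k * ‖a‖ := by
        gcongr ?_ * _
        exact pow_le_pow_of_le_one (by norm_num) (by norm_num) (Nat.le_succ k)
      linarith
    have h3 := hsum.hasSum.tendsto_sum_nat
    simp only [Finset.sum_range_sub (fun k => f k a)] at h3
    rw [← tendsto_nhds_unique h3 (h2.sub_const _)]
    exact hsum.hasSum
  obtain ⟨r, hr⟩ := (hf1 0).exists_traceRep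
  have := (h1.add hr).wstarContinuousForm
  simpa using this

end Predual

theorem scalarMatNorm_le {n : ℕ} {X : Matrix (Fin n) (Fin n) ℂ} {c : ℝ} (hc : 0 ≤ c)
    (h : ∀ w v : Fin n → ℂ, ‖∑ k, ∑ l, starRingEnd ℂ (w k) * (X k l * v l)‖ ≤
      c * (√(∑ k, ‖w k‖ ^ 2) * √(∑ l, ‖v l‖ ^ 2))) : scalarMatNorm X ≤ c := by
  have h1 : OpBound (fun i j => X i j • ContinuousLinearMap.id ℂ ℂ) c :=
    opBound_of_inner fun w v => by
      simpa [mul_comm] using h w v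
  refine ContinuousLinearMap.opNorm_le_bound _ hc fun v => ?_
  rw [← pow_le_pow_iff_left₀ (norm_nonneg _) (by positivity) two_ne_zero, mul_pow,
    EuclideanSpace.norm_sq_eq, EuclideanSpace.norm_sq_eq]
  simpa [Matrix.mulVec, dotProduct] using h1 v

/-! ### Averages of operator valued bilinear maps against an element of the normal Haagerup tensor
product. -/

section Average

variable {H : Type*} [NormedAddCommGroup H] [InnerProductSpace ℂ H]
variable {K : Type*} [NormedAddCommGroup K] [InnerProductSpace ℂ K]
variable {M : Subalgebra ℂ (H →L[ℂ] H)} {N : Subalgebra ℂ (K →L[ℂ] K)}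

/-- Joint complete boundedness of a matrix of operator valued maps of two variables. -/
def CBMat {ι κ : Type} [Fintype ι] [Fintype κ] (B : ι → κ → M → M → K →L[ℂ] K) (A : ℝ) : Prop :=
  ∀ (ν : Type) [Fintype ν] (x y : ν → ν → M) (C D : ℝ), 0 ≤ C → 0 ≤ D →
    OpBound (fun i j => (x i j : H →L[ℂ] H)) C → OpBound (fun i j => (y i j : H →L[ℂ] H)) D →
      OpBound (fun (p : ν × ι) (q : ν × κ) => ∑ k, B p.2 q.2 (x p.1 k) (y k q.1)) (A * (C * D))

theorem CBBound₂.cbMat {B : M → M → K →L[ℂ] K} {A : ℝ} (h : CBBound₂ B A) :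
    CBMat (fun _ _ : Unit => B) A := fun ν _ x y C D hC hD hx hy =>
  (h ν x y C D hC hD hx hy).reindex (Equiv.prodPUnit ν) (Equiv.prodPUnit ν)

/-- Pairing the amplified form with scalar vectors `w`, `v` is pairing the amplified matrix of maps
with `w ⊗ η` and `v ⊗ ξ`, whose norms are products. Thus a joint matrix bound on `B` controls the
cb-norm of one scalar form. -/
theorem scalarMatNorm_bilAmp_le {ι κ : Type} [Fintype ι] [Fintype κ]
    {B : ι → κ → M → M → K →L[ℂ] K} {A : ℝ} (hA : 0 ≤ A) (h : CBMat B A)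
    (ψ : M →ₗ[ℂ] M →ₗ[ℂ] ℂ) (η : ι → K) (ξ : κ → K)
    (hψ : ∀ a b, ψ a b = ∑ i, ∑ j, ⟪η i, B i j a b (ξ j)⟫_ℂ) (n : ℕ)
    (x y : Matrix (Fin n) (Fin n) M) :
    scalarMatNorm (bilAmp ψ x y) ≤
      (A * (√(∑ i, ‖η i‖ ^ 2) * √(∑ j, ‖ξ j‖ ^ 2))) * (matNorm x * matNorm y) := by
  have hx := (matNorm_le_iff (matNorm_nonneg x)).1 le_rfl
  have hy := (matNorm_le_iff (matNorm_nonneg y)).1 le_rfl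
  have h1 := h (Fin n) x y _ _ (matNorm_nonneg x) (matNorm_nonneg y) hx hy
  have h0 : 0 ≤ matNorm x * matNorm y := mul_nonneg (matNorm_nonneg x) (matNorm_nonneg y)
  refine scalarMatNorm_le (by positivity) fun w v => ?_
  have h2 := h1.norm_sum_inner_le (by positivity) (fun p => w p.1 • η p.2) (fun q => v q.1 • ξ q.2)
  have hn : ∀ {ι : Type} [Fintype ι] (w : Fin n → ℂ) (η : ι → K),
      √(∑ p : Fin n × ι, ‖w p.1 • η p.2‖ ^ 2) = √(∑ k, ‖w k‖ ^ 2) * √(∑ i, ‖η i‖ ^ 2) := by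
    intro ι _ w η
    rw [← Real.sqrt_mul (by positivity), Fintype.sum_prod_type, Finset.sum_mul_sum]
    simp only [norm_smul, mul_pow]
  rw [hn, hn] at h2
  refine le_trans (le_of_eq ?_) (h2.trans (le_of_eq (by ring)))
  congr 1
  have hψ' : ∀ k l, bilAmp ψ x y k l = ∑ i, ∑ j, ⟪η i, (∑ m, B i j (x k m) (y m l)) (ξ j)⟫_ℂ :=
    fun k l => by
      simp only [bilAmp, Matrix.of_apply, hψ, sum_apply, inner_sum]
      rw [Finset.sum_comm]
      exact Finset.sum_congr rfl fun i _ => Finset.sum_comm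
  simp only [hψ', Fintype.sum_prod_type, Finset.mul_sum, Finset.sum_mul, map_smul,
    inner_smul_left, inner_smul_right]
  refine Finset.sum_congr rfl fun k _ => ?_
  rw [Finset.sum_comm]
  refine Finset.sum_congr rfl fun i _ => Finset.sum_congr rfl fun l _ =>
    Finset.sum_congr rfl fun j _ => ?_
  ring

/-- Pointwise convergence suffices: for fixed `x` and `y` the amplifications live in a finite
dimensional space of matrices, so the series converges there in norm. -/
theorem scalarMatNorm_bilAmp_le_of_hasSum {ψ : M →ₗ[ℂ] M →ₗ[ℂ] ℂ} {φ : ℕ → M →ₗ[ℂ] M →ₗ[ℂ] ℂ}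
    (h : ∀ a b, HasSum (fun i => φ i a b) (ψ a b)) {c : ℕ → ℝ} (hc : Summable c) {n : ℕ}
    {x y : Matrix (Fin n) (Fin n) M} {r : ℝ}
    (hφ : ∀ i, scalarMatNorm (bilAmp (φ i) x y) ≤ c i * r) :
    scalarMatNorm (bilAmp ψ x y) ≤ (∑' i, c i) * r := by
  let T : Matrix (Fin n) (Fin n) ℂ →ₗ[ℂ] (EuclideanSpace ℂ (Fin n) →L[ℂ] EuclideanSpace ℂ (Fin n)) :=
    { toFun := Matrix.toEuclideanCLM (n := Fin n) (𝕜 := ℂ)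
      map_add' := map_add _
      map_smul' := map_smul _ }
  have hT : Continuous T := T.continuous_of_finiteDimensional
  have h1 : HasSum (fun i => bilAmp (φ i) x y) (bilAmp ψ x y) :=
    Pi.hasSum.2 fun k => Pi.hasSum.2 fun l => by
      simp only [bilAmp, Matrix.of_apply]
      exact hasSum_sum fun j _ => h _ _
  have h2 : HasSum (fun i => T (bilAmp (φ i) x y)) (T (bilAmp ψ x y)) := h1.map T hT
  change ‖T (bilAmp ψ x y)‖ ≤ _
  rw [← h2.tsum_eq]
  exact tsum_of_norm_bounded (hc.hasSum.mul_right r) hφ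

/-- `W` is the average `u[E]`, that is `⟪η, W ξ⟫ = ⟨u, ⟪η, E(·,·) ξ⟫⟩` for all `η`, `ξ`. -/
def IsAvg (u : NormalHaagerup M) (E : M → M → K →L[ℂ] K) (W : K →L[ℂ] K) : Prop :=
  ∀ η ξ : K, ∃ ψ : NormalForms M,
    (∀ a b, (ψ : M →ₗ[ℂ] M →ₗ[ℂ] ℂ) a b = ⟪η, E a b ξ⟫_ℂ) ∧ ⟪η, W ξ⟫_ℂ = u ψ

variable {u : NormalHaagerup M}

theorem NormalForms.ext {ψ ψ' : NormalForms M} (h : ∀ a b, (ψ : M →ₗ[ℂ] M →ₗ[ℂ] ℂ) a b =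
    (ψ' : M →ₗ[ℂ] M →ₗ[ℂ] ℂ) a b) : ψ = ψ' :=
  Subtype.ext (LinearMap.ext₂ h)

theorem IsAvg.unique {E : M → M → K →L[ℂ] K} {W W' : K →L[ℂ] K} (h : IsAvg u E W)
    (h' : IsAvg u E W') : W = W' := by
  ext ξ
  refine ext_inner_left ℂ fun η => ?_
  obtain ⟨ψ, h1, h2⟩ := h η ξ
  obtain ⟨ψ', h1', h2'⟩ := h' η ξ
  rw [h2, h2', NormalForms.ext fun a b => (h1 a b).trans (h1' a b).symm]

theorem IsAvg.apply {E : M → M → K →L[ℂ] K} {W : K →L[ℂ] K} (h : IsAvg u E W)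
    {η ξ : K} {ψ : NormalForms M}
    (hψ : ∀ a b, (ψ : M →ₗ[ℂ] M →ₗ[ℂ] ℂ) a b = ⟪η, E a b ξ⟫_ℂ) : ⟪η, W ξ⟫_ℂ = u ψ := by
  obtain ⟨ψ', h1, h2⟩ := h η ξ
  rw [h2, NormalForms.ext fun a b => (h1 a b).trans (hψ a b).symm]

theorem IsAvg.add {E E' : M → M → K →L[ℂ] K} {W W' : K →L[ℂ] K} (h : IsAvg u E W)
    (h' : IsAvg u E' W') : IsAvg u (fun a b => E a b + E' a b) (W + W') := fun η ξ => by
  obtain ⟨ψ, h1, h2⟩ := h η ξ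
  obtain ⟨ψ', h1', h2'⟩ := h' η ξ
  refine ⟨ψ + ψ', fun a b => ?_, ?_⟩
  · simp [← h1, ← h1']
  · simp [h2, h2']

theorem IsAvg.smul {E : M → M → K →L[ℂ] K} {W : K →L[ℂ] K} (h : IsAvg u E W) (c : ℂ) :
    IsAvg u (fun a b => c • E a b) (c • W) := fun η ξ => by
  obtain ⟨ψ, h1, h2⟩ := h η ξ
  refine ⟨c • ψ, fun a b => ?_, ?_⟩
  · simp [← h1]
  · simp [h2]

theorem IsAvg.sub {E E' : M → M → K →L[ℂ] K} {W W' : K →L[ℂ] K} (h : IsAvg u E W)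
    (h' : IsAvg u E' W') : IsAvg u (fun a b => E a b - E' a b) (W - W') := by
  simpa [sub_eq_add_neg] using h.add (h'.smul (-1))

theorem IsAvg.sum {ι : Type*} (s : Finset ι) {E : ι → M → M → K →L[ℂ] K} {W : ι → K →L[ℂ] K}
    (h : ∀ i, IsAvg u (E i) (W i)) : IsAvg u (fun a b => ∑ i ∈ s, E i a b) (∑ i ∈ s, W i) := by
  classical
  induction s using Finset.induction_on with
  | empty => exact fun η ξ => ⟨0, by simp, by simp⟩
  | insert i s hi ih => simpa [Finset.sum_insert hi] using (h i).add ih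

theorem IsAvg.mul_right {E : M → M → K →L[ℂ] K} {W : K →L[ℂ] K} (h : IsAvg u E W)
    (T : K →L[ℂ] K) : IsAvg u (fun a b => E a b * T) (W * T) := fun η ξ => h η (T ξ)

theorem IsAvg.mul_left [CompleteSpace K] {E : M → M → K →L[ℂ] K} {W : K →L[ℂ] K}
    (h : IsAvg u E W) (T : K →L[ℂ] K) : IsAvg u (fun a b => T * E a b) (T * W) := fun η ξ => by
  simpa [ContinuousLinearMap.adjoint_inner_left] using h (ContinuousLinearMap.adjoint T η) ξ

theorem IsAvg.congr {E E' : M → M → K →L[ℂ] K} {W W' : K →L[ℂ] K} (h : IsAvg u E W)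
    (hE : ∀ a b, E a b = E' a b) (hW : W = W') : IsAvg u E' W' := by
  have : E = E' := funext₂ hE
  rwa [← this, ← hW]

/-- The relation `x · u = u · x`, tested on the form `⟪η, E(·,·) ξ⟫`. The average `W₀` is needed
only to know that this form is normal. -/
theorem IsAvg.comm [CompleteSpace H] (hu : IsNormalVirtualHDiagonal u) {E : M → M → K →L[ℂ] K}
    {W W₀ : K →L[ℂ] K} (h₀ : IsAvg u E W₀) {x : M} (h : IsAvg u (fun a b => E (x * a) b) W) :
    IsAvg u (fun a b => E a (b * x)) W := fun η ξ => by
  obtain ⟨ψ, h1, -⟩ := h₀ η ξ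
  refine ⟨actForm 1 x ψ, fun a b => by simp [actForm_apply, h1], ?_⟩
  rw [h.apply (ψ := actForm x 1 ψ) fun a b => by simp [actForm_apply, h1]]
  exact congrArg (fun v : NormalHaagerup M => v ψ) (hu.commutes x)

/-- The condition `m_σh(u) = 1`, tested on the normal functional `⟪η, α(·) ξ⟫`. -/
theorem isAvg_mul [CompleteSpace H] (hu : IsNormalVirtualHDiagonal u) (α : M →ₗ[ℂ] K →L[ℂ] K)
    (hα : ∀ η ξ : K, WStarContinuousForm fun a => ⟪η, α a ξ⟫_ℂ) :
    IsAvg u (fun a b => α (a * b)) (α 1) := fun η ξ => by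
  let φ : M →ₗ[ℂ] ℂ := ((innerSL ℂ η).toLinearMap ∘ₗ
    (ContinuousLinearMap.apply ℂ K ξ).toLinearMap) ∘ₗ α
  exact ⟨mulForm φ (hα η ξ), fun a b => rfl, (hu.mul_eq_one φ (hα η ξ)).symm⟩

/-- All entries are averaged at once: the pairing of `W` with vectors `η`, `ξ` is `u` applied to the
single form `∑ ⟪ηᵢ, E i j ξⱼ⟫`. This yields cb-estimates for averages, not only norm estimates. -/
theorem IsAvg.opBound {ι κ : Type} [Fintype ι] [Fintype κ] {E : ι → κ → M → M → K →L[ℂ] K}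
    {W : ι → κ → K →L[ℂ] K} (h : ∀ i j, IsAvg u (E i j) (W i j)) {A : ℝ} (hA : 0 ≤ A)
    (hE : CBMat E A) : OpBound W (‖u‖ * A) := by
  refine opBound_of_inner fun η ξ => ?_
  choose ψ h1 h2 using fun i j => h i j (η i) (ξ j)
  simp only [h2, ← map_sum]
  refine (u.le_opNorm _).trans ?_
  rw [mul_assoc]
  refine mul_le_mul_of_nonneg_left ?_ (norm_nonneg u)
  refine toReal_cbNormForm_le (by positivity) (scalarMatNorm_bilAmp_le hA hE _ η ξ fun a b => ?_)
  simp [h1]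

theorem IsAvg.norm_le {E : M → M → K →L[ℂ] K} {W : K →L[ℂ] K} (h : IsAvg u E W) {A : ℝ}
    (hA : 0 ≤ A) (hE : CBBound₂ E A) : ‖W‖ ≤ ‖u‖ * A :=
  (opBound_unit (by positivity)).1 (IsAvg.opBound (fun _ _ => h) hA hE.cbMat)

/-- A completely bounded bilinear map into `B(K)` that is separately weak-star continuous. -/
structure IsNormalBilinear (B : M →ₗ[ℂ] M →ₗ[ℂ] K →L[ℂ] K) (A : ℝ) : Prop where
  nonneg : 0 ≤ A
  left : ∀ b η ξ, WStarContinuousForm fun a => ⟪η, B a b ξ⟫_ℂ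
  right : ∀ a η ξ, WStarContinuousForm fun b => ⟪η, B a b ξ⟫_ℂ
  bound : CBBound₂ (fun a b => B a b) A

/-- The bilinear form `⟪η, B(·,·) ξ⟫`. -/
def vecBilin (B : M →ₗ[ℂ] M →ₗ[ℂ] K →L[ℂ] K) (η ξ : K) : M →ₗ[ℂ] M →ₗ[ℂ] ℂ :=
  B.compr₂ ((innerSL ℂ η).toLinearMap ∘ₗ (ContinuousLinearMap.apply ℂ K ξ).toLinearMap)

variable {B : M →ₗ[ℂ] M →ₗ[ℂ] K →L[ℂ] K} {A : ℝ}

theorem vecBilin_apply (η ξ : K) (a b : M) : vecBilin B η ξ a b = ⟪η, B a b ξ⟫_ℂ := rfl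

theorem IsNormalBilinear.scalarMatNorm_le (hB : IsNormalBilinear B A) (η ξ : K) (n : ℕ)
    (x y : Matrix (Fin n) (Fin n) M) : scalarMatNorm (bilAmp (vecBilin B η ξ) x y) ≤
      (A * (‖η‖ * ‖ξ‖)) * (matNorm x * matNorm y) := by
  simpa [Real.sqrt_sq] using scalarMatNorm_bilAmp_le hB.nonneg hB.bound.cbMat (vecBilin B η ξ)
    (fun _ => η) (fun _ => ξ) (by simp [vecBilin_apply]) n x y

/-- The bilinear form `⟪η, B(·,·) ξ⟫` as an element of the predual of `M ⊗_σh M`. -/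
def IsNormalBilinear.form (hB : IsNormalBilinear B A) (η ξ : K) : NormalForms M :=
  ⟨vecBilin B η ξ, fun b => hB.left b η ξ, fun a => hB.right a η ξ,
    ne_top_of_le_ne_top ENNReal.ofReal_ne_top (cbNormForm_le
      (by have := hB.nonneg; positivity) (hB.scalarMatNorm_le η ξ))⟩

theorem IsNormalBilinear.form_apply (hB : IsNormalBilinear B A) (η ξ : K) (a b : M) :
    (hB.form η ξ : M →ₗ[ℂ] M →ₗ[ℂ] ℂ) a b = ⟪η, B a b ξ⟫_ℂ := rfl

theorem IsNormalBilinear.norm_form_le (hB : IsNormalBilinear B A) (η ξ : K) :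
    ‖hB.form η ξ‖ ≤ A * (‖η‖ * ‖ξ‖) :=
  toReal_cbNormForm_le (by have := hB.nonneg; positivity) (hB.scalarMatNorm_le η ξ)

theorem IsNormalBilinear.exists_isAvg [CompleteSpace K] (hB : IsNormalBilinear B A) :
    ∃ W, IsAvg u (fun a b => B a b) W := by
  obtain ⟨W, -, hW⟩ := exists_clm_of_sesquilinear (fun η ξ => u (hB.form η ξ))
    (fun η η' ξ => by
      rw [← map_add]; congr 1; refine NormalForms.ext fun a b => ?_
      simp [form_apply])
    (fun c η ξ => by
      rw [← smul_eq_mul, ← map_smul]; congr 1; refine NormalForms.ext fun a b => ?_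
      simp [form_apply, mul_comm])
    (fun η ξ ξ' => by
      rw [← map_add]; congr 1; refine NormalForms.ext fun a b => ?_
      simp [form_apply])
    (fun c η ξ => by
      rw [← smul_eq_mul, ← map_smul]; congr 1; refine NormalForms.ext fun a b => ?_
      simp [form_apply])
    (C := ‖u‖ * A) (mul_nonneg (norm_nonneg u) hB.nonneg) (fun η ξ => by
      rw [mul_assoc]
      exact (u.le_opNorm _).trans
        (mul_le_mul_of_nonneg_left (hB.norm_form_le η ξ) (norm_nonneg u)))
  exact ⟨W, fun η ξ => ⟨hB.form η ξ, fun a b => rfl, hW η ξ⟩⟩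

/-- Since the whole series vanishes, a partial sum is minus its tail, and the tail is estimated term
by term. -/
theorem IsNormalBilinear.norm_sum_form_le (hB : IsNormalBilinear B A) {η ξ : ℕ → K}
    (hs : Summable fun n => ‖η n‖ * ‖ξ n‖)
    (h0 : ∀ a b, ∑' n, ⟪η n, B a b (ξ n)⟫_ℂ = 0) (m : ℕ) :
    ‖∑ i ∈ Finset.range m, hB.form (η i) (ξ i)‖ ≤ A * ∑' i, ‖η (i + m)‖ * ‖ξ (i + m)‖ := by
  have hs' := (summable_nat_add_iff m).2 hs
  have hA := hB.nonneg
  have ht : 0 ≤ ∑' i, ‖η (i + m)‖ * ‖ξ (i + m)‖ := tsum_nonneg fun i => by positivity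
  have hS1 : ∀ a b, HasSum (fun i => vecBilin B (-η (i + m)) (ξ (i + m)) a b)
      (((∑ i ∈ Finset.range m, hB.form (η i) (ξ i) : NormalForms M) : M →ₗ[ℂ] M →ₗ[ℂ] ℂ) a b) := fun a b => by
    have h1 := (summable_inner_clm hs (B a b)).hasSum
    rw [h0 a b] at h1
    have h2 := ((hasSum_nat_add_iff' m).2 h1).neg
    convert! h2 using 1
    · simp only [vecBilin_apply, inner_neg_left]
    · simp [form_apply]
  refine toReal_cbNormForm_le (by positivity) fun n x y => ?_
  rw [← tsum_mul_left]
  refine scalarMatNorm_bilAmp_le_of_hasSum hS1 (hs'.mul_left A) fun i => ?_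
  simpa using hB.scalarMatNorm_le (-η (i + m)) (ξ (i + m)) n x y

/-- By closedness of `N` it is enough to test `W` against trace functionals vanishing on `N`. The
partial sums of the corresponding series of forms tend to zero in cb-norm, and `u` is norm
continuous. -/
theorem IsNormalBilinear.mem_of_isAvg [CompleteSpace K] (hN : IsDualOperatorAlgebra N)
    (hB : IsNormalBilinear B A) (hBN : ∀ a b, B a b ∈ N) {W : K →L[ℂ] K}
    (hW : IsAvg u (fun a b => B a b) W) : W ∈ N := by
  refine hN.mem_of_forall W fun η ξ hs h0 => ?_
  have h1 := (summable_inner_clm hs W).hasSum.tendsto_sum_nat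
  refine tendsto_nhds_unique h1 ?_
  rw [tendsto_zero_iff_norm_tendsto_zero]
  refine squeeze_zero (g := fun m => ‖u‖ * (A * ∑' i, ‖η (i + m)‖ * ‖ξ (i + m)‖))
    (fun _ => norm_nonneg _) (fun m => ?_) ?_
  · have : ∀ i, ⟪η i, W (ξ i)⟫_ℂ = u (hB.form (η i) (ξ i)) := fun i => hW.apply fun _ _ => rfl
    simp only [this, ← map_sum]
    exact (u.le_opNorm _).trans (mul_le_mul_of_nonneg_left
      (hB.norm_sum_form_le hs (fun a b => h0 ⟨B a b, hBN a b⟩) m) (norm_nonneg u))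
  · simpa using ((tendsto_sum_nat_add fun i => ‖η i‖ * ‖ξ i‖).const_mul A).const_mul ‖u‖

end Average

-- Hilbert space completion and approximation of functionals.

universe w in
theorem exists_hilbert_completion {V : Type w} [AddCommGroup V] [Module ℂ V]
    (c : PreInnerProductSpace.Core ℂ V) :
    ∃ (G : Type w) (_ : NormedAddCommGroup G) (_ : InnerProductSpace ℂ G) (_ : CompleteSpace G)
      (e : V →ₗ[ℂ] G), DenseRange e ∧ ∀ x, ‖e x‖ ^ 2 = (c.inner x x).re := by
  let _ : SeminormedAddCommGroup V := InnerProductSpace.Core.toSeminormedAddCommGroup (c := c)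
  let _ : InnerProductSpace ℂ V := InnerProductSpace.ofCore c
  refine ⟨UniformSpace.Completion V, inferInstance, inferInstance, inferInstance,
    (UniformSpace.Completion.toComplL (𝕜 := ℂ) (E := V)).toLinearMap,
    UniformSpace.Completion.denseRange_coe, fun x => ?_⟩
  change ‖(x : UniformSpace.Completion V)‖ ^ 2 = _
  rw [UniformSpace.Completion.norm_coe]
  exact norm_sq_eq_re_inner (𝕜 := ℂ) x

/-- A functional on a Hilbert space that is controlled by a family of operators is a norm limit of
combinations of the coefficients of the family. -/
theorem exists_approx_of_tendsto {V G K ι : Type*} [AddCommGroup V] [Module ℂ V]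
    [NormedAddCommGroup G] [InnerProductSpace ℂ G] [CompleteSpace G]
    [NormedAddCommGroup K] [InnerProductSpace ℂ K] [CompleteSpace K]
    (e : V →ₗ[ℂ] G) (he : DenseRange e) (h : ι → V →ₗ[ℂ] K)
    (hh : ∀ i, ∃ C, ∀ x, ‖h i x‖ ≤ C * ‖e x‖) (F : V →ₗ[ℂ] ℂ) (hF : ∃ C, ∀ x, ‖F x‖ ≤ C * ‖e x‖)
    (hFh : ∀ x : ℕ → V, CauchySeq (fun n => e (x n)) →
      (∀ i, Filter.Tendsto (fun n => h i (x n)) Filter.atTop (𝓝 0)) →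
      Filter.Tendsto (fun n => F (x n)) Filter.atTop (𝓝 0))
    (Q : Submodule ℂ (V →ₗ[ℂ] ℂ)) (hQ : ∀ i k, (innerSL ℂ k).toLinearMap ∘ₗ h i ∈ Q)
    {ε : ℝ} (hε : 0 < ε) : ∃ f ∈ Q, ∀ x, ‖F x - f x‖ ≤ ε * ‖e x‖ := by
  let F' : G →L[ℂ] ℂ := F.extendOfNorm e
  let h' : ι → G →L[ℂ] K := fun i => (h i).extendOfNorm e
  have hF' : ∀ x, F' (e x) = F x := F.extendOfNorm_eq he hF
  have hh' : ∀ i x, h' i (e x) = h i x := fun i => (h i).extendOfNorm_eq he (hh i)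
  let y := (InnerProductSpace.toDual ℂ G).symm F'
  have hy : ∀ z, ⟪y, z⟫_ℂ = F' z := fun z => InnerProductSpace.toDual_symm_apply
  let P : Submodule ℂ G :=
    Submodule.span ℂ (Set.range fun p : ι × K => ContinuousLinearMap.adjoint (h' p.1) p.2)
  -- Orthogonality of `z` to `P` means that every `h' i` vanishes at `z`. Approximating `z` by
  -- vectors `e (x n)` brings it within reach of `hFh`, which gives `F' z = 0`.
  have hyP : y ∈ Pᗮᗮ := by
    refine (Submodule.mem_orthogonal' _ _).2 fun z hz => ?_
    have hz0 : ∀ i, h' i z = 0 := fun i => by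
      have h1 := (Submodule.mem_orthogonal _ _).1 hz _
        (Submodule.subset_span ⟨(i, h' i z), rfl⟩)
      rw [ContinuousLinearMap.adjoint_inner_left] at h1
      exact inner_self_eq_zero.1 h1
    obtain ⟨s, hs1, hs2⟩ := mem_closure_iff_seq_limit.1 (he z)
    choose x hx using hs1
    have hx' : Filter.Tendsto (fun n => e (x n)) Filter.atTop (𝓝 z) := by simpa only [hx] using hs2
    have h1 := hFh x hx'.cauchySeq fun i => by
      simpa only [← hh', ← hz0 i, Function.comp_def] using ((h' i).continuous.tendsto z).comp hx'
    have h2 : Filter.Tendsto (fun n => F (x n)) Filter.atTop (𝓝 (F' z)) := by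
      simpa only [← hF', Function.comp_def] using (F'.continuous.tendsto z).comp hx'
    rw [hy, tendsto_nhds_unique h2 h1]
  rw [Submodule.orthogonal_orthogonal_eq_closure] at hyP
  obtain ⟨p, hp, hyp⟩ := Metric.mem_closure_iff.1 hyP ε hε
  have hpQ : ∀ p ∈ P, (innerSL ℂ p).toLinearMap ∘ₗ e ∈ Q := fun p hp => by
    induction hp using Submodule.span_induction with
    | mem q hq =>
      obtain ⟨⟨i, k⟩, rfl⟩ := hq
      convert! hQ i k using 1
      ext x
      simp [ContinuousLinearMap.adjoint_inner_left, hh']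
    | zero => simp
    | add p q _ _ h1 h2 =>
      convert! Q.add_mem h1 h2 using 1
      ext x
      simp
    | smul c p _ h1 =>
      convert! Q.smul_mem (starRingEnd ℂ c) h1 using 1
      ext x
      simp [mul_comm]
  refine ⟨_, hpQ p hp, fun x => ?_⟩
  have : F x - ⟪p, e x⟫_ℂ = ⟪y - p, e x⟫_ℂ := by rw [inner_sub_left, hy, hF']
  change ‖F x - ⟪p, e x⟫_ℂ‖ ≤ _
  rw [this]
  refine (norm_inner_le_norm _ _).trans ?_
  gcongr
  rw [← dist_eq_norm]
  exact hyp.le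

/-! ### Domination of a column bounded map by a positive functional. -/

section Domination

variable {H : Type*} [NormedAddCommGroup H] [InnerProductSpace ℂ H] [CompleteSpace H]
variable {K : Type*} [NormedAddCommGroup K] [InnerProductSpace ℂ K]
variable {M : Subalgebra ℂ (H →L[ℂ] H)}

/-- A map into a Hilbert space that is bounded on columns is dominated by a positive functional. -/
theorem exists_positive_functional (g : M →ₗ[ℂ] K) {c : ℝ}
    (hg : ∀ (l : List M) (t : ℝ), 0 ≤ t →
      (∀ v : H, (l.map fun b : M => ‖(b : H →L[ℂ] H) v‖ ^ 2).sum ≤ t * ‖v‖ ^ 2) →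
      (l.map fun b : M => ‖g b‖ ^ 2).sum ≤ c * t) :
    ∃ ω : (H →L[ℂ] H) →ₗ[ℝ] ℝ,
      (∀ (T : H →L[ℂ] H) (t : ℝ), 0 ≤ t → (∀ v, (⟪v, T v⟫_ℂ).re ≤ t * ‖v‖ ^ 2) → ω T ≤ c * t) ∧
      ∀ b : M, ‖g b‖ ^ 2 ≤
        ω (ContinuousLinearMap.adjoint (b : H →L[ℂ] H) * (b : H →L[ℂ] H)) := by
  -- The infimum of `S T` is the sublinear functional `N(T) = inf {c t - ∑ ‖g b‖² : Re T + ∑ b* b ≤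
  -- t}`. Any linear functional below it has both required properties; the column hypothesis keeps
  -- the infimum finite.
  let S : (H →L[ℂ] H) → Set ℝ := fun T => {s | ∃ (l : List M) (t : ℝ), 0 ≤ t ∧
    (∀ v : H, (⟪v, T v⟫_ℂ).re + (l.map fun b : M => ‖(b : H →L[ℂ] H) v‖ ^ 2).sum ≤ t * ‖v‖ ^ 2) ∧
    s = c * t - (l.map fun b : M => ‖g b‖ ^ 2).sum}
  have re_le : ∀ (T : H →L[ℂ] H) v, |(⟪v, T v⟫_ℂ).re| ≤ ‖T‖ * ‖v‖ ^ 2 := fun T v => by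
    refine (Complex.abs_re_le_norm _).trans ((norm_inner_le_norm _ _).trans ?_)
    have := mul_le_mul_of_nonneg_left (T.le_opNorm v) (norm_nonneg v)
    linarith
  have hne : ∀ T, (S T).Nonempty := fun T => ⟨_, [], ‖T‖, norm_nonneg _, fun v => by
    simpa using (le_abs_self _).trans (re_le T v), rfl⟩
  have hlow : ∀ T, ∀ s ∈ S T, -(c * ‖T‖) ≤ s := by
    rintro T s ⟨l, t, ht, hv, rfl⟩
    have := hg l (t + ‖T‖) (by positivity) fun v => by
      have h1 := hv v
      have h2 := (abs_le.1 (re_le T v)).1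
      linarith
    linarith
  have hbdd : ∀ T, BddBelow (S T) := fun T => ⟨_, hlow T⟩
  let N : (H →L[ℂ] H) → ℝ := fun T => sInf (S T)
  have N_le : ∀ {T s}, s ∈ S T → N T ≤ s := fun h => csInf_le (hbdd _) h
  have N_hom' : ∀ r : ℝ, 0 < r → ∀ T, N (r • T) ≤ r * N T := fun r hr T => by
    rw [← div_le_iff₀' hr]
    refine le_csInf (hne T) ?_
    rintro s ⟨l, t, ht, hv, rfl⟩
    rw [div_le_iff₀' hr]
    have hsq : ‖((√r : ℝ) : ℂ)‖ ^ 2 = r := by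
      rw [Complex.norm_real, Real.norm_of_nonneg (Real.sqrt_nonneg _), Real.sq_sqrt hr.le]
    refine N_le ⟨l.map fun b => ((√r : ℝ) : ℂ) • b, r * t, by positivity, fun v => ?_, ?_⟩
    · have h1 := mul_le_mul_of_nonneg_left (hv v) hr.le
      have h2 : (l.map fun b : M => ‖((((√r : ℝ) : ℂ) • b : M) : H →L[ℂ] H) v‖ ^ 2).sum =
          r * (l.map fun b : M => ‖(b : H →L[ℂ] H) v‖ ^ 2).sum := by
        rw [← List.sum_map_mul_left]
        congr 2
        funext b
        change ‖((√r : ℝ) : ℂ) • (b : H →L[ℂ] H) v‖ ^ 2 = _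
        rw [norm_smul, mul_pow, hsq]
      have h3 : (⟪v, (r • T) v⟫_ℂ).re = r * (⟪v, T v⟫_ℂ).re := by
        rw [smul_apply, ← Complex.coe_smul, inner_smul_right, Complex.re_ofReal_mul]
      rw [List.map_map]
      change _ + (l.map fun b : M => ‖((((√r : ℝ) : ℂ) • b : M) : H →L[ℂ] H) v‖ ^ 2).sum ≤ _
      rw [h2, h3]
      linarith
    · have h2 : (l.map fun b : M => ‖g (((√r : ℝ) : ℂ) • b)‖ ^ 2).sum =
          r * (l.map fun b : M => ‖g b‖ ^ 2).sum := by
        rw [← List.sum_map_mul_left]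
        congr 2
        funext b
        rw [map_smul, norm_smul, mul_pow, hsq]
      rw [List.map_map]
      change _ = _ - (l.map fun b : M => ‖g (((√r : ℝ) : ℂ) • b)‖ ^ 2).sum
      rw [h2]
      ring
  have N_hom : ∀ r : ℝ, 0 < r → ∀ T, N (r • T) = r * N T := fun r hr T => by
    refine le_antisymm (N_hom' r hr T) ?_
    have h2 := N_hom' r⁻¹ (inv_pos.2 hr) (r • T)
    rw [smul_smul, inv_mul_cancel₀ hr.ne', one_smul] at h2
    rwa [← le_inv_mul_iff₀ hr]
  have N_add : ∀ T T', N (T + T') ≤ N T + N T' := fun T T' => by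
    rw [← sub_le_iff_le_add]
    refine le_csInf (hne T) ?_
    rintro s ⟨l, t, ht, hv, rfl⟩
    rw [sub_le_comm]
    refine le_csInf (hne T') ?_
    rintro s' ⟨l', t', ht', hv', rfl⟩
    rw [sub_le_iff_le_add]
    -- Concatenating the lists adds their sums; this is why lists of arbitrary length are allowed.
    refine N_le ⟨l ++ l', t + t', by positivity, fun v => ?_, ?_⟩
    · have h1 := hv v
      have h2 := hv' v
      simp only [add_apply, inner_add_right, Complex.add_re, List.map_append, List.sum_append]
      linarith
    · simp only [List.map_append, List.sum_append]
      ring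
  -- No prescribed values are needed, so the zero functional on the zero subspace is extended.
  obtain ⟨ω, -, hω⟩ := exists_extension_of_le_sublinear ⊥ N N_hom N_add (by
    rintro ⟨x, hx⟩
    have hx0 : x = 0 := (Submodule.mem_bot ℝ).1 hx
    subst hx0
    refine le_trans (le_of_eq ?_) (le_csInf (hne 0) (fun s hs => by simpa using hlow 0 s hs))
    exact map_zero _)
  refine ⟨ω, fun T t ht hT => (hω T).trans (N_le ⟨[], t, ht, by simpa using hT, by simp⟩),
    fun b => ?_⟩
  -- For `T = -b* b`, the list `[b]` with `t = 0` is admissible and yields `ω(-b* b) ≤ -‖g b‖²`.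
  have h1 := (hω (-(ContinuousLinearMap.adjoint (b : H →L[ℂ] H) * (b : H →L[ℂ] H)))).trans
    (N_le ⟨[b], 0, le_rfl, fun v => ?_, rfl⟩)
  · simp only [map_neg, mul_zero, List.map_cons, List.map_nil, List.sum_cons, List.sum_nil] at h1
    linarith
  · have : (⟪v, (ContinuousLinearMap.adjoint (b : H →L[ℂ] H) * (b : H →L[ℂ] H)) v⟫_ℂ).re =
        ‖(b : H →L[ℂ] H) v‖ ^ 2 := by
      rw [mul_apply_eq_comp, ContinuousLinearMap.adjoint_inner_right]
      exact (norm_sq_eq_re_inner (𝕜 := ℂ) _).symm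
    simp only [neg_apply, inner_neg_right, Complex.neg_re, this]
    simp

end Domination

/-! ### The semi-inner product of a positive functional. -/

section Core

variable {H : Type*} [NormedAddCommGroup H] [InnerProductSpace ℂ H] [CompleteSpace H]
variable {M : Subalgebra ℂ (H →L[ℂ] H)}

/-- The inner product `⟪x, y⟫ = ω(x* y)` of a positive functional `ω`. -/
@[reducible]
def positiveCore (M : Subalgebra ℂ (H →L[ℂ] H)) (ω : (H →L[ℂ] H) →ₗ[ℝ] ℝ)
    (hω : ∀ T : H →L[ℂ] H, (∀ v, (⟪v, T v⟫_ℂ).re ≤ 0) → ω T ≤ 0) :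
    PreInnerProductSpace.Core ℂ M where
  inner x y := Module.Dual.extendRCLike (𝕜 := ℂ) ω
    (ContinuousLinearMap.adjoint (x : H →L[ℂ] H) * (y : H →L[ℂ] H))
  conj_inner_symm x y := by
    -- Positivity makes `ω` vanish on skew-adjoint operators, hence invariant under the adjoint;
    -- conjugate symmetry follows from this.
    have h0 : ∀ T : H →L[ℂ] H, (∀ v, (⟪v, T v⟫_ℂ).re = 0) → ω T = 0 := fun T hT =>
      le_antisymm (hω T fun v => (hT v).le) (by
        have := hω (-T) fun v => by simp [hT v]
        rw [map_neg] at this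
        linarith)
    have hadj : ∀ T : H →L[ℂ] H, ω (ContinuousLinearMap.adjoint T) = ω T := fun T => by
      rw [← sub_eq_zero, ← map_sub]
      refine h0 _ fun v => ?_
      rw [sub_apply, inner_sub_right, ContinuousLinearMap.adjoint_inner_right, Complex.sub_re,
        ← inner_conj_symm v (T v), Complex.conj_re, sub_self]
    set S := ContinuousLinearMap.adjoint (x : H →L[ℂ] H) * (y : H →L[ℂ] H) with hS
    have h1 : ContinuousLinearMap.adjoint (y : H →L[ℂ] H) * (x : H →L[ℂ] H) =
        ContinuousLinearMap.adjoint S := by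
      rw [← ContinuousLinearMap.star_eq_adjoint, ← ContinuousLinearMap.star_eq_adjoint, hS,
        star_mul, ← ContinuousLinearMap.star_eq_adjoint, star_star]
    have h2 : Complex.I • ContinuousLinearMap.adjoint S =
        -ContinuousLinearMap.adjoint (Complex.I • S) := by
      rw [← ContinuousLinearMap.star_eq_adjoint, ← ContinuousLinearMap.star_eq_adjoint, star_smul]
      simp
    rw [h1]
    apply Complex.ext
    · have e1 := Module.Dual.re_extendRCLike_apply (𝕜 := ℂ) ω (ContinuousLinearMap.adjoint S)
      have e2 := Module.Dual.re_extendRCLike_apply (𝕜 := ℂ) ω S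
      rw [Complex.conj_re]
      exact e1.trans ((hadj S).trans e2.symm)
    · have e1 := Module.Dual.im_extendRCLike_apply (𝕜 := ℂ) ω (ContinuousLinearMap.adjoint S)
      have e2 := Module.Dual.im_extendRCLike_apply (𝕜 := ℂ) ω S
      have e3 : ω (Complex.I • ContinuousLinearMap.adjoint S) = -ω (Complex.I • S) := by
        rw [h2, map_neg, hadj]
      rw [Complex.conj_im]
      refine (congrArg Neg.neg (e1.trans (congrArg Neg.neg e3))).trans ?_
      rw [neg_neg]
      exact e2.symm
  re_inner_nonneg x := by
    have e1 := Module.Dual.re_extendRCLike_apply (𝕜 := ℂ) ω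
      (ContinuousLinearMap.adjoint (x : H →L[ℂ] H) * (x : H →L[ℂ] H))
    rw [e1]
    have := hω (-(ContinuousLinearMap.adjoint (x : H →L[ℂ] H) * (x : H →L[ℂ] H))) fun v => by
      rw [neg_apply, inner_neg_right, mul_apply_eq_comp, ContinuousLinearMap.adjoint_inner_right,
        Complex.neg_re]
      exact neg_nonpos.2 (inner_self_nonneg (𝕜 := ℂ))
    rw [map_neg] at this
    linarith
  add_left x y z := by simp [add_mul]
  smul_left x y r := by
    have h : ContinuousLinearMap.adjoint ((r • x : M) : H →L[ℂ] H) * (y : H →L[ℂ] H) =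
        starRingEnd ℂ r • (ContinuousLinearMap.adjoint (x : H →L[ℂ] H) * (y : H →L[ℂ] H)) := by
      change ContinuousLinearMap.adjoint (r • (x : H →L[ℂ] H)) * _ = _
      rw [map_smulₛₗ, smul_mul_assoc]
    rw [h, map_smul, smul_eq_mul]

theorem positiveCore_inner_self (ω : (H →L[ℂ] H) →ₗ[ℝ] ℝ)
    (hω : ∀ T : H →L[ℂ] H, (∀ v, (⟪v, T v⟫_ℂ).re ≤ 0) → ω T ≤ 0) (x : M) :
    ((positiveCore M ω hω).inner x x).re =
      ω (ContinuousLinearMap.adjoint (x : H →L[ℂ] H) * (x : H →L[ℂ] H)) :=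
  Module.Dual.re_extendRCLike_apply (𝕜 := ℂ) ω _

end Core

/-! ### Normality of averages of translates. -/

section Normality

variable {H : Type*} [NormedAddCommGroup H] [InnerProductSpace ℂ H]
variable {K : Type*} [NormedAddCommGroup K] [InnerProductSpace ℂ K]
variable {M : Subalgebra ℂ (H →L[ℂ] H)} {N : Subalgebra ℂ (K →L[ℂ] K)}

theorem CBBound.sum_list_le {β : M → K →L[ℂ] K} {B : ℝ} (hβ : CBBound β B) (ξ : K)
    (l : List M) {t : ℝ} (ht : 0 ≤ t)
    (hl : ∀ v : H, (l.map fun b : M => ‖(b : H →L[ℂ] H) v‖ ^ 2).sum ≤ t * ‖v‖ ^ 2) :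
    (l.map fun b : M => ‖β b ξ‖ ^ 2).sum ≤ B ^ 2 * ‖ξ‖ ^ 2 * t := by
  have h1 := hβ (Fin l.length) Unit (fun i _ => l[i.1]) √t (Real.sqrt_nonneg t) (fun v => by
    have := hl (v ())
    rw [← Fin.sum_univ_fun_getElem] at this
    simpa [Real.sq_sqrt ht] using this) fun _ => ξ
  rw [← Fin.sum_univ_fun_getElem]
  refine (le_of_eq ?_).trans (h1.trans (le_of_eq ?_))
  · simp
  · simp only [Finset.univ_unique, Finset.sum_singleton, mul_pow, Real.sq_sqrt ht]
    ring

/-- After pairing with scalar vectors `w`, `v`, the matrix `y` enters only through the column `b p =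
∑ v l • y p l`. So the second factor `h` need only be bounded on columns, with no larger matrix
norms. -/
theorem norm_form_le_of_column {α : M → K →L[ℂ] K} {A : ℝ} (hA : 0 ≤ A) (hα : CBBound α A)
    (η : K) (h : M →ₗ[ℂ] K) {R : ℝ} (hR : 0 ≤ R)
    (hh : ∀ (m : ℕ) (b : Fin m → M) (t : ℝ), 0 ≤ t →
      (∀ v : H, ∑ i, ‖(b i : H →L[ℂ] H) v‖ ^ 2 ≤ t ^ 2 * ‖v‖ ^ 2) →
      ∑ i, ‖h (b i)‖ ^ 2 ≤ (R * t) ^ 2)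
    (ψ : NormalForms M)
    (hψ : ∀ a b, (ψ : M →ₗ[ℂ] M →ₗ[ℂ] ℂ) a b = ⟪η, α a (h b)⟫_ℂ) : ‖ψ‖ ≤ A * ‖η‖ * R := by
  refine toReal_cbNormForm_le (by positivity) fun n x y => ?_
  have hx := (matNorm_le_iff (matNorm_nonneg x)).1 le_rfl
  have hy := (matNorm_le_iff (matNorm_nonneg y)).1 le_rfl
  have h1 := hα (Fin n) (Fin n) x _ (matNorm_nonneg x) hx
  have hx0 := matNorm_nonneg x
  have hy0 := matNorm_nonneg y
  refine scalarMatNorm_le (by positivity) fun w v => ?_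
  set b : Fin n → M := fun p => ∑ l, v l • y p l with hb
  have h2 : ∑ p, ‖h (b p)‖ ^ 2 ≤ (R * (matNorm y * √(∑ l, ‖v l‖ ^ 2))) ^ 2 := by
    refine hh n b _ (by positivity) fun z => ?_
    have h3 := hy fun l => v l • z
    have h4 : ∀ p, ∑ l, (y p l : H →L[ℂ] H) (v l • z) = (b p : H →L[ℂ] H) z := fun p => by
      simp [hb]
    simp only [h4, norm_smul, mul_pow, ← Finset.sum_mul] at h3
    rw [mul_pow, Real.sq_sqrt (by positivity)]
    linarith
  have h3 := h1.norm_sum_inner_le (by positivity) (fun k => w k • η) (fun p => h (b p))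
  have h4 : √(∑ p, ‖h (b p)‖ ^ 2) ≤ R * (matNorm y * √(∑ l, ‖v l‖ ^ 2)) :=
    Real.sqrt_le_iff.2 ⟨by positivity, h2⟩
  have h5 : √(∑ k, ‖w k • η‖ ^ 2) = √(∑ k, ‖w k‖ ^ 2) * ‖η‖ := by
    simp only [norm_smul, mul_pow, ← Finset.sum_mul]
    rw [Real.sqrt_mul (by positivity), Real.sqrt_sq (norm_nonneg _)]
  rw [h5] at h3
  refine le_trans (le_of_eq ?_) (h3.trans ?_)
  · congr 1
    refine Finset.sum_congr rfl fun k _ => ?_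
    simp only [hb, map_sum, map_smul, inner_sum, inner_smul_left, inner_smul_right, bilAmp,
      Matrix.of_apply, hψ, Finset.mul_sum, Finset.sum_mul]
    rw [Finset.sum_comm]
    refine Finset.sum_congr rfl fun p _ => Finset.sum_congr rfl fun l _ => ?_
    ring
  · calc _ ≤ A * matNorm x * (√(∑ k, ‖w k‖ ^ 2) * ‖η‖ *
          (R * (matNorm y * √(∑ l, ‖v l‖ ^ 2)))) := by gcongr
      _ = _ := by ring

/-- The right module action of `M` on `M ⊗_σh M` is weak-star continuous on coefficients of
products of completely bounded maps. -/
theorem IsDualOperatorAlgebra.wstarContinuousForm_translate [CompleteSpace H] [CompleteSpace K]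
    (hM : IsDualOperatorAlgebra M) (u : NormalHaagerup M) (α β : M →ₗ[ℂ] K →L[ℂ] K) {A B : ℝ}
    (hA : 0 ≤ A) (hα : CBBound α A) (hβ : CBBound β B)
    (hβc : ∀ η ξ, WStarContinuousForm fun b => ⟪η, β b ξ⟫_ℂ) (η ξ : K) (F : M →ₗ[ℂ] ℂ)
    (hF : ∀ x, ∃ ψ : NormalForms M,
      (∀ a b, (ψ : M →ₗ[ℂ] M →ₗ[ℂ] ℂ) a b = ⟪η, α a (β (b * x) ξ)⟫_ℂ) ∧ F x = u ψ) :
    WStarContinuousForm F := by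
  let g : M →ₗ[ℂ] K := (ContinuousLinearMap.apply ℂ K ξ).toLinearMap ∘ₗ β
  have hgdef : ∀ b, g b = β b ξ := fun b => rfl
  set c := B ^ 2 * ‖ξ‖ ^ 2 with hc
  have hc0 : 0 ≤ c := by positivity
  obtain ⟨ω, hω1, hω2⟩ := exists_positive_functional g (c := c) fun l t ht hl =>
    hβ.sum_list_le ξ l ht hl
  have hω0 : ∀ T : H →L[ℂ] H, (∀ v, (⟪v, T v⟫_ℂ).re ≤ 0) → ω T ≤ 0 := fun T hT => by
    simpa using hω1 T 0 le_rfl (by simpa using hT)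
  obtain ⟨G, _, _, _, e, he, hen⟩ := exists_hilbert_completion (positiveCore M ω hω0)
  simp only [positiveCore_inner_self] at hen
  have hre : ∀ (x : M) v, (⟪v, (ContinuousLinearMap.adjoint (x : H →L[ℂ] H) *
      (x : H →L[ℂ] H)) v⟫_ℂ).re = ‖(x : H →L[ℂ] H) v‖ ^ 2 := fun x v => by
    rw [mul_apply_eq_comp, ContinuousLinearMap.adjoint_inner_right]
    exact (norm_sq_eq_re_inner (𝕜 := ℂ) _).symm
  -- If `∑ bᵢ* bᵢ ≤ t²`, then `∑ ‖g(bᵢ x)‖² ≤ ω(x* (∑ bᵢ* bᵢ) x) ≤ t² ω(x* x) = t² ‖e x‖²`.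
  have hcol : ∀ (m : ℕ) (b : Fin m → M) (t : ℝ),
      (∀ v : H, ∑ i, ‖(b i : H →L[ℂ] H) v‖ ^ 2 ≤ t ^ 2 * ‖v‖ ^ 2) → ∀ x : M,
      ∑ i, ‖g (b i * x)‖ ^ 2 ≤ (t * ‖e x‖) ^ 2 := fun m b t hb x => by
    have h1 : ∑ i, ‖g (b i * x)‖ ^ 2 ≤ ω (∑ i, ContinuousLinearMap.adjoint
        ((b i * x : M) : H →L[ℂ] H) * ((b i * x : M) : H →L[ℂ] H)) := by
      rw [map_sum]
      exact Finset.sum_le_sum fun i _ => hω2 _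
    have h2 := hω0 (∑ i, ContinuousLinearMap.adjoint
        ((b i * x : M) : H →L[ℂ] H) * ((b i * x : M) : H →L[ℂ] H) -
        (t ^ 2) • (ContinuousLinearMap.adjoint (x : H →L[ℂ] H) * (x : H →L[ℂ] H))) fun v => by
      rw [sub_apply, sum_apply, inner_sub_right, inner_sum, Complex.sub_re, Complex.re_sum,
        smul_apply, ← Complex.coe_smul, inner_smul_right, Complex.re_ofReal_mul, hre]
      simp only [hre]
      exact sub_nonpos.2 (hb ((x : H →L[ℂ] H) v))
    rw [map_sub, map_smul, smul_eq_mul] at h2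
    rw [mul_pow, hen]
    linarith
  have hone : ∀ b x : M, ‖g (b * x)‖ ≤ ‖b‖ * ‖e x‖ := fun b x => by
    have := hcol 1 (fun _ => b) ‖b‖ (fun v => by
      simp only [Finset.univ_unique, Finset.sum_singleton, ← mul_pow]
      gcongr
      exact (b : H →L[ℂ] H).le_opNorm v) x
    simp only [Finset.univ_unique, Finset.sum_singleton] at this
    exact (pow_le_pow_iff_left₀ (norm_nonneg _) (by positivity) two_ne_zero).1 this
  have hFle : ∀ (x : M) (R : ℝ), 0 ≤ R → (∀ (m : ℕ) (b : Fin m → M) (t : ℝ), 0 ≤ t →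
      (∀ v : H, ∑ i, ‖(b i : H →L[ℂ] H) v‖ ^ 2 ≤ t ^ 2 * ‖v‖ ^ 2) →
      ∑ i, ‖g (b i * x)‖ ^ 2 ≤ (R * t) ^ 2) → ‖F x‖ ≤ ‖u‖ * (A * ‖η‖) * R := fun x R hR hx => by
    obtain ⟨ψ, h1, h2⟩ := hF x
    rw [h2, mul_assoc]
    refine (u.le_opNorm _).trans (mul_le_mul_of_nonneg_left ?_ (norm_nonneg u))
    exact norm_form_le_of_column hA hα η (g ∘ₗ LinearMap.mulRight ℂ x) hR hx ψ h1
  have hen' : ∀ x : M, ‖e x‖ ≤ √c * ‖x‖ := fun x => by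
    rw [← pow_le_pow_iff_left₀ (norm_nonneg _) (by positivity) two_ne_zero, mul_pow,
      Real.sq_sqrt hc0, hen]
    refine hω1 _ _ (by positivity) fun v => ?_
    rw [hre, ← mul_pow]
    gcongr
    exact (x : H →L[ℂ] H).le_opNorm v
  let Q : Submodule ℂ (M →ₗ[ℂ] ℂ) := traceForms M.val.toLinearMap
  -- The functional `ω` need not be normal; the approximants of `F` are normal because they are
  -- combinations of the functionals `x ↦ ⟪k, β(bx) ξ⟫`.
  refine hM.wstarContinuousForm_of_approx F fun ε hε => ?_
  obtain ⟨f, ⟨r, hfr⟩, hf⟩ := exists_approx_of_tendsto e he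
    (fun b : M => g ∘ₗ LinearMap.mulLeft ℂ b) (fun b => ⟨‖b‖, hone b⟩) F
    ⟨‖u‖ * (A * ‖η‖), fun x => hFle x _ (norm_nonneg _) fun m b t _ hb =>
      (hcol m b t hb x).trans (le_of_eq (by ring))⟩
    (fun x hx hbx => by
      rw [Metric.tendsto_atTop]
      intro ε hε
      obtain ⟨n₀, hn₀⟩ := Metric.cauchySeq_iff.1 hx (ε / (‖u‖ * (A * ‖η‖) + 1)) (by positivity)
      refine ⟨n₀, fun n hn => ?_⟩
      rw [dist_zero_right]
      refine (hFle (x n) (ε / (‖u‖ * (A * ‖η‖) + 1)) (by positivity)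
        fun m b t ht hb => ?_).trans_lt ?_
      -- As `g(bᵢ x p)` tends to zero, the column bound for `x n - x p` passes to `x n` when `p →
      -- ∞`, and the Cauchy property makes it small uniformly in `b`.
      · have h1 : Filter.Tendsto (fun p => ∑ i, ‖g (b i * (x n - x p))‖ ^ 2) Filter.atTop
            (𝓝 (∑ i, ‖g (b i * x n)‖ ^ 2)) := by
          refine tendsto_finsetSum _ fun i _ => ?_
          have h2 := (tendsto_const_nhds (x := g (b i * x n))).sub (hbx (b i))
          simp only [sub_zero] at h2
          have h3 := (h2.norm).pow 2
          simpa [mul_sub] using h3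
        refine le_of_tendsto h1 (Filter.eventually_atTop.2 ⟨n₀, fun p hp => ?_⟩)
        refine (hcol m b t hb _).trans ?_
        rw [mul_comm]
        gcongr
        rw [map_sub, ← dist_eq_norm]
        exact (hn₀ n hn p hp).le
      · rw [mul_div_assoc', div_lt_iff₀ (by positivity)]
        nlinarith)
    Q (fun b k => (WStarContinuousForm.exists_traceRep (f := (innerSL ℂ k).toLinearMap ∘ₗ
      (g ∘ₗ LinearMap.mulLeft ℂ b)) ((hβc k ξ).comp (wstarContinuous_mulLeft b))))
    (ε := ε / (√c + 1)) (by positivity)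
  refine ⟨f, hfr.wstarContinuousForm, fun a => (hf a).trans ?_⟩
  calc ε / (√c + 1) * ‖e a‖ ≤ ε / (√c + 1) * ((√c + 1) * ‖a‖) := by
        gcongr
        exact (hen' a).trans (by gcongr; linarith)
    _ = ε * ‖a‖ := by field_simp

end Normality

/-! ### The correction step of the iteration. -/

section Improve

variable {H : Type*} [NormedAddCommGroup H] [InnerProductSpace ℂ H]
variable {K : Type*} [NormedAddCommGroup K] [InnerProductSpace ℂ K]
variable {M : Subalgebra ℂ (H →L[ℂ] H)} {N : Subalgebra ℂ (K →L[ℂ] K)}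

theorem OpBound.comp_const {E F G ι κ : Type*} [NormedAddCommGroup E] [InnerProductSpace ℂ E]
    [NormedAddCommGroup F] [InnerProductSpace ℂ F] [NormedAddCommGroup G] [InnerProductSpace ℂ G]
    [Fintype ι] [Fintype κ] {x : ι → κ → F →L[ℂ] G} {C : ℝ} (hx : OpBound x C) (T : E →L[ℂ] F) :
    OpBound (fun i j => x i j ∘L T) (C * ‖T‖) := fun ξ => by
  calc _ ≤ C ^ 2 * ∑ j, ‖T (ξ j)‖ ^ 2 := hx fun j => T (ξ j)
    _ ≤ C ^ 2 * ∑ j, (‖T‖ * ‖ξ j‖) ^ 2 := by gcongr; exact T.le_opNorm _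
    _ = _ := by simp only [mul_pow, ← Finset.mul_sum, mul_assoc]

theorem CBBound.mono {α : M → K →L[ℂ] K} {A B : ℝ} (h : CBBound α A) (hA : 0 ≤ A)
    (hAB : A ≤ B) : CBBound α B := fun ι κ _ _ x C hC hx =>
  (h ι κ x C hC hx).mono (by positivity) (by gcongr)

theorem CBBound₂.mono {α : M → M → K →L[ℂ] K} {A B : ℝ} (h : CBBound₂ α A) (hA : 0 ≤ A)
    (hAB : A ≤ B) : CBBound₂ α B := fun ι _ x y C D hC hD hx hy =>
  (h ι x y C D hC hD hx hy).mono (by positivity) (by gcongr)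

theorem CBBound.add {α β : M → K →L[ℂ] K} {A B : ℝ} (hα : CBBound α A) (hβ : CBBound β B)
    (hA : 0 ≤ A) (hB : 0 ≤ B) : CBBound (fun a => α a + β a) (A + B) :=
  fun ι κ _ _ x C hC hx => by
    rw [add_mul]
    exact (hα ι κ x C hC hx).add (hβ ι κ x C hC hx) (by positivity) (by positivity)

theorem CBBound.neg {α : M → K →L[ℂ] K} {A : ℝ} (hα : CBBound α A) :
    CBBound (fun a => -α a) A :=
  fun ι κ _ _ x C hC hx => (hα ι κ x C hC hx).neg

theorem CBBound.sub {α β : M → K →L[ℂ] K} {A B : ℝ} (hα : CBBound α A) (hβ : CBBound β B)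
    (hA : 0 ≤ A) (hB : 0 ≤ B) : CBBound (fun a => α a - β a) (A + B) := by
  simpa only [sub_eq_add_neg] using hα.add hβ.neg hA hB

theorem CBBound.comp_mul_right {α : M → K →L[ℂ] K} {A : ℝ} (hα : CBBound α A) (c : M) :
    CBBound (fun a => α (a * c)) (A * ‖c‖) := fun ι κ _ _ x C hC hx => by
  have := hα ι κ (fun i j => x i j * c) (C * ‖c‖) (by positivity) (hx.comp_const (c : H →L[ℂ] H))
  rwa [mul_assoc, mul_comm ‖c‖]

theorem CBBound.comp_mul_left {α : M → K →L[ℂ] K} {A : ℝ} (hα : CBBound α A) (c : M) :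
    CBBound (fun a => α (c * a)) (A * ‖c‖) := fun ι κ _ _ x C hC hx => by
  have := hα ι κ (fun i j => c * x i j) (‖c‖ * C) (by positivity)
    (opBound_const_comp hx (c : H →L[ℂ] H))
  rwa [mul_assoc]

theorem CBBound.mul_const {α : M → K →L[ℂ] K} {A : ℝ} (hα : CBBound α A) (T : K →L[ℂ] K) :
    CBBound (fun a => α a * T) (A * ‖T‖) := fun ι κ _ _ x C hC hx => by
  have := (hα ι κ x C hC hx).comp_const T
  rwa [mul_right_comm]

theorem CBBound.const_mul {α : M → K →L[ℂ] K} {A : ℝ} (hα : CBBound α A) (T : K →L[ℂ] K) :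
    CBBound (fun a => T * α a) (‖T‖ * A) := fun ι κ _ _ x C hC hx => by
  have := opBound_const_comp (hα ι κ x C hC hx) T
  rwa [mul_assoc]

theorem CBBound.norm_le {α : M → K →L[ℂ] K} {A : ℝ} (hα : CBBound α A) (hA : 0 ≤ A) (a : M) :
    ‖α a‖ ≤ A * ‖a‖ :=
  (opBound_unit (by positivity)).1
    (hα Unit Unit (fun _ _ => a) ‖a‖ (norm_nonneg a) ((opBound_unit (norm_nonneg a)).2 le_rfl))

theorem CBBound₂.norm_le {α : M → M → K →L[ℂ] K} {A : ℝ} (hα : CBBound₂ α A) (hA : 0 ≤ A)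
    (a b : M) : ‖α a b‖ ≤ A * (‖a‖ * ‖b‖) := by
  refine (opBound_unit (by positivity)).1 ?_
  simpa using hα Unit (fun _ _ => a) (fun _ _ => b) ‖a‖ ‖b‖ (norm_nonneg a) (norm_nonneg b)
    ((opBound_unit (norm_nonneg a)).2 le_rfl) ((opBound_unit (norm_nonneg b)).2 le_rfl)

theorem CBBound.mul {α β : M → K →L[ℂ] K} {A B : ℝ} (hα : CBBound α A) (hβ : CBBound β B) :
    CBBound₂ (fun a b => α a * β b) (A * B) := fun ι _ x y C D hC hD hx hy => by
  have := (hα ι ι x C hC hx).comp (hβ ι ι y D hD hy)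
  rwa [mul_mul_mul_comm] at this

/-- Apply the amplification to `x ⊗ 1` and `1 ⊗ y`: in the sum over the middle index only `(q.1,
p.2)` survives, which leaves `B` on independent matrix entries. -/
theorem CBBound₂.opBound_kron {B : M →ₗ[ℂ] M →ₗ[ℂ] K →L[ℂ] K} {A : ℝ}
    (hB : CBBound₂ (fun a b => B a b) A) {ν ι : Type} [Fintype ν] [Fintype ι]
    {x : ν → ν → M} {y : ι → ι → M} {C D : ℝ} (hC : 0 ≤ C) (hD : 0 ≤ D)
    (hx : OpBound (fun i j => (x i j : H →L[ℂ] H)) C)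
    (hy : OpBound (fun i j => (y i j : H →L[ℂ] H)) D) :
    OpBound (fun p q : ν × ι => B (x p.1 q.1) (y p.2 q.2)) (A * (C * D)) := by
  classical
  have h := hB (ν × ι) (fun p q => if p.2 = q.2 then x p.1 q.1 else 0)
    (fun p q => if p.1 = q.1 then y p.2 q.2 else 0) C D hC hD
    (by simpa only [apply_ite (Subtype.val (p := fun a => a ∈ M)), ZeroMemClass.coe_zero] using
      hx.kronRight (ν := ι))
    (by simpa only [apply_ite (Subtype.val (p := fun a => a ∈ M)), ZeroMemClass.coe_zero] using
      hy.kronLeft (ν := ν))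
  refine Eq.mp ?_ h
  congr 1
  funext p q
  rw [Finset.sum_eq_single (q.1, p.2)]
  · simp
  · rintro ⟨r, s⟩ - hrs
    by_cases h1 : p.2 = s
    · have h2 : r ≠ q.1 := fun h2 => hrs (by rw [h1, h2])
      simp [h2]
    · simp [h1]
  · simp

/-- The bilinear map `(a, b) ↦ α(a) β(b)`. -/
def mulBilin (α β : M →ₗ[ℂ] K →L[ℂ] K) : M →ₗ[ℂ] M →ₗ[ℂ] K →L[ℂ] K :=
  (LinearMap.mul ℂ (K →L[ℂ] K)).compl₁₂ α β

/-- The multiplicativity defect of an operator valued map. -/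
def opDefect (ℓ : M →ₗ[ℂ] K →L[ℂ] K) : M →ₗ[ℂ] M →ₗ[ℂ] K →L[ℂ] K :=
  (LinearMap.mul ℂ M).compr₂ ℓ - (LinearMap.mul ℂ (K →L[ℂ] K)).compl₁₂ ℓ ℓ

theorem opDefect_apply (ℓ : M →ₗ[ℂ] K →L[ℂ] K) (a b : M) :
    opDefect ℓ a b = ℓ (a * b) - ℓ a * ℓ b := rfl

/-- Pointwise weak operator continuity with respect to the weak-star topology. -/
def VecContinuous (α : M → K →L[ℂ] K) : Prop :=
  ∀ η ξ : K, WStarContinuousForm fun a => ⟪η, α a ξ⟫_ℂ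

theorem VecContinuous.sub {α β : M → K →L[ℂ] K} (hα : VecContinuous α) (hβ : VecContinuous β) :
    VecContinuous fun a => α a - β a := fun η ξ => by
  simpa only [sub_apply, inner_sub_right] using (hα η ξ).sub (hβ η ξ)

theorem VecContinuous.add {α β : M → K →L[ℂ] K} (hα : VecContinuous α) (hβ : VecContinuous β) :
    VecContinuous fun a => α a + β a := fun η ξ => by
  have := (hα η ξ).sub (hβ (-η) ξ)
  simpa only [add_apply, inner_add_right, inner_neg_left, sub_neg_eq_add] using this

theorem VecContinuous.mul_const {α : M → K →L[ℂ] K} (hα : VecContinuous α) (T : K →L[ℂ] K) :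
    VecContinuous fun a => α a * T := fun η ξ => hα η (T ξ)

theorem VecContinuous.const_mul [CompleteSpace K] {α : M → K →L[ℂ] K} (hα : VecContinuous α)
    (T : K →L[ℂ] K) : VecContinuous fun a => T * α a := fun η ξ => by
  simpa [ContinuousLinearMap.adjoint_inner_left] using hα (ContinuousLinearMap.adjoint T η) ξ

theorem VecContinuous.comp_mul_right {α : M → K →L[ℂ] K} (hα : VecContinuous α) (c : M) :
    VecContinuous fun a => α (a * c) := fun η ξ => (hα η ξ).comp (wstarContinuous_mulRight c)

theorem VecContinuous.comp_mul_left [CompleteSpace H] {α : M → K →L[ℂ] K} (hα : VecContinuous α)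
    (c : M) : VecContinuous fun a => α (c * a) := fun η ξ =>
  (hα η ξ).comp (wstarContinuous_mulLeft c)

theorem isNormalBilinear_mul [CompleteSpace K] {α β : M →ₗ[ℂ] K →L[ℂ] K} {A B : ℝ} (hA : 0 ≤ A)
    (hB : 0 ≤ B) (hα : CBBound α A) (hβ : CBBound β B) (hαc : VecContinuous α)
    (hβc : VecContinuous β) : IsNormalBilinear (mulBilin α β) (A * B) where
  nonneg := mul_nonneg hA hB
  left b := hαc.mul_const (β b)
  right a := hβc.const_mul (α a)
  bound := hα.mul hβ

/-- A unital, weak-star continuous, completely bounded map into `N` that is almost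
multiplicative. -/
structure IsAlmostHom (N : Subalgebra ℂ (K →L[ℂ] K)) (ℓ : M →ₗ[ℂ] K →L[ℂ] K) (m d : ℝ) :
    Prop where
  mem : ∀ a, ℓ a ∈ N
  one : ℓ 1 = 1
  continuous : VecContinuous ℓ
  bound : CBBound ℓ m
  defect_bound : CBBound₂ (fun a b => opDefect ℓ a b) d

/-- The correction is `R(x) = u[ℓ(a) D(b, x)]`. The three contributions `‖u‖d²`, `‖u‖d²` and
`(‖u‖md)²` to the new defect come from `u[D] D`, `u[D(x, a) D(b, y)]` and `R(x)R(y)`. -/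
theorem IsAlmostHom.exists_improvement [CompleteSpace H] [CompleteSpace K]
    (hM : IsDualOperatorAlgebra M) (hN : IsDualOperatorAlgebra N) {u : NormalHaagerup M}
    (hu : IsNormalVirtualHDiagonal u) {ℓ : M →ₗ[ℂ] K →L[ℂ] K} {m d : ℝ} (hm : 0 ≤ m) (hd : 0 ≤ d)
    (h : IsAlmostHom N ℓ m d) :
    ∃ ℓ' : M →ₗ[ℂ] K →L[ℂ] K,
      IsAlmostHom N ℓ' (m + ‖u‖ * (m * d)) ((2 * ‖u‖ + m ^ 2 * ‖u‖ ^ 2) * d ^ 2) ∧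
      CBBound (fun a => ℓ' a - ℓ a) (‖u‖ * (m * d)) := by
  set D := opDefect ℓ with hD
  -- These crude bounds, depending on `x`, only ensure that the averages exist and lie in `N`; the
  -- sharp estimates are `hR_cb` and `hW₄_cb`.
  have hDr_cb : ∀ x, CBBound (fun b => D b x) (m * ‖x‖ + m * ‖ℓ x‖) := fun x =>
    (h.bound.comp_mul_right x).sub (h.bound.mul_const (ℓ x)) (by positivity) (by positivity)
  have hDl_cb : ∀ x, CBBound (fun b => D x b) (m * ‖x‖ + ‖ℓ x‖ * m) := fun x =>
    (h.bound.comp_mul_left x).sub (h.bound.const_mul (ℓ x)) (by positivity) (by positivity)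
  have hDr_c : ∀ x, VecContinuous (fun b => D b x) := fun x =>
    (h.continuous.comp_mul_right x).sub (h.continuous.mul_const (ℓ x))
  have hDl_c : ∀ x, VecContinuous (fun b => D x b) := fun x =>
    (h.continuous.comp_mul_left x).sub (h.continuous.const_mul (ℓ x))
  have hBR : ∀ x, IsNormalBilinear (mulBilin ℓ (D.flip x)) (m * (m * ‖x‖ + m * ‖ℓ x‖)) :=
    fun x => isNormalBilinear_mul hm (by positivity) h.bound (hDr_cb x) h.continuous (hDr_c x)
  have hB4 : ∀ x y, IsNormalBilinear (mulBilin (D x) (D.flip y))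
      ((m * ‖x‖ + ‖ℓ x‖ * m) * (m * ‖y‖ + m * ‖ℓ y‖)) := fun x y =>
    isNormalBilinear_mul (by positivity) (by positivity) (hDl_cb x) (hDr_cb y) (hDl_c x) (hDr_c y)
  choose R₀ hR₀ using fun x => (hBR x).exists_isAvg (u := u)
  choose W₄ hW₄ using fun x y => (hB4 x y).exists_isAvg (u := u)
  obtain ⟨W₂, hW₂⟩ := (isNormalBilinear_mul hm hm h.bound h.bound h.continuous
    h.continuous).exists_isAvg (u := u)
  choose W₅ hW₅ using fun x => (isNormalBilinear_mul (β := ℓ ∘ₗ LinearMap.mulRight ℂ x) hm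
    (by positivity) h.bound (h.bound.comp_mul_right x) h.continuous
    (h.continuous.comp_mul_right x)).exists_isAvg (u := u)
  let R : M →ₗ[ℂ] K →L[ℂ] K :=
    { toFun := R₀
      map_add' := fun x y => (hR₀ (x + y)).unique (((hR₀ x).add (hR₀ y)).congr
        (fun a b => by simp [mulBilin, mul_add]) rfl)
      map_smul' := fun c x => (hR₀ (c • x)).unique (((hR₀ x).smul c).congr
        (fun a b => by simp [mulBilin]) rfl) }
  have hR : ∀ x, IsAvg u (fun a b => ℓ a * D b x) (R x) := hR₀
  have hD_apply : ∀ a b, D a b = ℓ (a * b) - ℓ a * ℓ b := fun _ _ => rfl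
  have hRmem : ∀ x, R x ∈ N := fun x => (hBR x).mem_of_isAvg hN
    (fun a b => N.mul_mem (h.mem a) (N.sub_mem (h.mem _) (N.mul_mem (h.mem _) (h.mem _)))) (hR x)
  -- `D b 1` vanishes because `ℓ` is unital; the empty sum exhibits zero as the average of the zero
  -- map.
  have hR_one : R 1 = 0 := (hR 1).unique
    ((IsAvg.sum (u := u) (∅ : Finset Unit) fun _ => hR 1).congr
      (fun a b => by simp [hD_apply, h.one]) (by simp))
  -- Expanding `D` isolates `W₅ x = u[ℓ(a)ℓ(bx)]`, the only term whose normality is not immediate.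
  have hR_W : ∀ x, R x = W₅ x - W₂ * ℓ x := fun x => (hR x).unique
    (((hW₅ x).sub (hW₂.mul_right (ℓ x))).congr
      (fun a b => by simp [mulBilin, hD_apply, mul_sub, mul_assoc]) rfl)
  have hR_c : VecContinuous R := by
    have h1 : VecContinuous W₅ := fun η ξ => by
      let F : M →ₗ[ℂ] ℂ :=
        { toFun := fun x => ⟪η, W₅ x ξ⟫_ℂ
          map_add' := fun x y => by
            rw [(hW₅ (x + y)).unique (((hW₅ x).add (hW₅ y)).congr
              (fun a b => by simp [mulBilin, mul_add]) rfl), add_apply, inner_add_right]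
          map_smul' := fun c x => by
            rw [(hW₅ (c • x)).unique (((hW₅ x).smul c).congr
              (fun a b => by simp [mulBilin]) rfl), smul_apply, inner_smul_right]
            rfl }
      exact hM.wstarContinuousForm_translate u ℓ ℓ hm h.bound h.bound h.continuous η ξ F
        fun x => hW₅ x η ξ
    have h2 := h1.sub (h.continuous.const_mul W₂)
    simpa only [← hR_W] using h2
  have hW₃ : IsAvg u (fun a b => D a b) (1 - W₂) :=
    ((isAvg_mul hu ℓ h.continuous).sub hW₂).congr (fun a b => rfl) (by rw [h.one])
  have hW₃n : ‖1 - W₂‖ ≤ ‖u‖ * d := hW₃.norm_le hd h.defect_bound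
  -- The cocycle identity reduces the left side to `u[ℓ(a) D(bx, y)] - W₂ D(x, y)`. Moving `x` to
  -- the first leg and splitting `ℓ(xa) = D(x, a) + ℓ(x)ℓ(a)` gives the right side.
  have key : ∀ x y, R (x * y) - R x * ℓ y = W₄ x y + ℓ x * R y - W₂ * D x y := fun x y => by
    have h1 : IsAvg u (fun a b => ℓ (x * a) * D b y) (W₄ x y + ℓ x * R y) :=
      ((hW₄ x y).add ((hR y).mul_left (ℓ x))).congr
        (fun a b => by simp [mulBilin, hD_apply, mul_assoc]) rfl
    have h2 := IsAvg.comm hu (hR y) h1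
    refine ((hR (x * y)).sub ((hR x).mul_right (ℓ y))).unique
      ((h2.sub (hW₂.mul_right (D x y))).congr (fun a b => ?_) rfl)
    simp only [mulBilin, LinearMap.compl₁₂_apply, LinearMap.mul_apply', hD_apply, mul_assoc,
      sub_mul, mul_sub]
    abel
  have hR_cb : CBBound R (‖u‖ * (m * d)) := cbBound_of_square R fun ι _ x C hC hx => by
    classical
    have h1 : CBMat (fun i j a b => ℓ a * D b (x i j)) (m * d * C) := by
      intro ν _ X Y C₁ D₁ hC₁ hD₁ hX hY
      -- The amplified integrand factors as `ℓ(X) ⊗ 1` times the matrix with entries `D(Y k q, x i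
      -- j)`.
      have h2 := ((h.bound ν ν X C₁ hC₁ hX).kronRight (ν := ι)).comp
        (h.defect_bound.opBound_kron hD₁ hC hY hx)
      refine Eq.mp ?_ h2
      congr 1
      · funext p q
        rw [Fintype.sum_prod_type]
        refine Finset.sum_congr rfl fun k _ => ?_
        rw [Finset.sum_eq_single p.2]
        · simp [← ContinuousLinearMap.mul_def, hD]
        · intro s _ hs
          simp [hs.symm]
        · simp
      · ring
    have := IsAvg.opBound (fun i j => hR (x i j)) (by positivity) h1
    simpa only [mul_assoc] using this
  have hW₄_cb : CBBound₂ W₄ (‖u‖ * d ^ 2) := fun ι _ x y C₂ D₂ hC₂ hD₂ hx hy => by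
    have h1 : CBMat (fun i j a b => ∑ s, D (x i s) a * D b (y s j)) (d ^ 2 * (C₂ * D₂)) := by
      intro ν _ X Y C₁ D₁ hC₁ hD₁ hX hY
      -- Here the integrand is a product of two matrices of defects; the middle index combines that
      -- of `X Y` with that of `x y`, after a swap of the factors in the left matrix.
      have h2 := ((h.defect_bound.opBound_kron hC₂ hC₁ hx hX).reindex (Equiv.prodComm ν ι)
        (Equiv.prodComm ν ι)).comp (h.defect_bound.opBound_kron hD₁ hD₂ hY hy)
      refine Eq.mp ?_ h2
      congr 1
      · funext p q
        rw [Fintype.sum_prod_type]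
        rfl
      · ring
    have := IsAvg.opBound (fun i j => IsAvg.sum Finset.univ fun s => hW₄ (x i s) (y s j))
      (by positivity) h1
    simpa only [mul_assoc] using this
  refine ⟨ℓ + R, ⟨fun a => N.add_mem (h.mem a) (hRmem a), ?_, h.continuous.add hR_c,
    h.bound.add hR_cb hm (by positivity), ?_⟩, ?_⟩
  · rw [LinearMap.add_apply, hR_one, h.one, add_zero]
  · have hD' : ∀ x y, opDefect (ℓ + R) x y = (1 - W₂) * D x y + W₄ x y + -(R x * R y) :=
      fun x y => by
        have h1 : R (x * y) = W₄ x y + ℓ x * R y - W₂ * D x y + R x * ℓ y := by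
          rw [← key, sub_add_cancel]
        simp only [opDefect_apply, LinearMap.add_apply, h1, hD_apply, add_mul, mul_add, sub_mul,
          mul_sub, one_mul]
        abel
    intro ι _ x y C₁ D₁ hC₁ hD₁ hx hy
    have h1 := opBound_const_comp (h.defect_bound ι x y C₁ D₁ hC₁ hD₁ hx hy) (1 - W₂)
    have h2 := hW₄_cb ι x y C₁ D₁ hC₁ hD₁ hx hy
    have h3 := (hR_cb.mul hR_cb ι x y C₁ D₁ hC₁ hD₁ hx hy).neg
    have h4 := (h1.add h2 (by positivity) (by positivity)).add h3 (by positivity) (by positivity)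
    have h5 := h4.mono (D := (2 * ‖u‖ + m ^ 2 * ‖u‖ ^ 2) * d ^ 2 * (C₁ * D₁)) (by positivity) (by
      have : ‖1 - W₂‖ * (d * (C₁ * D₁)) ≤ ‖u‖ * d * (d * (C₁ * D₁)) := by gcongr
      linarith)
    refine Eq.mp ?_ h5
    congr 1
    funext i j
    simp only [hD', Finset.sum_add_distrib, Finset.sum_neg_distrib, ← Finset.mul_sum]
    rfl
  · simpa using hR_cb

end Improve

/-! ### Convergence of the iteration. -/

section Limit

variable {H : Type*} [NormedAddCommGroup H] [InnerProductSpace ℂ H]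
variable {K : Type*} [NormedAddCommGroup K] [InnerProductSpace ℂ K]
variable {M : Subalgebra ℂ (H →L[ℂ] H)} {N : Subalgebra ℂ (K →L[ℂ] K)}

/-- The identity is the average of the product map `(a, b) ↦ ab`, which is completely contractive.
-/
theorem one_le_norm_of_isNormalVirtualHDiagonal [CompleteSpace H] [Nontrivial H]
    {u : NormalHaagerup M} (hu : IsNormalVirtualHDiagonal u) : 1 ≤ ‖u‖ := by
  have hid : CBBound (fun a : M => (a : H →L[ℂ] H)) 1 := fun ι κ _ _ x C _ hx => by
    rwa [one_mul]
  have h1 : IsAvg u (fun a b : M => ((a * b : M) : H →L[ℂ] H)) ((1 : M) : H →L[ℂ] H) :=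
    isAvg_mul hu M.val.toLinearMap wstarContinuousForm_inner
  have h2 := h1.norm_le zero_le_one (by simpa using hid.mul hid)
  simpa using h2

theorem IsDualOperatorAlgebra.mem_of_tendsto (hN : IsDualOperatorAlgebra N)
    {f : ℕ → K →L[ℂ] K} {T : K →L[ℂ] K} (hf : ∀ n, f n ∈ N)
    (hT : Filter.Tendsto f Filter.atTop (𝓝 T)) : T ∈ N :=
  (IsClosed.mono hN norm_le_wstarTopology).mem_of_tendsto hT (Filter.Eventually.of_forall hf)

theorem WStarContinuous.vecContinuous {L : M →ₗ[ℂ] N} (hL : WStarContinuous L) :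
    VecContinuous fun a => (L a : K →L[ℂ] K) := fun η ξ =>
  @Continuous.comp _ _ _ (wstar M) (wstar N) _ _ _ (wstarContinuousForm_inner (M := N) η ξ) hL

/-- Each weak-star functional on `N`, pulled back along `L`, is a norm limit of finite sums of
vector functionals, with error at most `C ‖a‖` times the tail of `∑ ‖ηᵢ‖ ‖ξᵢ‖`. -/
theorem VecContinuous.wstarContinuous [CompleteSpace H] (hM : IsDualOperatorAlgebra M)
    {L : M →ₗ[ℂ] N} {C : ℝ} (hC : ∀ a, ‖(L a : K →L[ℂ] K)‖ ≤ C * ‖a‖)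
    (hL : VecContinuous fun a => (L a : K →L[ℂ] K)) : WStarContinuous L := by
  refine (@wstar_continuous_iff _ _ _ N _ (wstar M) _).2 fun ξ η hξ hη => ?_
  have hs := summable_inner_apply hξ hη
  let ρ : M →ₗ[ℂ] K →L[ℂ] K := N.val.toLinearMap ∘ₗ L
  refine hM.wstarContinuousForm_of_approx (tsumInner η ξ hs ∘ₗ ρ) fun ε hε => ?_
  obtain ⟨n, hn⟩ := ((((tendsto_sum_nat_add fun i => ‖η i‖ * ‖ξ i‖).const_mul C).eventually_lt_const
    (u := ε) (by simpa using hε))).exists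
  refine ⟨∑ i ∈ Finset.range n, ((innerSL ℂ (η i)).toLinearMap ∘ₗ
    (ContinuousLinearMap.apply ℂ K (ξ i)).toLinearMap) ∘ₗ ρ, ?_, fun a => ?_⟩
  · let _ : TopologicalSpace M := wstar M
    have h1 : (fun a => ∑ i ∈ Finset.range n, ⟪η i, (L a : K →L[ℂ] K) (ξ i)⟫_ℂ) =
        ⇑(∑ i ∈ Finset.range n, ((innerSL ℂ (η i)).toLinearMap ∘ₗ
          (ContinuousLinearMap.apply ℂ K (ξ i)).toLinearMap) ∘ₗ ρ) := by
      ext a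
      simp [ρ]
    exact h1 ▸ continuous_finsetSum _ fun i _ => hL (η i) (ξ i)
  · have h1 := (hasSum_nat_add_iff' n).2 (summable_inner_clm hs (ρ a)).hasSum
    have h2 : (tsumInner η ξ hs ∘ₗ ρ) a - (∑ i ∈ Finset.range n, ((innerSL ℂ (η i)).toLinearMap ∘ₗ
        (ContinuousLinearMap.apply ℂ K (ξ i)).toLinearMap) ∘ₗ ρ) a =
        ∑' i, ⟪η (i + n), ρ a (ξ (i + n))⟫_ℂ := by
      rw [h1.tsum_eq]
      simp [tsumInner]
    rw [h2]
    refine (tsum_of_norm_bounded (((summable_nat_add_iff n).2 hs).hasSum.mul_left (C * ‖a‖))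
      fun i => ?_).trans ?_
    · refine (norm_inner_le_norm _ _).trans ?_
      have := mul_le_mul_of_nonneg_left ((ρ a).le_of_opNorm_le (hC a) (ξ (i + n)))
        (norm_nonneg (η (i + n)))
      linarith
    · rw [mul_right_comm]
      gcongr

theorem OpBound.of_tendsto {E F ι κ : Type*} [NormedAddCommGroup E] [InnerProductSpace ℂ E]
    [NormedAddCommGroup F] [InnerProductSpace ℂ F] [Fintype ι] [Fintype κ]
    {x : ℕ → ι → κ → E →L[ℂ] F} {y : ι → κ → E →L[ℂ] F} {C : ℝ} (hx : ∀ n, OpBound (x n) C)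
    (h : ∀ i j, Filter.Tendsto (fun n => x n i j) Filter.atTop (𝓝 (y i j))) : OpBound y C :=
  fun ξ => by
    refine le_of_tendsto' (f := fun n => ∑ i, ‖∑ j, x n i j (ξ j)‖ ^ 2) (x := Filter.atTop) ?_
      fun n => hx n ξ
    refine tendsto_finsetSum _ fun i _ => ((tendsto_finsetSum _ fun j _ => ?_).norm).pow 2
    exact ((ContinuousLinearMap.apply ℂ F (ξ j)).continuous.tendsto _).comp (h i j)

/-- The increments `c / 2 / 2 ^ n` sum to `c`. The defect tends to zero, so the limit is
multiplicative; weak continuity passes to the norm limit because the predual is complete. -/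
theorem exists_algHom_of_isAlmostHom [CompleteSpace H] [CompleteSpace K]
    (hM : IsDualOperatorAlgebra M) (hN : IsDualOperatorAlgebra N)
    {ℓ : ℕ → M →ₗ[ℂ] K →L[ℂ] K} {m d : ℕ → ℝ} (hℓ : ∀ n, IsAlmostHom N (ℓ n) (m n) (d n))
    (hd0 : ∀ n, 0 ≤ d n) (hd : Filter.Tendsto d Filter.atTop (𝓝 0)) {c : ℝ} (hc : 0 ≤ c)
    (hcb : ∀ n, CBBound (fun a => ℓ (n + 1) a - ℓ n a) (c / 2 / 2 ^ n)) :
    ∃ π : M →ₐ[ℂ] N, VecContinuous (fun a => (π a : K →L[ℂ] K)) ∧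
      CBBound (fun a => (π a : K →L[ℂ] K) - ℓ 0 a) c := by
  have hdist : ∀ a n, dist (ℓ n a) (ℓ (n + 1) a) ≤ c * ‖a‖ / 2 / 2 ^ n := fun a n => by
    rw [dist_comm, dist_eq_norm]
    exact ((hcb n).norm_le (by positivity) a).trans (le_of_eq (by ring))
  choose p hp using fun a => cauchySeq_tendsto_of_complete (cauchySeq_of_le_geometric_two (hdist a))
  have hpn : ∀ a n, ‖p a - ℓ n a‖ ≤ c * ‖a‖ / 2 ^ n := fun a n => by
    rw [← dist_eq_norm, dist_comm]
    exact dist_le_of_le_geometric_two_of_tendsto (hdist a) (hp a) n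
  let P : M →ₗ[ℂ] K →L[ℂ] K :=
    { toFun := p
      map_add' := fun a b => tendsto_nhds_unique (hp (a + b)) (by
        simpa only [map_add] using (hp a).add (hp b))
      map_smul' := fun t a => tendsto_nhds_unique (hp (t • a)) (by
        simpa only [map_smul, RingHom.id_apply] using (hp a).const_smul t) }
  have hmem : ∀ a, P a ∈ N := fun a => hN.mem_of_tendsto (fun n => (hℓ n).mem a) (hp a)
  have hone : P 1 = 1 := tendsto_nhds_unique (hp 1) (by
    simpa only [(hℓ _).one] using tendsto_const_nhds)
  have hmul : ∀ a b, P (a * b) = P a * P b := fun a b => by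
    have h1 : Filter.Tendsto (fun n => opDefect (ℓ n) a b) Filter.atTop (𝓝 0) := by
      refine squeeze_zero_norm (fun n => (hℓ n).defect_bound.norm_le (hd0 n) a b) ?_
      simpa using hd.mul_const (‖a‖ * ‖b‖)
    exact sub_eq_zero.1 (tendsto_nhds_unique ((hp (a * b)).sub ((hp a).mul (hp b))) h1)
  refine ⟨AlgHom.ofLinearMap (P.codRestrict (Subalgebra.toSubmodule N) hmem) (Subtype.ext hone)
    fun a b => Subtype.ext (hmul a b), fun η ξ => ?_, fun ι κ _ _ x C hC hx => ?_⟩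
  · refine hM.wstarContinuousForm_of_approx (((innerSL ℂ η).toLinearMap ∘ₗ
      (ContinuousLinearMap.apply ℂ K ξ).toLinearMap) ∘ₗ P) fun ε hε => ?_
    have h0 : Filter.Tendsto (fun n : ℕ => ‖η‖ * c * ‖ξ‖ * (1 / 2) ^ n) Filter.atTop (𝓝 0) := by
      simpa using (tendsto_pow_atTop_nhds_zero_of_lt_one (r := (1 / 2 : ℝ)) (by norm_num)
        (by norm_num)).const_mul (‖η‖ * c * ‖ξ‖)
    obtain ⟨n, hn⟩ := (h0.eventually_lt_const hε).exists
    refine ⟨((innerSL ℂ η).toLinearMap ∘ₗ (ContinuousLinearMap.apply ℂ K ξ).toLinearMap) ∘ₗ ℓ n,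
      (hℓ n).continuous η ξ, fun a => ?_⟩
    change ‖⟪η, P a ξ⟫_ℂ - ⟪η, ℓ n a ξ⟫_ℂ‖ ≤ _
    rw [← inner_sub_right, ← sub_apply]
    calc _ ≤ ‖η‖ * ‖(P a - ℓ n a) ξ‖ := norm_inner_le_norm _ _
      _ ≤ ‖η‖ * (c * ‖a‖ / 2 ^ n * ‖ξ‖) := by
        gcongr
        exact (P a - ℓ n a).le_of_opNorm_le (hpn a n) ξ
      _ = ‖η‖ * c * ‖ξ‖ * (1 / 2) ^ n * ‖a‖ := by
        rw [one_div, inv_pow]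
        ring
      _ ≤ ε * ‖a‖ := by gcongr
  -- The cb-estimate is obtained by telescoping at finite stages and survives the pointwise limit on
  -- each finite matrix.
  · have hsum : ∀ n, CBBound (fun a => ℓ n a - ℓ 0 a) (c * (1 - (1 / 2) ^ n)) := fun n => by
      induction n with
      | zero => 
        intro ι κ _ _ x C hC hx ξ
        simp
      | succ n ih =>
        have h1 : (1 / 2 : ℝ) ^ n ≤ 1 := pow_le_one₀ (by norm_num) (by norm_num)
        have h2 := ih.add (hcb n) (mul_nonneg hc (by linarith)) (by positivity)
        have h3 : c * (1 - (1 / 2) ^ n) + c / 2 / 2 ^ n = c * (1 - (1 / 2) ^ (n + 1)) := by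
          rw [one_div, pow_succ, inv_pow]
          ring
        rw [h3] at h2
        simpa only [sub_add_sub_cancel'] using h2
    refine OpBound.of_tendsto (x := fun n i j => ℓ n (x i j) - ℓ 0 (x i j)) (fun n => ?_)
      fun i j => (hp (x i j)).sub_const _
    have h1 : (1 / 2 : ℝ) ^ n ≤ 1 := pow_le_one₀ (by norm_num) (by norm_num)
    refine (hsum n ι κ x C hC hx).mono (mul_nonneg (mul_nonneg hc (by linarith)) hC) ?_
    have h2 : (0 : ℝ) ≤ (1 / 2) ^ n := by positivity
    gcongr
    nlinarith

/-- The correction at stage `n` has cb-norm at most `‖u‖ (2m) (d / 2 ^ n)`, and these bounds sum to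
`4m‖u‖d`. By `h1` this total is at most `m`, which justifies the bound `2m` used for every iterate.
-/
theorem exists_seq_isAlmostHom [CompleteSpace H] [CompleteSpace K]
    (hM : IsDualOperatorAlgebra M) (hN : IsDualOperatorAlgebra N) {u : NormalHaagerup M}
    (hu : IsNormalVirtualHDiagonal u) {ℓ₀ : M →ₗ[ℂ] K →L[ℂ] K} {m d : ℝ} (hm : 0 ≤ m) (hd : 0 ≤ d)
    (h₀ : IsAlmostHom N ℓ₀ m d) (h1 : 4 * ‖u‖ * d ≤ 1)
    (h2 : (4 * ‖u‖ + 8 * m ^ 2 * ‖u‖ ^ 2) * d ≤ 1) :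
    ∃ ℓ : ℕ → M →ₗ[ℂ] K →L[ℂ] K, ℓ 0 = ℓ₀ ∧
      (∀ n, IsAlmostHom N (ℓ n) (m + 4 * m * ‖u‖ * d * (1 - (1 / 2) ^ n)) (d * (1 / 2) ^ n)) ∧
      ∀ n, CBBound (fun a => ℓ (n + 1) a - ℓ n a) (4 * m * ‖u‖ * d / 2 / 2 ^ n) := by
  set U := ‖u‖ with hU
  have hU0 : 0 ≤ U := norm_nonneg u
  let μ : ℕ → ℝ := fun n => m + 4 * m * U * d * (1 - (1 / 2) ^ n)
  let δ : ℕ → ℝ := fun n => d * (1 / 2) ^ n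
  have step : ∀ n (ℓ : {ℓ : M →ₗ[ℂ] K →L[ℂ] K // IsAlmostHom N ℓ (μ n) (δ n)}),
      ∃ ℓ' : {ℓ : M →ₗ[ℂ] K →L[ℂ] K // IsAlmostHom N ℓ (μ (n + 1)) (δ (n + 1))},
        CBBound (fun a => ℓ'.1 a - ℓ.1 a) (4 * m * U * d / 2 / 2 ^ n) := fun n ℓ => by
    have hq0 : (0 : ℝ) ≤ (1 / 2) ^ n := by positivity
    have hq1 : (1 / 2 : ℝ) ^ n ≤ 1 := pow_le_one₀ (by norm_num) (by norm_num)
    have hqs : (1 / 2 : ℝ) ^ (n + 1) = (1 / 2) ^ n / 2 := by rw [pow_succ]; ring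
    have hq2 : 4 * m * U * d / 2 / 2 ^ n = 2 * m * U * d * (1 / 2) ^ n := by
      rw [one_div, inv_pow]
      ring
    set q : ℝ := (1 / 2) ^ n
    have hr0 : 0 ≤ 4 * m * U * d := by positivity
    have hμ0 : 0 ≤ μ n := add_nonneg hm (mul_nonneg hr0 (by linarith))
    have hδ0 : 0 ≤ δ n := mul_nonneg hd hq0
    have hr1 : 4 * m * U * d ≤ m := by nlinarith
    have hμ2 : μ n ≤ 2 * m := by
      have : 4 * m * U * d * (1 - q) ≤ 4 * m * U * d := mul_le_of_le_one_right hr0 (by linarith)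
      change m + 4 * m * U * d * (1 - q) ≤ 2 * m
      linarith
    obtain ⟨ℓ', h3, h4⟩ := ℓ.2.exists_improvement hM hN hu hμ0 hδ0
    have h5 : U * (μ n * δ n) ≤ 2 * m * U * d * q := by
      calc U * (μ n * δ n) ≤ U * (2 * m * δ n) := by gcongr
        _ = 2 * m * U * d * q := by change U * (2 * m * (d * q)) = _; ring
    have h6 : 0 ≤ U * (μ n * δ n) := by positivity
    -- With `μ n ≤ 2m`, halving the defect requires `(2U + 4m²U²) d ≤ 1/2`, which is the origin of
    -- the denominator of `δ` in the theorem. The extra factor `q ≤ 1` from quadratic convergence is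
    -- discarded.
    have h7 : (2 * U + μ n ^ 2 * U ^ 2) * δ n ^ 2 ≤ δ (n + 1) := by
      calc (2 * U + μ n ^ 2 * U ^ 2) * δ n ^ 2 ≤ (2 * U + (2 * m) ^ 2 * U ^ 2) * δ n ^ 2 := by
            gcongr
        _ = ((4 * U + 8 * m ^ 2 * U ^ 2) * d) * q * (d * (q / 2)) := by
            change (2 * U + (2 * m) ^ 2 * U ^ 2) * (d * q) ^ 2 = _; ring
        _ ≤ 1 * 1 * (d * (q / 2)) := by gcongr
        _ = δ (n + 1) := by change _ = d * (1 / 2) ^ (n + 1); rw [hqs]; ring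
    refine ⟨⟨ℓ', h3.mem, h3.one, h3.continuous, h3.bound.mono (by positivity) ?_,
      h3.defect_bound.mono (by positivity) h7⟩, h4.mono h6 (hq2 ▸ h5)⟩
    change μ n + _ ≤ m + 4 * m * U * d * (1 - (1 / 2) ^ (n + 1))
    rw [hqs]
    change m + 4 * m * U * d * (1 - q) + _ ≤ _
    linarith
  choose next hnext using step
  let s : ∀ n, {ℓ : M →ₗ[ℂ] K →L[ℂ] K // IsAlmostHom N ℓ (μ n) (δ n)} := fun n =>
    Nat.rec ⟨ℓ₀, by simpa [μ, δ] using h₀⟩ next n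
  exact ⟨fun n => (s n).1, rfl, fun n => (s n).2, fun n => hnext n (s n)⟩

theorem exists_algHom_near [CompleteSpace H] [CompleteSpace K] [Nontrivial H]
    (hM : IsDualOperatorAlgebra M) (hN : IsDualOperatorAlgebra N) {u : NormalHaagerup M}
    (hu : IsNormalVirtualHDiagonal u) {ℓ : M →ₗ[ℂ] K →L[ℂ] K} {m d ε : ℝ} (hm : 0 < m)
    (hd : 0 ≤ d) (hℓ : IsAlmostHom N ℓ m d) (hε : (4 * ‖u‖ + 8 * m ^ 2 * ‖u‖ ^ 2) * d = ε)
    (hε1 : ε < 1) :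
    ∃ π : M →ₐ[ℂ] N, VecContinuous (fun a => (π a : K →L[ℂ] K)) ∧
      CBBound (fun a => (π a : K →L[ℂ] K) - ℓ a) ε := by
  have hU : 1 ≤ ‖u‖ := one_le_norm_of_isNormalVirtualHDiagonal hu
  have h8 : 0 ≤ 8 * m ^ 2 * ‖u‖ ^ 2 * d := by positivity
  have h4 : 0 ≤ 4 * ‖u‖ * d := by positivity
  obtain ⟨f, rfl, h1, h2⟩ := exists_seq_isAlmostHom hM hN hu hm.le hd hℓ
    (by linarith) (by linarith)
  have hlim : Filter.Tendsto (fun n : ℕ => d * (1 / 2) ^ n) Filter.atTop (𝓝 0) := by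
    simpa using (tendsto_pow_atTop_nhds_zero_of_lt_one (r := (1 / 2 : ℝ)) (by norm_num)
      (by norm_num)).const_mul d
  obtain ⟨π, h3, h4⟩ := exists_algHom_of_isAlmostHom hM hN h1 (fun n => by positivity) hlim
    (by positivity) h2
  refine ⟨π, h3, h4.mono (by positivity) ?_⟩
  -- The total displacement `4m‖u‖d` must not exceed `ε`. Completing the square gives `8m²‖u‖² -
  -- 4m‖u‖ ≥ -1/2`, and `4‖u‖ ≥ 4` absorbs the deficit.
  have : 0 ≤ (4 * ‖u‖ * (1 - m) + 8 * m ^ 2 * ‖u‖ ^ 2) * d := by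
    refine mul_nonneg ?_ hd
    nlinarith [sq_nonneg (4 * m * ‖u‖ - 1)]
  linarith

theorem opDefect_val_comp (L : M →ₗ[ℂ] N) (a b : M) :
    opDefect (N.val.toLinearMap ∘ₗ L) a b = (defect L a b : K →L[ℂ] K) := by
  simp [opDefect_apply, defect]

theorem isAlmostHom_val_comp {L : M →ₗ[ℂ] N} {m d : ℝ} (hm : 0 ≤ m) (hd : 0 ≤ d)
    (h1 : L 1 = 1) (hc : WStarContinuous L) (hb : cbNorm L ≤ ENNReal.ofReal m)
    (hdef : cbNorm₂ (defect L) ≤ ENNReal.ofReal d) :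
    IsAlmostHom N (N.val.toLinearMap ∘ₗ L) m d where
  mem a := (L a).2
  one := congrArg Subtype.val h1
  continuous := hc.vecContinuous
  bound := cbBound_of_cbNorm_le hm hb
  defect_bound := by
    simp only [opDefect_val_comp]
    exact cbBound₂_of_cbNorm₂_le hd hdef

end Limit

end DualOpAlg
end

theorem theorem3p2
    {H : Type*} [NormedAddCommGroup H] [InnerProductSpace ℂ H] [CompleteSpace H] [Nontrivial H]
    {K : Type*} [NormedAddCommGroup K] [InnerProductSpace ℂ K] [CompleteSpace K]
    (M : Subalgebra ℂ (H →L[ℂ] H)) (hM : DualOpAlg.IsDualOperatorAlgebra M)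
    (N : Subalgebra ℂ (K →L[ℂ] K)) (hN : DualOpAlg.IsDualOperatorAlgebra N)
    (u : DualOpAlg.NormalHaagerup M) (hu : DualOpAlg.IsNormalVirtualHDiagonal u)
    (ε μ : ℝ) (hε₀ : 0 < ε) (hε₁ : ε < 1) (hμ : 0 < μ) :
    ∃ δ : ℝ, 0 < δ ∧ δ = ε / (4 * ‖u‖ + 8 * μ ^ 2 * ‖u‖ ^ 2) ∧
      ∀ L : M →ₗ[ℂ] N, L 1 = 1 → DualOpAlg.WStarContinuous L →
        DualOpAlg.cbNorm L ≤ ENNReal.ofReal μ →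
        DualOpAlg.cbNorm₂ (DualOpAlg.defect L) ≤ ENNReal.ofReal δ →
        ∃ π : M →ₐ[ℂ] N, DualOpAlg.WStarContinuous π ∧
          DualOpAlg.cbNorm π.toLinearMap < ⊤ ∧
          DualOpAlg.cbNorm (L - π.toLinearMap) ≤ ENNReal.ofReal ε := by
  have hU : 0 < ‖u‖ :=
    zero_lt_one.trans_le (DualOpAlg.one_le_norm_of_isNormalVirtualHDiagonal hu)
  have hD : 0 < 4 * ‖u‖ + 8 * μ ^ 2 * ‖u‖ ^ 2 := by positivity
  have hδ := div_pos hε₀ hD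
  refine ⟨_, hδ, rfl, fun L hL1 hLc hLb hLd => ?_⟩
  have hb := DualOpAlg.cbBound_of_cbNorm_le hμ.le hLb
  have h₀ := DualOpAlg.isAlmostHom_val_comp hμ.le hδ.le hL1 hLc hLb hLd
  have hε := mul_div_cancel₀ ε hD.ne'
  obtain ⟨π, h3, h5⟩ := DualOpAlg.exists_algHom_near hM hN hu hμ hδ.le h₀ hε hε₁
  -- Writing `π = (π - L) + L` gives the bound `ε + μ`, used both for complete boundedness and for
  -- upgrading weak operator to weak-star continuity.
  have h6 : DualOpAlg.CBBound (fun a => (π.toLinearMap a : K →L[ℂ] K)) (ε + μ) := by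
    have := h5.add hb hε₀.le hμ.le
    simpa only [LinearMap.comp_apply, AlgHom.toLinearMap_apply, Subalgebra.coe_val,
      sub_add_cancel] using this
  have hεμ : 0 ≤ ε + μ := (add_pos hε₀ hμ).le
  have h7 : DualOpAlg.CBBound (fun a => ((L - π.toLinearMap) a : K →L[ℂ] K)) ε := by
    have := h5.neg
    simpa only [LinearMap.comp_apply, AlgHom.toLinearMap_apply, Subalgebra.coe_val, neg_sub,
      LinearMap.sub_apply, Subalgebra.coe_sub] using this
  exact ⟨π, DualOpAlg.VecContinuous.wstarContinuous (L := π.toLinearMap) hM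
      (h6.norm_le hεμ) h3,
    lt_of_le_of_lt (DualOpAlg.cbNorm_le_of_cbBound hεμ h6) ENNReal.ofReal_lt_top,
    DualOpAlg.cbNorm_le_of_cbBound hε₀.le h7⟩
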